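/- A *star-autonomous category* is a (not necessarily symmetric) linearly distributive category $(\mathcal K,\otimes,e,⅋,d)$ with, for every object $p$, a chosen right dual $p^*$ (arrows $\tau:e\to p^*⅋p$, $\gamma_p:p\otimes p^*\to d$ satisfying the linear triangle identities; we write $p\dashv p^*$) and a chosen left dual ${}^*p\dashv p$. It has *strict negations* if the canonical de Morgan isomorphisms $p^*\otimes q^*\cong(q⅋p)^*$, $(p\otimes q)^*\cong q^*⅋p^*$, $e\cong d^*$, $e^*\cong d$, their analogues for ${}^*(-)$, and the cancellation isomorphisms $p\cong({}^*p)^*$, $p\cong{}^*(p^*)$ are all identities. A *cycle* on $\mathcal K$ is a natural isomorphism $\sigma_p:p^*\to{}^*p$ compatible with the de Morgan isomorphisms $(p\otimes q)^*\cong q^*⅋p^*$, ${}^*(p\otimes q)\cong{}^*q⅋{}^*p$ and $(p⅋q)^*\cong q^*\otimes p^*$, ${}^*(p⅋q)\cong{}^*q\otimes{}^*p$; a *cyclic* star-autonomous category $(\mathcal K,\sigma)$ has a *strict negation* if it has strict negations and $\sigma$ is the identity. Let $\Sigma_{p,t}:\mathcal K(p\otimes t,d)\to\mathcal K(t\otimes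 p,d)$ be the bijection induced by $\sigma$: transpose $p\otimes t\to d$ to $t\to p^*$, compose with $\sigma_p$, and transpose back. An equivalence of star-autonomous categories is an adjoint equivalence of categories whose functors are strong monoidal for $\otimes$ and for $⅋$ and preserve the linear distributions, and whose unit and counit are monoidal for both; for cyclic categories its functors must also preserve the cycles. For $\omega:p\otimes t\to d$ and $\psi:q\otimes s\to d$ let $\mathsf{rbind}(\omega,\psi):(p\otimes q)\otimes(s⅋t)\to d$ and $\mathsf{lbind}(\omega,\psi):(p⅋q)\otimes(s\otimes t)\to d$ be the arrows that apply a linear distribution, then $\psi$, then $\omega$. Let $\mathrm{Zang}\,\mathcal K$ be the category whose objects are $\mathbb Z$-strings of linear adjoints $p=(p_n)_{n\in\mathbb Z}$, with $\tau_n:e\to p_{n+1}⅋p_n$ and $\gamma_n:p_n\otimes p_{n+1}\to d$ exhibiting $p_n\dashv p_{n+1}$, and whose arrows $\omega:p\to q$ are families $\omega_n:p_n\to q_n$ ($n$ even), $\omega_n:q_n\to p_n$ ($n$ odd) in which $\omega_n$ and $\omega_{n+1}$ are always linear mates. **Theorem.** Let $\mathcal K$ be a star-autonomous category. 1. $\mathrm{Zang}\,\mathcal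 K$ carries a star-autonomous structure with $(p\otimes q)_n=p_n\otimes q_n$ ($n$ even), $q_n⅋p_n$ ($n$ odd); $(p⅋q)_n=p_n⅋q_n$ ($n$ even), $q_n\otimes p_n$ ($n$ odd); $e_n=e$, $d_n=d$ ($n$ even), $e_n=d$, $d_n=e$ ($n$ odd); $p^*$ and ${}^*p$ the strings $p$ shifted by $+1$ and $-1$, so that $(p^*)_n=p_{n+1}$ and $({}^*p)_n=p_{n-1}$. The counit of $p\otimes q$ at $n$ is $\mathsf{rbind}(\gamma^p_n,\gamma^q_n)$ ($n$ even), $\mathsf{lbind}(\gamma^q_n,\gamma^p_n)$ ($n$ odd); that of $p⅋q$ is $\mathsf{lbind}(\gamma^p_n,\gamma^q_n)$ ($n$ even), $\mathsf{rbind}(\gamma^q_n,\gamma^p_n)$ ($n$ odd); those of $e$ and $d$ are unitors of $\otimes$. The functor $p\mapsto p_0$ preserves the linearly distributive structure strictly. The counits $p\otimes p^*\to d$ and ${}^*p\otimes p\to d$ have at index $n$ the components $\gamma_n$ and $\gamma_{n-1}$ ($n$ even), $\tau_n$ and $\tau_{n-1}$ ($n$ odd). This structure has strict negations. 2. The functor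 $\mathcal K\to\mathrm{Zang}\,\mathcal K$ sending $p$ to its canonical string $(\dots,{}^{**}p,{}^*p,p,p^*,p^{**},\dots)$ (with the chosen adjunctions) and an arrow to the string of its iterated duals, and the functor $p\mapsto p_0$, form an adjoint equivalence of star-autonomous categories. 3. Let $\sigma$ be a cycle on $\mathcal K$. There is a cycle $\hat\sigma$ on $\mathrm{Zang}\,\mathcal K$ for which the composite $p_{n+1}\cong(p_n)^*\xrightarrow{\sigma_{p_n}}{}^*(p_n)\cong p_{n-1}$ is the $n$th component of $\hat\sigma_p$ for even $n$, and of $\hat\sigma_p^{-1}$ for odd $n$ (where components point backwards); and the equivalence in 2 preserves the cycles $\sigma$ and $\hat\sigma$. 4. Let $\mathrm{Fang}\,\mathcal K$ be the full subcategory of $\mathrm{Zang}\,\mathcal K$ on those $p$ with $p_{n+1}=p_{n-1}$ and $\gamma_n=\Sigma_{p_{n-1},p_n}(\gamma_{n-1})$ for all $n\in\mathbb Z$. It is closed under $\otimes$, $⅋$, $e$, $d$, $(-)^*$ and ${}^*(-)$, and $\hat\sigma_p$ is the identity for every $p$ in $\mathrm{Fang}\,\mathcal K$. 5. Consequently $\mathrm{Fang}\,\mathcal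 K$, with the cyclic star-autonomous structure for which its inclusion in $\mathrm{Zang}\,\mathcal K$ is strict, has a strict negation, and it is equivalent to $(\mathcal K,\sigma)$ as a cyclic star-autonomous category, through $p\mapsto p_0$. So every star-autonomous category is equivalent to one with strict negations, and every cyclic star-autonomous category is equivalent to one with a strict negation. -/

import Mathlib

open CategoryTheory MonoidalCategory

universe v v₁ v₂ u u₁ u₂

namespace StarAut

/-! ### Equality of arrows and identities up to equality of objects -/

/-- An arrow "is an identity": its source and target are the same object, and the arrow is the
identity of that object. -/
def IsIdentity {C : Type u} [Category.{v} C] {X Y : C} (f : X ⟶ Y) : Prop :=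
  ∃ h : X = Y, f = eqToHom h

/-- Two arrows, whose sources and targets need only be propositionally equal, are the same. -/
def SameArrow {C : Type u} [Category.{v} C] {X Y X' Y' : C} (f : X ⟶ Y) (g : X' ⟶ Y') : Prop :=
  ∃ (h : X = X') (h' : Y = Y'), f = eqToHom h ≫ g ≫ eqToHom h'.symm

/-! ### A second monoidal structure, written `⅋` -/

/-- A category with a (second) monoidal structure, called "par". -/
class ParCategory (C : Type u) [Category.{v} C] where
  /-- the monoidal structure `(⅋, d)` -/
  par : MonoidalCategory C

section Par

variable {C : Type u} [Category.{v} C] [ParCategory C]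

/-- `X ⅋ Y` -/
def parObj (X Y : C) : C := (ParCategory.par : MonoidalCategory C).tensorObj X Y

infixr:70 " ⅋ " => parObj

variable (C) in
/-- The unit `d` of `⅋`. -/
def parUnit : C := (ParCategory.par : MonoidalCategory C).tensorUnit

/-- `X ⅋ f` -/
def parLeft (X : C) {Y Z : C} (f : Y ⟶ Z) : X ⅋ Y ⟶ X ⅋ Z :=
  (ParCategory.par : MonoidalCategory C).whiskerLeft X f

/-- `f ⅋ Z` -/
def parRight {X Y : C} (f : X ⟶ Y) (Z : C) : X ⅋ Z ⟶ Y ⅋ Z :=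
  (ParCategory.par : MonoidalCategory C).whiskerRight f Z

/-- `f ⅋ g` -/
def parHom {X Y X' Y' : C} (f : X ⟶ Y) (g : X' ⟶ Y') : X ⅋ X' ⟶ Y ⅋ Y' :=
  (ParCategory.par : MonoidalCategory C).tensorHom f g

/-- The associator of `⅋`. -/
def parAssoc (X Y Z : C) : (X ⅋ Y) ⅋ Z ≅ X ⅋ (Y ⅋ Z) :=
  (ParCategory.par : MonoidalCategory C).associator X Y Z

/-- The left unitor of `⅋`. -/
def parLambda (X : C) : parUnit C ⅋ X ≅ X :=
  (ParCategory.par : MonoidalCategory C).leftUnitor X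

/-- The right unitor of `⅋`. -/
def parRho (X : C) : X ⅋ parUnit C ≅ X :=
  (ParCategory.par : MonoidalCategory C).rightUnitor X

theorem parLeft_comp (X : C) {Y Z W : C} (f : Y ⟶ Z) (g : Z ⟶ W) :
    parLeft X (f ≫ g) = parLeft X f ≫ parLeft X g :=
  @MonoidalCategory.whiskerLeft_comp C _ ParCategory.par X _ _ _ f g

theorem parRight_comp {X Y Z : C} (f : X ⟶ Y) (g : Y ⟶ Z) (W : C) :
    parRight (f ≫ g) W = parRight f W ≫ parRight g W :=
  @MonoidalCategory.comp_whiskerRight C _ ParCategory.par _ _ _ f g W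

theorem par_exchange {W X Y Z : C} (f : W ⟶ X) (g : Y ⟶ Z) :
    parLeft W g ≫ parRight f Z = parRight f Y ≫ parLeft X g :=
  @MonoidalCategory.whisker_exchange C _ ParCategory.par _ _ _ _ f g

theorem parLambda_naturality {X Y : C} (f : X ⟶ Y) :
    parLeft (parUnit C) f ≫ (parLambda Y).hom = (parLambda X).hom ≫ f :=
  @MonoidalCategory.leftUnitor_naturality C _ ParCategory.par _ _ f

theorem parRho_naturality {X Y : C} (f : X ⟶ Y) :
    parRight f (parUnit C) ≫ (parRho Y).hom = (parRho X).hom ≫ f :=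
  @MonoidalCategory.rightUnitor_naturality C _ ParCategory.par _ _ f

theorem par_unitors_equal : (parLambda (parUnit C)).hom = (parRho (parUnit C)).hom :=
  @MonoidalCategory.unitors_equal C _ ParCategory.par

end Par

/-! ### Linearly distributive categories -/

/-- A (not necessarily symmetric) linearly distributive category: monoidal structures `(⊗, e)`
and `(⅋, d)` with the two natural linear distributions, subject to the four unit axioms and the
six associativity axioms. -/
class LinearlyDistributive (C : Type u) [Category.{v} C] extends
    MonoidalCategory C, ParCategory C where
  /-- `X ⊗ (Y ⅋ Z) ⟶ (X ⊗ Y) ⅋ Z` -/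
  distL (X Y Z : C) : X ⊗ (Y ⅋ Z) ⟶ (X ⊗ Y) ⅋ Z
  /-- `(X ⅋ Y) ⊗ Z ⟶ X ⅋ (Y ⊗ Z)` -/
  distR (X Y Z : C) : (X ⅋ Y) ⊗ Z ⟶ X ⅋ (Y ⊗ Z)
  distL_nat₁ {X X' : C} (f : X ⟶ X') (Y Z : C) :
    f ▷ (Y ⅋ Z) ≫ distL X' Y Z = distL X Y Z ≫ parRight (f ▷ Y) Z
  distL_nat₂ (X : C) {Y Y' : C} (f : Y ⟶ Y') (Z : C) :
    X ◁ parRight f Z ≫ distL X Y' Z = distL X Y Z ≫ parRight (X ◁ f) Z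
  distL_nat₃ (X Y : C) {Z Z' : C} (f : Z ⟶ Z') :
    X ◁ parLeft Y f ≫ distL X Y Z' = distL X Y Z ≫ parLeft (X ⊗ Y) f
  distR_nat₁ {X X' : C} (f : X ⟶ X') (Y Z : C) :
    parRight f Y ▷ Z ≫ distR X' Y Z = distR X Y Z ≫ parRight f (Y ⊗ Z)
  distR_nat₂ (X : C) {Y Y' : C} (f : Y ⟶ Y') (Z : C) :
    parLeft X f ▷ Z ≫ distR X Y' Z = distR X Y Z ≫ parLeft X (f ▷ Z)
  distR_nat₃ (X Y : C) {Z Z' : C} (f : Z ⟶ Z') :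
    (X ⅋ Y) ◁ f ≫ distR X Y Z' = distR X Y Z ≫ parLeft X (Y ◁ f)
  -- the unit axioms
  distL_unit_left (Y Z : C) :
    distL (𝟙_ C) Y Z ≫ parRight (λ_ Y).hom Z = (λ_ (Y ⅋ Z)).hom
  distL_unit_right (X Y : C) :
    distL X Y (parUnit C) ≫ (parRho (X ⊗ Y)).hom = X ◁ (parRho Y).hom
  distR_unit_left (Y Z : C) :
    distR (parUnit C) Y Z ≫ (parLambda (Y ⊗ Z)).hom = (parLambda Y).hom ▷ Z
  distR_unit_right (X Y : C) :
    distR X Y (𝟙_ C) ≫ parLeft X (ρ_ Y).hom = (ρ_ (X ⅋ Y)).hom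
  -- the associativity axioms
  distL_tensor (W X Y Z : C) :
    distL (W ⊗ X) Y Z ≫ parRight (α_ W X Y).hom Z =
      (α_ W X (Y ⅋ Z)).hom ≫ W ◁ distL X Y Z ≫ distL W (X ⊗ Y) Z
  distL_par (W X Y Z : C) :
    W ◁ (parAssoc X Y Z).hom ≫ distL W X (Y ⅋ Z) =
      distL W (X ⅋ Y) Z ≫ parRight (distL W X Y) Z ≫ (parAssoc (W ⊗ X) Y Z).hom
  distR_tensor (W X Y Z : C) :
    (α_ (W ⅋ X) Y Z).hom ≫ distR W X (Y ⊗ Z) =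
      distR W X Y ▷ Z ≫ distR W (X ⊗ Y) Z ≫ parLeft W (α_ X Y Z).hom
  distR_par (W X Y Z : C) :
    distR (W ⅋ X) Y Z ≫ (parAssoc W X (Y ⊗ Z)).hom =
      (parAssoc W X Y).hom ▷ Z ≫ distR W (X ⅋ Y) Z ≫ parLeft W (distR X Y Z)
  distL_distR (W X Y Z : C) :
    (α_ W (X ⅋ Y) Z).hom ≫ W ◁ distR X Y Z ≫ distL W X (Y ⊗ Z) =
      distL W X Y ▷ Z ≫ distR (W ⊗ X) Y Z
  distR_distL (W X Y Z : C) :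
    distL (W ⅋ X) Y Z ≫ parRight (distR W X Y) Z ≫ (parAssoc W (X ⊗ Y) Z).hom =
      distR W X (Y ⅋ Z) ≫ parLeft W (distL X Y Z)

open LinearlyDistributive (distL distR)

/-! ### Linear adjoints and mates -/

section Adjoints

variable {C : Type u} [Category.{v} C] [LinearlyDistributive C]

/-- A linear adjunction `x ⊣ y`: arrows `τ : e ⟶ y ⅋ x` and `γ : x ⊗ y ⟶ d` satisfying the linear
triangle identities. -/
@[ext]
structure LinearAdjoint (x y : C) where
  /-- the unit -/
  τ : 𝟙_ C ⟶ y ⅋ x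
  /-- the counit -/
  γ : x ⊗ y ⟶ parUnit C
  triangle_left :
    (ρ_ x).inv ≫ x ◁ τ ≫ distL x y x ≫ parRight γ x ≫ (parLambda x).hom = 𝟙 x
  triangle_right :
    (λ_ y).inv ≫ τ ▷ y ≫ distR y x y ≫ parLeft y γ ≫ (parRho y).hom = 𝟙 y

namespace LinearAdjoint

variable {x y : C} (a : LinearAdjoint x y)

/-- The transpose `t ⟶ y` of an arrow `x ⊗ t ⟶ d`, for `x ⊣ y`. -/
def lCurry {t : C} (ω : x ⊗ t ⟶ parUnit C) : t ⟶ y :=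
  (λ_ t).inv ≫ a.τ ▷ t ≫ distR y x t ≫ parLeft y ω ≫ (parRho y).hom

/-- The transpose `t ⟶ x` of an arrow `t ⊗ y ⟶ d`, for `x ⊣ y`. -/
def rCurry {t : C} (ψ : t ⊗ y ⟶ parUnit C) : t ⟶ x :=
  (ρ_ t).inv ≫ t ◁ a.τ ≫ distL t y x ≫ parRight ψ x ≫ (parLambda x).hom

theorem whiskerLeft_lCurry {t : C} (ω : x ⊗ t ⟶ parUnit C) : x ◁ a.lCurry ω ≫ a.γ = ω := by
  have h1 : x ◁ (parRho y).hom ≫ a.γ =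
      distL x y (parUnit C) ≫ parRight a.γ (parUnit C) ≫ (parRho (parUnit C)).hom := by
    rw [← LinearlyDistributive.distL_unit_right, Category.assoc, parRho_naturality]
  have h2 : x ◁ parLeft y ω ≫ x ◁ (parRho y).hom ≫ a.γ =
      distL x y (x ⊗ t) ≫ parRight a.γ (x ⊗ t) ≫ (parLambda (x ⊗ t)).hom ≫ ω := by
    rw [h1, ← Category.assoc, LinearlyDistributive.distL_nat₃, Category.assoc,
      ← Category.assoc (parLeft _ _), par_exchange, Category.assoc, ← par_unitors_equal,
      parLambda_naturality]
  have h3 : x ◁ distR y x t ≫ distL x y (x ⊗ t) ≫ parRight a.γ (x ⊗ t) ≫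
        (parLambda (x ⊗ t)).hom =
      (α_ x (y ⅋ x) t).inv ≫ distL x y x ▷ t ≫ parRight a.γ x ▷ t ≫ (parLambda x).hom ▷ t := by
    rw [← LinearlyDistributive.distR_unit_left, ← Category.assoc (parRight a.γ x ▷ t),
      LinearlyDistributive.distR_nat₁, Category.assoc, Iso.eq_inv_comp,
      ← Category.assoc (distL x y x ▷ t), ← LinearlyDistributive.distL_distR]
    simp only [Category.assoc]
  have h4 := congrArg (fun f => f ▷ t) a.triangle_left
  simp only [comp_whiskerRight, id_whiskerRight] at h4
  unfold lCurry
  simp only [MonoidalCategory.whiskerLeft_comp, Category.assoc]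
  rw [h2, ← Category.assoc (parRight _ _), ← Category.assoc (distL _ _ _),
    ← Category.assoc (x ◁ distR _ _ _), h3]
  simp only [Category.assoc]
  have h5 : x ◁ (λ_ t).inv ≫ x ◁ a.τ ▷ t ≫ (α_ x (y ⅋ x) t).inv =
      (ρ_ x).inv ▷ t ≫ (x ◁ a.τ) ▷ t := by
    simp
  rw [reassoc_of% h5, reassoc_of% h4]

theorem lCurry_whiskerLeft {t : C} (g : t ⟶ y) : a.lCurry (x ◁ g ≫ a.γ) = g := by
  unfold lCurry
  rw [parLeft_comp, Category.assoc, ← Category.assoc (distR _ _ _),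
    ← LinearlyDistributive.distR_nat₃]
  simp only [Category.assoc]
  rw [← whisker_exchange_assoc, ← leftUnitor_inv_naturality_assoc, a.triangle_right,
    Category.comp_id]

theorem whiskerRight_rCurry {t : C} (ψ : t ⊗ y ⟶ parUnit C) : a.rCurry ψ ▷ y ≫ a.γ = ψ := by
  have h1 : (parLambda x).hom ▷ y ≫ a.γ =
      distR (parUnit C) x y ≫ parLeft (parUnit C) a.γ ≫ (parLambda (parUnit C)).hom := by
    rw [← LinearlyDistributive.distR_unit_left, Category.assoc, parLambda_naturality]
  have h2 : parRight ψ x ▷ y ≫ (parLambda x).hom ▷ y ≫ a.γ =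
      distR (t ⊗ y) x y ≫ parLeft (t ⊗ y) a.γ ≫ (parRho (t ⊗ y)).hom ≫ ψ := by
    rw [h1, ← Category.assoc, LinearlyDistributive.distR_nat₁, Category.assoc,
      ← Category.assoc (parRight _ _), ← par_exchange, Category.assoc, par_unitors_equal,
      parRho_naturality]
  have h3 : distL t y x ▷ y ≫ distR (t ⊗ y) x y ≫ parLeft (t ⊗ y) a.γ ≫
        (parRho (t ⊗ y)).hom =
      (α_ t (y ⅋ x) y).hom ≫ t ◁ distR y x y ≫ t ◁ parLeft y a.γ ≫ t ◁ (parRho y).hom := by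
    rw [← LinearlyDistributive.distL_unit_right, ← Category.assoc (t ◁ parLeft y a.γ),
      LinearlyDistributive.distL_nat₃, ← Category.assoc (distL t y x ▷ y),
      ← LinearlyDistributive.distL_distR]
    simp only [Category.assoc]
  have h4 := congrArg (fun f => t ◁ f) a.triangle_right
  simp only [MonoidalCategory.whiskerLeft_comp, MonoidalCategory.whiskerLeft_id] at h4
  unfold rCurry
  simp only [comp_whiskerRight, Category.assoc]
  rw [h2, ← Category.assoc (parLeft _ _), ← Category.assoc (distR _ _ _),
    ← Category.assoc (distL _ _ _ ▷ _), h3]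
  simp only [Category.assoc]
  have h5 : (ρ_ t).inv ▷ y ≫ (t ◁ a.τ) ▷ y ≫ (α_ t (y ⅋ x) y).hom =
      t ◁ (λ_ y).inv ≫ t ◁ a.τ ▷ y := by
    simp
  rw [reassoc_of% h5, reassoc_of% h4]

theorem rCurry_whiskerRight {t : C} (f : t ⟶ x) : a.rCurry (f ▷ y ≫ a.γ) = f := by
  unfold rCurry
  rw [parRight_comp, Category.assoc, ← Category.assoc (distL _ _ _),
    ← LinearlyDistributive.distL_nat₁]
  simp only [Category.assoc]
  rw [whisker_exchange_assoc, ← rightUnitor_inv_naturality_assoc, a.triangle_left,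
    Category.comp_id]

end LinearAdjoint

/-- For linear adjunctions `a : x ⊣ y` and `a' : x' ⊣ y'`, the arrows `f : x ⟶ x'` and
`g : y' ⟶ y` are (linear) mates; see `isMate_iff` for the form of this relation which exhibits
`g` as the transpose of `f`, and `isMate_iff'` for the one which exhibits `f` as the transpose
of `g`. -/
def IsMate {x y x' y' : C} (a : LinearAdjoint x y) (a' : LinearAdjoint x' y')
    (f : x ⟶ x') (g : y' ⟶ y) : Prop :=
  f ▷ y' ≫ a'.γ = x ◁ g ≫ a.γ

theorem isMate_iff {x y x' y' : C} (a : LinearAdjoint x y) (a' : LinearAdjoint x' y')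
    (f : x ⟶ x') (g : y' ⟶ y) : IsMate a a' f g ↔
      g = (λ_ y').inv ≫ a.τ ▷ y' ≫ distR y x y' ≫ parLeft y (f ▷ y' ≫ a'.γ) ≫ (parRho y).hom := by
  constructor
  · intro h
    exact (a.lCurry_whiskerLeft g).symm.trans (congrArg a.lCurry h.symm)
  · intro h
    have h' : g = a.lCurry (f ▷ y' ≫ a'.γ) := h
    rw [IsMate, h', a.whiskerLeft_lCurry]

theorem isMate_iff' {x y x' y' : C} (a : LinearAdjoint x y) (a' : LinearAdjoint x' y')
    (f : x ⟶ x') (g : y' ⟶ y) : IsMate a a' f g ↔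
      f = (ρ_ x).inv ≫ x ◁ a'.τ ≫ distL x y' x' ≫ parRight (x ◁ g ≫ a.γ) x' ≫
        (parLambda x').hom := by
  constructor
  · intro h
    exact (a'.rCurry_whiskerRight f).symm.trans (congrArg a'.rCurry h)
  · intro h
    have h' : f = a'.rCurry (x ◁ g ≫ a.γ) := h
    rw [IsMate, h', a'.whiskerRight_rCurry]

theorem IsMate.id {x y : C} (a : LinearAdjoint x y) : IsMate a a (𝟙 x) (𝟙 y) := by
  simp [IsMate]

theorem IsMate.comp {x y x' y' x'' y'' : C} {a : LinearAdjoint x y} {a' : LinearAdjoint x' y'}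
    {a'' : LinearAdjoint x'' y''} {f : x ⟶ x'} {g : y' ⟶ y} {f' : x' ⟶ x''} {g' : y'' ⟶ y'}
    (h : IsMate a a' f g) (h' : IsMate a' a'' f' g') : IsMate a a'' (f ≫ f') (g' ≫ g) := by
  unfold IsMate at *
  rw [comp_whiskerRight, Category.assoc, h', ← whisker_exchange_assoc, h,
    MonoidalCategory.whiskerLeft_comp, Category.assoc]

/-- From `ω : p ⊗ t ⟶ d` and `ψ : q ⊗ s ⟶ d`, the composite
`(p ⅋ q) ⊗ (s ⊗ t) ⟶ ((p ⅋ q) ⊗ s) ⊗ t ⟶ (p ⅋ (q ⊗ s)) ⊗ t ⟶ (p ⅋ d) ⊗ t ⟶ p ⊗ t ⟶ d`. -/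
def lbind {p q s t : C} (ω : p ⊗ t ⟶ parUnit C) (ψ : q ⊗ s ⟶ parUnit C) :
    (p ⅋ q) ⊗ (s ⊗ t) ⟶ parUnit C :=
  (α_ (p ⅋ q) s t).inv ≫ distR p q s ▷ t ≫ parLeft p ψ ▷ t ≫ (parRho p).hom ▷ t ≫ ω

/-- From `ω : p ⊗ t ⟶ d` and `ψ : q ⊗ s ⟶ d`, the composite
`(p ⊗ q) ⊗ (s ⅋ t) ⟶ p ⊗ (q ⊗ (s ⅋ t)) ⟶ p ⊗ ((q ⊗ s) ⅋ t) ⟶ p ⊗ (d ⅋ t) ⟶ p ⊗ t ⟶ d`. -/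
def rbind {p q s t : C} (ω : p ⊗ t ⟶ parUnit C) (ψ : q ⊗ s ⟶ parUnit C) :
    (p ⊗ q) ⊗ (s ⅋ t) ⟶ parUnit C :=
  (α_ p q (s ⅋ t)).hom ≫ p ◁ distL q s t ≫ p ◁ parRight ψ t ≫ p ◁ (parLambda t).hom ≫ ω

end Adjoints

/-! ### Star-autonomous categories -/

/-- A star-autonomous category: a linearly distributive category with, for every object `p`, a
chosen right dual `perp p` (written `p^*` below) and a chosen left dual `prep p` (written
`*p` below). -/
class StarAutonomous (C : Type u) [Category.{v} C] extends LinearlyDistributive C where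
  /-- the object `p^*` -/
  perp : C → C
  /-- the object `*p` -/
  prep : C → C
  /-- the chosen linear adjunction `p ⊣ p^*` -/
  perpAdj (p : C) : LinearAdjoint p (perp p)
  /-- the chosen linear adjunction `*p ⊣ p` -/
  prepAdj (p : C) : LinearAdjoint (prep p) p

open StarAutonomous (perp prep perpAdj prepAdj)

section Negations

variable {C : Type u} [Category.{v} C] [StarAutonomous C]

/-- The action of `(-)^*` on arrows. -/
def perpMap {p q : C} (f : p ⟶ q) : perp q ⟶ perp p :=
  (perpAdj p).lCurry (f ▷ perp q ≫ (perpAdj q).γ)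

/-- The action of `*(-)` on arrows. -/
def prepMap {p q : C} (f : p ⟶ q) : prep q ⟶ prep p :=
  (prepAdj p).rCurry (prep q ◁ f ≫ (prepAdj q).γ)

theorem isMate_perpMap {p q : C} (f : p ⟶ q) :
    IsMate (perpAdj p) (perpAdj q) f (perpMap f) :=
  (isMate_iff _ _ _ _).2 rfl

theorem isMate_prepMap {p q : C} (f : p ⟶ q) :
    IsMate (prepAdj q) (prepAdj p) (prepMap f) f :=
  (isMate_iff' _ _ _ _).2 rfl

theorem perpMap_id (p : C) : perpMap (𝟙 p) = 𝟙 (perp p) :=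
  ((isMate_iff _ _ _ _).1 (IsMate.id (perpAdj p))).symm

theorem prepMap_id (p : C) : prepMap (𝟙 p) = 𝟙 (prep p) :=
  ((isMate_iff' _ _ _ _).1 (IsMate.id (prepAdj p))).symm

theorem perpMap_comp {p q r : C} (f : p ⟶ q) (g : q ⟶ r) :
    perpMap (f ≫ g) = perpMap g ≫ perpMap f :=
  ((isMate_iff _ _ _ _).1 ((isMate_perpMap f).comp (isMate_perpMap g))).symm

theorem prepMap_comp {p q r : C} (f : p ⟶ q) (g : q ⟶ r) :
    prepMap (f ≫ g) = prepMap g ≫ prepMap f :=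
  ((isMate_iff' _ _ _ _).1 ((isMate_prepMap g).comp (isMate_prepMap f))).symm

/-! The de Morgan and cancellation isomorphisms.  Each is an isomorphism between two duals of one
object; we write it as an arrow into the chosen dual, which is the transpose of the counit that
exhibits the other object as a dual. -/

/-- `p^* ⊗ q^* ⟶ (q ⅋ p)^*` -/
def perpOfPar (p q : C) : perp p ⊗ perp q ⟶ perp (q ⅋ p) :=
  (perpAdj (q ⅋ p)).lCurry (lbind (perpAdj q).γ (perpAdj p).γ)

/-- `q^* ⅋ p^* ⟶ (p ⊗ q)^*` -/
def perpOfTensor (p q : C) : perp q ⅋ perp p ⟶ perp (p ⊗ q) :=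
  (perpAdj (p ⊗ q)).lCurry (rbind (perpAdj p).γ (perpAdj q).γ)

variable (C) in
/-- `e ⟶ d^*` -/
def perpOfParUnit : 𝟙_ C ⟶ perp (parUnit C) :=
  (perpAdj (parUnit C)).lCurry (ρ_ (parUnit C)).hom

variable (C) in
/-- `d ⟶ e^*` -/
def perpOfUnit : parUnit C ⟶ perp (𝟙_ C) :=
  (perpAdj (𝟙_ C)).lCurry (λ_ (parUnit C)).hom

/-- `*p ⊗ *q ⟶ *(q ⅋ p)` -/
def prepOfPar (p q : C) : prep p ⊗ prep q ⟶ prep (q ⅋ p) :=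
  (prepAdj (q ⅋ p)).rCurry (rbind (prepAdj p).γ (prepAdj q).γ)

/-- `*q ⅋ *p ⟶ *(p ⊗ q)` -/
def prepOfTensor (p q : C) : prep q ⅋ prep p ⟶ prep (p ⊗ q) :=
  (prepAdj (p ⊗ q)).rCurry (lbind (prepAdj q).γ (prepAdj p).γ)

variable (C) in
/-- `e ⟶ *d` -/
def prepOfParUnit : 𝟙_ C ⟶ prep (parUnit C) :=
  (prepAdj (parUnit C)).rCurry (λ_ (parUnit C)).hom

variable (C) in
/-- `d ⟶ *e` -/
def prepOfUnit : parUnit C ⟶ prep (𝟙_ C) :=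
  (prepAdj (𝟙_ C)).rCurry (ρ_ (parUnit C)).hom

/-- `p ⟶ (*p)^*` -/
def cancelPrepPerp (p : C) : p ⟶ perp (prep p) :=
  (perpAdj (prep p)).lCurry (prepAdj p).γ

/-- `p ⟶ *(p^*)` -/
def cancelPerpPrep (p : C) : p ⟶ prep (perp p) :=
  (prepAdj (perp p)).rCurry (perpAdj p).γ

variable (C) in
/-- A star-autonomous category has strict negations if all of the de Morgan and cancellation
isomorphisms are identities. -/
structure HasStrictNegations : Prop where
  perp_par (p q : C) : IsIdentity (perpOfPar p q)
  perp_tensor (p q : C) : IsIdentity (perpOfTensor p q)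
  perp_parUnit : IsIdentity (perpOfParUnit C)
  perp_unit : IsIdentity (perpOfUnit C)
  prep_par (p q : C) : IsIdentity (prepOfPar p q)
  prep_tensor (p q : C) : IsIdentity (prepOfTensor p q)
  prep_parUnit : IsIdentity (prepOfParUnit C)
  prep_unit : IsIdentity (prepOfUnit C)
  perp_prep (p : C) : IsIdentity (cancelPrepPerp p)
  prep_perp (p : C) : IsIdentity (cancelPerpPrep p)

/-! ### Cyclic star-autonomous categories -/

variable (C) in
/-- A cycle on a star-autonomous category: a natural isomorphism `p^* ⟶ *p` which is compatible
with the de Morgan isomorphisms for `⊗` and with those for `⅋`. -/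
structure StarCycle where
  /-- the component `p^* ≅ *p` -/
  iso (p : C) : perp p ≅ prep p
  naturality {p q : C} (f : p ⟶ q) :
    perpMap f ≫ (iso p).hom = (iso q).hom ≫ prepMap f
  tensor (p q : C) :
    perpOfTensor p q ≫ (iso (p ⊗ q)).hom =
      parHom (iso q).hom (iso p).hom ≫ prepOfTensor p q
  par (p q : C) :
    perpOfPar q p ≫ (iso (p ⅋ q)).hom = ((iso q).hom ⊗ₘ (iso p).hom) ≫ prepOfPar q p

/-- The bijection `Hom(p ⊗ t, d) → Hom(t ⊗ p, d)` corresponding to a cycle (the "upper case" form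
of the cycle): transpose to `t ⟶ p^*`, compose with `p^* ⟶ *p`, and transpose back. -/
def StarCycle.rotate (σ : StarCycle C) {p t : C} (ω : p ⊗ t ⟶ parUnit C) : t ⊗ p ⟶ parUnit C :=
  ((perpAdj p).lCurry ω ≫ (σ.iso p).hom) ▷ p ≫ (prepAdj p).γ

/-- A cyclic star-autonomous category has a strict negation if it has strict negations and its
cycle is the identity. -/
structure StarCycle.IsStrictNegation (σ : StarCycle C) : Prop where
  hasStrictNegations : HasStrictNegations C
  isIdentity (p : C) : IsIdentity (σ.iso p).hom

/-- A class of objects is closed under all the star-autonomous operations. -/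
structure IsStarClosed (P : ObjectProperty C) : Prop where
  tensor {p q : C} : P p → P q → P (p ⊗ q)
  par {p q : C} : P p → P q → P (p ⅋ q)
  unit : P (𝟙_ C)
  parUnit : P (parUnit C)
  perp {p : C} : P p → P (perp p)
  prep {p : C} : P p → P (prep p)

end Negations

/-! ### Functors and equivalences -/

section Functors

variable {C : Type u₁} [Category.{v₁} C] {D : Type u₂} [Category.{v₂} D]

section LD

variable [LinearlyDistributive C] [LinearlyDistributive D]

/-- The structure of a strong functor of linearly distributive categories: strong monoidal for
`⊗` and for `⅋`, and compatible with the linear distributions. -/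
structure LDFunctor (F : C ⥤ D) where
  /-- `F` is strong monoidal for `⊗` -/
  tens : F.Monoidal
  /-- `F` is strong monoidal for `⅋` -/
  par : @Functor.Monoidal C _ ParCategory.par D _ ParCategory.par F
  map_distL (X Y Z : C) :
    F.obj X ◁ (par.μ Y Z : F.obj Y ⅋ F.obj Z ⟶ F.obj (Y ⅋ Z)) ≫ tens.μ X (Y ⅋ Z) ≫
        F.map (distL X Y Z) =
      distL (F.obj X) (F.obj Y) (F.obj Z) ≫ parRight (tens.μ X Y) (F.obj Z) ≫
        (par.μ (X ⊗ Y) Z : F.obj (X ⊗ Y) ⅋ F.obj Z ⟶ F.obj ((X ⊗ Y) ⅋ Z))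
  map_distR (X Y Z : C) :
    (par.μ X Y : F.obj X ⅋ F.obj Y ⟶ F.obj (X ⅋ Y)) ▷ F.obj Z ≫ tens.μ (X ⅋ Y) Z ≫
        F.map (distR X Y Z) =
      distR (F.obj X) (F.obj Y) (F.obj Z) ≫ parLeft (F.obj X) (tens.μ Y Z) ≫
        (par.μ X (Y ⊗ Z) : F.obj X ⅋ F.obj (Y ⊗ Z) ⟶ F.obj (X ⅋ (Y ⊗ Z)))

namespace LDFunctor

variable {F : C ⥤ D} (M : LDFunctor F)

/-- `F p ⊗ F q ⟶ F (p ⊗ q)` -/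
def μ (p q : C) : F.obj p ⊗ F.obj q ⟶ F.obj (p ⊗ q) := M.tens.μ p q

/-- `e ⟶ F e` -/
def ε : 𝟙_ D ⟶ F.obj (𝟙_ C) := M.tens.ε

/-- `F p ⅋ F q ⟶ F (p ⅋ q)` -/
def parμ (p q : C) : F.obj p ⅋ F.obj q ⟶ F.obj (p ⅋ q) := M.par.μ p q

/-- `d ⟶ F d` -/
def parε : parUnit D ⟶ F.obj (parUnit C) := M.par.ε

/-- `F d ⟶ d`, the inverse of `parε` -/
def parη : F.obj (parUnit C) ⟶ parUnit D := M.par.η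

/-- `F` preserves the two monoidal structures strictly (and so, by the coherence conditions, also
the structural isomorphisms and the linear distributions). -/
structure IsStrict : Prop where
  μ (p q : C) : IsIdentity (M.μ p q)
  ε : IsIdentity M.ε
  parμ (p q : C) : IsIdentity (M.parμ p q)
  parε : IsIdentity M.parε

end LDFunctor

/-- The structure of an (adjoint) equivalence of linearly distributive categories on an adjoint
equivalence of categories: both functors are strong functors of linearly distributive categories,
and the unit and counit are monoidal for `⊗` and for `⅋`. -/
structure LDEquivalence (E : C ≌ D) where
  /-- the structure of `E.functor` -/
  functor : LDFunctor E.functor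
  /-- the structure of `E.inverse` -/
  inverse : LDFunctor E.inverse
  tens_isMonoidal : @Equivalence.IsMonoidal C _ _ D _ _ E functor.tens inverse.tens
  par_isMonoidal : @Equivalence.IsMonoidal C _ ParCategory.par D _ ParCategory.par E
    functor.par inverse.par

end LD

section Star

variable [StarAutonomous C] [StarAutonomous D] {F : C ⥤ D} (M : LDFunctor F)

namespace LDFunctor

/-- The canonical comparison `F (p^*) ⟶ (F p)^*`. -/
def perpComparison (p : C) : F.obj (perp p) ⟶ perp (F.obj p) :=
  (perpAdj (F.obj p)).lCurry (M.μ p (perp p) ≫ F.map (perpAdj p).γ ≫ M.parη)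

/-- The canonical comparison `F (*p) ⟶ *(F p)`. -/
def prepComparison (p : C) : F.obj (prep p) ⟶ prep (F.obj p) :=
  (prepAdj (F.obj p)).rCurry (M.μ (prep p) p ≫ F.map (prepAdj p).γ ≫ M.parη)

/-- `F` preserves all of the star-autonomous structure strictly. -/
structure IsStarStrict : Prop extends M.IsStrict where
  perp (p : C) : IsIdentity (M.perpComparison p)
  prep (p : C) : IsIdentity (M.prepComparison p)

/-- `F` carries one cycle to another. -/
def PreservesCycle (σ : StarCycle C) (σ' : StarCycle D) : Prop :=
  ∀ p : C, F.map (σ.iso p).hom ≫ M.prepComparison p =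
    M.perpComparison p ≫ (σ'.iso (F.obj p)).hom

end LDFunctor

end Star

end Functors

/-! ### Z-strings of linear adjoints -/

/-- A `ℤ`-string of linear adjoints: objects `p n` with linear adjunctions `p n ⊣ p (n + 1)`.
(The adjunctions are indexed by all pairs `m`, `n` with `n = m + 1`, so that strings may be
shifted without transport along equalities of objects.) -/
structure ZString (C : Type u) [Category.{v} C] [LinearlyDistributive C] where
  /-- the objects of the string -/
  obj : ℤ → C
  /-- the linear adjunctions of the string -/
  adj (m n : ℤ) (h : n = m + 1) : LinearAdjoint (obj m) (obj n)

namespace ZString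

section

variable {C : Type u} [Category.{v} C] [LinearlyDistributive C]

/-- `γ n : p n ⊗ p (n + 1) ⟶ d` -/
abbrev γ (p : ZString C) (m n : ℤ) (h : n = m + 1) : p.obj m ⊗ p.obj n ⟶ parUnit C :=
  (p.adj m n h).γ

/-- `τ n : e ⟶ p (n + 1) ⅋ p n` -/
abbrev τ (p : ZString C) (m n : ℤ) (h : n = m + 1) : 𝟙_ C ⟶ p.obj n ⅋ p.obj m :=
  (p.adj m n h).τ

/-- A `ℤ`-string of mates: arrows `p n ⟶ q n` for even `n` and `q n ⟶ p n` for odd `n`, any two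
consecutive ones of which are mates. -/
@[ext]
structure Hom (p q : ZString C) where
  /-- the components at even indices -/
  even (n : ℤ) (hn : Even n) : p.obj n ⟶ q.obj n
  /-- the components at odd indices -/
  odd (n : ℤ) (hn : Odd n) : q.obj n ⟶ p.obj n
  mate_even (m n : ℤ) (h : n = m + 1) (hm : Even m) (hn : Odd n) :
    IsMate (p.adj m n h) (q.adj m n h) (even m hm) (odd n hn)
  mate_odd (m n : ℤ) (h : n = m + 1) (hm : Odd m) (hn : Even n) :
    IsMate (q.adj m n h) (p.adj m n h) (odd m hm) (even n hn)

/-- The category of `ℤ`-strings of adjoints and `ℤ`-strings of mates. -/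
instance : Category.{v} (ZString C) where
  Hom := Hom
  id p :=
    { even := fun n _ => 𝟙 (p.obj n)
      odd := fun n _ => 𝟙 (p.obj n)
      mate_even := fun m n h _ _ => IsMate.id (p.adj m n h)
      mate_odd := fun m n h _ _ => IsMate.id (p.adj m n h) }
  comp f g :=
    { even := fun n hn => f.even n hn ≫ g.even n hn
      odd := fun n hn => g.odd n hn ≫ f.odd n hn
      mate_even := fun m n h hm hn => (f.mate_even m n h hm hn).comp (g.mate_even m n h hm hn)
      mate_odd := fun m n h hm hn => (g.mate_odd m n h hm hn).comp (f.mate_odd m n h hm hn) }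
  id_comp f := by
    apply Hom.ext <;> funext n hn <;> simp
  comp_id f := by
    apply Hom.ext <;> funext n hn <;> simp
  assoc f g h := by
    apply Hom.ext <;> funext n hn <;> simp

/-- The shifted string `n ↦ p (n + 1)`. -/
def succ (p : ZString C) : ZString C where
  obj n := p.obj (n + 1)
  adj m n h := p.adj (m + 1) (n + 1) (by omega)

/-- The shifted string `n ↦ p (n - 1)`. -/
def pred (p : ZString C) : ZString C where
  obj n := p.obj (n - 1)
  adj m n h := p.adj (m - 1) (n - 1) (by omega)

variable (C) in
/-- The functor `p ↦ p 0`. -/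
def zero : ZString C ⥤ C where
  obj p := p.obj 0
  map f := Hom.even f 0 Even.zero
  map_id _ := rfl
  map_comp _ _ := rfl

/-! The operations `⊗`, `⅋`, `e` and `d` on strings are described by their objects and their
counits `γ`.  (The units `τ` are determined by the counits `γ`.) -/

/-- `r = p ⊗ q` as strings. -/
structure IsTensor (p q r : ZString C) : Prop where
  obj_even (n : ℤ) : Even n → r.obj n = p.obj n ⊗ q.obj n
  obj_odd (n : ℤ) : Odd n → r.obj n = q.obj n ⅋ p.obj n
  γ_even (m n : ℤ) (h : n = m + 1) : Even m →
    SameArrow (r.γ m n h) (rbind (p.γ m n h) (q.γ m n h))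
  γ_odd (m n : ℤ) (h : n = m + 1) : Odd m →
    SameArrow (r.γ m n h) (lbind (q.γ m n h) (p.γ m n h))

/-- `r = p ⅋ q` as strings. -/
structure IsPar (p q r : ZString C) : Prop where
  obj_even (n : ℤ) : Even n → r.obj n = p.obj n ⅋ q.obj n
  obj_odd (n : ℤ) : Odd n → r.obj n = q.obj n ⊗ p.obj n
  γ_even (m n : ℤ) (h : n = m + 1) : Even m →
    SameArrow (r.γ m n h) (lbind (p.γ m n h) (q.γ m n h))
  γ_odd (m n : ℤ) (h : n = m + 1) : Odd m →
    SameArrow (r.γ m n h) (rbind (q.γ m n h) (p.γ m n h))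

/-- `r = e` as strings. -/
structure IsTensorUnit (r : ZString C) : Prop where
  obj_even (n : ℤ) : Even n → r.obj n = 𝟙_ C
  obj_odd (n : ℤ) : Odd n → r.obj n = parUnit C
  γ_even (m n : ℤ) (h : n = m + 1) : Even m → SameArrow (r.γ m n h) (λ_ (parUnit C)).hom
  γ_odd (m n : ℤ) (h : n = m + 1) : Odd m → SameArrow (r.γ m n h) (ρ_ (parUnit C)).hom

/-- `r = d` as strings. -/
structure IsParUnit (r : ZString C) : Prop where
  obj_even (n : ℤ) : Even n → r.obj n = parUnit C
  obj_odd (n : ℤ) : Odd n → r.obj n = 𝟙_ C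
  γ_even (m n : ℤ) (h : n = m + 1) : Even m → SameArrow (r.γ m n h) (ρ_ (parUnit C)).hom
  γ_odd (m n : ℤ) (h : n = m + 1) : Odd m → SameArrow (r.γ m n h) (λ_ (parUnit C)).hom

/-- A star-autonomous structure on the category of `ℤ`-strings is the standard one: its operations
on objects are the ones described above, the functor `p ↦ p 0` is a strict functor of linearly
distributive categories, `p^*` and `*p` are the shifts of `p`, and the components of the chosen
counits `p ⊗ p^* ⟶ d` and `*p ⊗ p ⟶ d` are the counits (and, at odd indices, the units) of the
string `p`.  An arrow of strings is determined by its component at `0`, so there is at most one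
such structure. -/
structure IsStandard (C : Type u) [Category.{v} C] [LinearlyDistributive C]
    [StarAutonomous (ZString C)] : Prop where
  tensor (p q : ZString C) : IsTensor p q (p ⊗ q)
  par (p q : ZString C) : IsPar p q (p ⅋ q)
  unit : IsTensorUnit (𝟙_ (ZString C))
  parUnit : IsParUnit (parUnit (ZString C))
  zero_strict : ∃ M : LDFunctor (zero C), M.IsStrict
  perp (p : ZString C) : perp p = p.succ
  prep (p : ZString C) : prep p = p.pred
  perp_γ_even (p : ZString C) (n : ℤ) (hn : Even n) :
    SameArrow (Hom.even (perpAdj p).γ n hn) (p.γ n (n + 1) rfl)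
  perp_γ_odd (p : ZString C) (n : ℤ) (hn : Odd n) :
    SameArrow (Hom.odd (perpAdj p).γ n hn) (p.τ n (n + 1) rfl)
  prep_γ_even (p : ZString C) (n : ℤ) (hn : Even n) :
    SameArrow (Hom.even (prepAdj p).γ n hn) (p.γ (n - 1) n (by omega))
  prep_γ_odd (p : ZString C) (n : ℤ) (hn : Odd n) :
    SameArrow (Hom.odd (prepAdj p).γ n hn) (p.τ (n - 1) n (by omega))

end

/-! ### Canonical strings -/

section Canonical

variable {C : Type u} [Category.{v} C] [StarAutonomous C]

/-- `p^{* ⋯ *}` (`k` times) -/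
def perpIter (p : C) : ℕ → C
  | 0 => p
  | k + 1 => perp (perpIter p k)

/-- `{* ⋯ *}p` (`k` times) -/
def prepIter (p : C) : ℕ → C
  | 0 => p
  | k + 1 => prep (prepIter p k)

/-- `f^{* ⋯ *}` (`k` times), whose direction depends on the parity of `k` -/
def perpIterMap {p q : C} (f : p ⟶ q) : (k : ℕ) →
    (Even k → (perpIter p k ⟶ perpIter q k)) × (Odd k → (perpIter q k ⟶ perpIter p k))
  | 0 => (fun _ => f, fun h => absurd h (by decide))
  | k + 1 =>
    (fun h => perpMap ((perpIterMap f k).2 (by grind)),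
      fun h => perpMap ((perpIterMap f k).1 (by grind)))

/-- `{* ⋯ *}f` (`k` times), whose direction depends on the parity of `k` -/
def prepIterMap {p q : C} (f : p ⟶ q) : (k : ℕ) →
    (Even k → (prepIter p k ⟶ prepIter q k)) × (Odd k → (prepIter q k ⟶ prepIter p k))
  | 0 => (fun _ => f, fun h => absurd h (by decide))
  | k + 1 =>
    (fun h => prepMap ((prepIterMap f k).2 (by grind)),
      fun h => prepMap ((prepIterMap f k).1 (by grind)))

/-- `p^{* ⋯ *}` at `n > 0`, `p` at `0`, and `{* ⋯ *}p` at `n < 0` -/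
def canonicalObj (p : C) : ℤ → C
  | .ofNat k => perpIter p k
  | .negSucc k => prepIter p (k + 1)

/-- The chosen linear adjunctions between consecutive objects of the canonical string. -/
def canonicalAdj (p : C) : (m : ℤ) → LinearAdjoint (canonicalObj p m) (canonicalObj p (m + 1))
  | .ofNat k => perpAdj (perpIter p k)
  | .negSucc 0 => prepAdj p
  | .negSucc (k + 1) => prepAdj (prepIter p (k + 1))

/-- The canonical string of an object. -/
def canonical (p : C) : ZString C where
  obj := canonicalObj p
  adj m n h := by
    subst h
    exact canonicalAdj p m

/-- The components of the canonical string of mates of an arrow at even indices. -/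
def canonicalEven {p q : C} (f : p ⟶ q) :
    (n : ℤ) → Even n → (canonicalObj p n ⟶ canonicalObj q n)
  | .ofNat k, h => (perpIterMap f k).1 (by simpa using h)
  | .negSucc k, h => (prepIterMap f (k + 1)).1
      (by rw [Int.negSucc_eq, even_neg] at h; exact_mod_cast h)

/-- The components of the canonical string of mates of an arrow at odd indices. -/
def canonicalOdd {p q : C} (f : p ⟶ q) :
    (n : ℤ) → Odd n → (canonicalObj q n ⟶ canonicalObj p n)
  | .ofNat k, h => (perpIterMap f k).2 (by simpa using h)
  | .negSucc k, h => (prepIterMap f (k + 1)).2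
      (by rw [Int.negSucc_eq, odd_neg] at h; exact_mod_cast h)

theorem canonical_mate_even {p q : C} (f : p ⟶ q) : (m : ℤ) → (hm : Even m) →
    (hn : Odd (m + 1)) → IsMate (canonicalAdj p m) (canonicalAdj q m)
      (canonicalEven f m hm) (canonicalOdd f (m + 1) hn)
  | .ofNat _, _, _ => isMate_perpMap _
  | .negSucc 0, hm, _ => absurd hm (by decide)
  | .negSucc (_ + 1), _, _ => isMate_prepMap _

theorem canonical_mate_odd {p q : C} (f : p ⟶ q) : (m : ℤ) → (hm : Odd m) →
    (hn : Even (m + 1)) → IsMate (canonicalAdj q m) (canonicalAdj p m)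
      (canonicalOdd f m hm) (canonicalEven f (m + 1) hn)
  | .ofNat _, _, _ => isMate_perpMap _
  | .negSucc 0, _, _ => isMate_prepMap _
  | .negSucc (_ + 1), _, _ => isMate_prepMap _

/-- The canonical string of mates of an arrow. -/
def canonicalMap {p q : C} (f : p ⟶ q) : Hom (canonical p) (canonical q) where
  even := canonicalEven f
  odd := canonicalOdd f
  mate_even m n h hm hn := by
    subst h
    exact canonical_mate_even f m hm hn
  mate_odd m n h hm hn := by
    subst h
    exact canonical_mate_odd f m hm hn

theorem perpIterMap_id (p : C) (k : ℕ) :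
    perpIterMap (𝟙 p) k = (fun _ => 𝟙 _, fun _ => 𝟙 _) := by
  induction k with
  | zero => ext h <;> [rfl; exact absurd h (by decide)]
  | succ k ih => simp only [perpIterMap, ih, perpMap_id]; rfl

theorem prepIterMap_id (p : C) (k : ℕ) :
    prepIterMap (𝟙 p) k = (fun _ => 𝟙 _, fun _ => 𝟙 _) := by
  induction k with
  | zero => ext h <;> [rfl; exact absurd h (by decide)]
  | succ k ih => simp only [prepIterMap, ih, prepMap_id]; rfl

theorem perpIterMap_comp {p q r : C} (f : p ⟶ q) (g : q ⟶ r) (k : ℕ) :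
    perpIterMap (f ≫ g) k =
      (fun h => (perpIterMap f k).1 h ≫ (perpIterMap g k).1 h,
        fun h => (perpIterMap g k).2 h ≫ (perpIterMap f k).2 h) := by
  induction k with
  | zero => ext h <;> [rfl; exact absurd h (by decide)]
  | succ k ih => simp only [perpIterMap, ih, perpMap_comp]; rfl

theorem prepIterMap_comp {p q r : C} (f : p ⟶ q) (g : q ⟶ r) (k : ℕ) :
    prepIterMap (f ≫ g) k =
      (fun h => (prepIterMap f k).1 h ≫ (prepIterMap g k).1 h,
        fun h => (prepIterMap g k).2 h ≫ (prepIterMap f k).2 h) := by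
  induction k with
  | zero => ext h <;> [rfl; exact absurd h (by decide)]
  | succ k ih => simp only [prepIterMap, ih, prepMap_comp]; rfl

variable (C) in
/-- The functor which sends an object to its canonical string of adjoints, and an arrow to its
canonical string of mates. -/
def canonicalFunctor : C ⥤ ZString C where
  obj := canonical
  map := canonicalMap
  map_id p := by
    apply Hom.ext <;> funext n hn <;> cases n <;>
      simp only [canonicalMap, canonicalEven, canonicalOdd, perpIterMap_id, prepIterMap_id] <;> rfl
  map_comp f g := by
    apply Hom.ext <;> funext n hn <;> cases n <;>
      simp only [canonicalMap, canonicalEven, canonicalOdd, perpIterMap_comp,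
        prepIterMap_comp] <;> rfl

end Canonical

/-! ### Cycles on strings, and strings which are fixed by a cycle -/

section Cyclic

variable {C : Type u} [Category.{v} C] [StarAutonomous C] (σ : StarCycle C)

/-- The composite `p (n + 1) ≅ (p n)^* ⟶ *(p n) ≅ p (n - 1)`, in which the outer isomorphisms are
the canonical ones between two right, or two left, duals of `p n`. -/
def cycleComponent (p : ZString C) (n : ℤ) : p.obj (n + 1) ⟶ p.obj (n - 1) :=
  (perpAdj (p.obj n)).lCurry (p.γ n (n + 1) rfl) ≫ (σ.iso (p.obj n)).hom ≫
    (p.adj (n - 1) n (by omega)).rCurry (prepAdj (p.obj n)).γ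

/-- The cycle `ς` on strings is the one induced by `σ`.  (At an odd index the components of an
arrow of strings point backwards, so there it is the inverse of `ς` which has
`p (n + 1) ⟶ p (n - 1)` as a component.) -/
structure IsInducedCycle [StarAutonomous (ZString C)] (ς : StarCycle (ZString C)) : Prop where
  even (p : ZString C) (n : ℤ) (hn : Even n) :
    SameArrow (Hom.even (ς.iso p).hom n hn) (cycleComponent σ p n)
  odd (p : ZString C) (n : ℤ) (hn : Odd n) :
    SameArrow (Hom.odd (ς.iso p).inv n hn) (cycleComponent σ p n)

/-- The strings with `p (n + 1) = p (n - 1)` and `γ n = Σ (γ (n - 1))` for all `n`, where `Σ` is the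
upper case form of the cycle. -/
def IsFString : ObjectProperty (ZString C) := fun p =>
  ∀ n : ℤ, p.obj (n + 1) = p.obj (n - 1) ∧
    SameArrow (p.γ n (n + 1) rfl) (σ.rotate (p.γ (n - 1) n (by omega)))

/-- The full subcategory of the strings which are fixed by a cycle. -/
abbrev Fang := (IsFString σ).FullSubcategory

end Cyclic

end ZString

end StarAut

open StarAut

/-! An arrow of strings is determined by its component at `0`, because each of two mates determines
the other, and every arrow `p 0 ⟶ q 0` extends to a string of mates. So `zero` is fully faithful;
canonical strings show that it is an equivalence. The objects `p ⊗ q`, `p ⅋ q`, `e`, `d` of the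
category of strings are prescribed, and everything else (functoriality, associators, unitors,
distributions and all of their axioms) is lifted from index `0`, where the comparison isomorphisms
are identities.

What has to be supplied by hand are the adjunctions inside the prescribed strings. A pairing `x ⊗ y
⟶ d` is the counit of a linear adjunction as soon as transposing along it is bijective, and
transposing along `rbind` or `lbind` of two pairings is, up to associators, transposing along one
and then along the other (`pairLeft_rbind`, `pairRight_lbind`). Hence no triangle identity is
checked for products. A linear adjunction is determined by its counit (`LinearAdjoint.ext_γ`), so
two strings are equal once their objects and counits are.

The negations are strict because they are shifts. A shift of `p ⊗ q` has `⊗` and `⅋` in opposite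
places, which makes it the string `⅋` of the shifted factors in the reverse order. Each canonical
isomorphism is the transpose of some counit along the chosen one; when these two counits coincide,
which can be tested at index `0`, the transpose is an identity.

Cycles are handled in their upper case form, `Rotation`: natural bijections between pairings `p ⊗ t
⟶ d` and pairings `t ⊗ p ⟶ d` that exchange `rbind` with `lbind`. In this form a cycle mentions no
chosen duals, so it lifts along any fully faithful strong functor, and preservation of cycles
becomes an equation between pairings. A rotation automatically exchanges the two unitors at `d` and
is an involution (`Rotation.rot_rightUnitor`, `Rotation.rot_rot`). Involutivity is what makes
consecutive components of the induced cycle mates.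

In a string with `γ n = Σ (γ (n - 1))` for all `n`, involutivity gives `γ (n + 1) = γ (n - 1)`, so
that the two shifts agree and the induced cycle is an identity. Closure under the operations follows
from the exchange of `rbind` and `lbind`. Every object `x` sits at index `0` of such a string,
namely `(…, x, x^*, x, x^*, …)`, so passing to the subcategory loses nothing up to isomorphism. -/

namespace StarAut

open LinearlyDistributive StarAutonomous

/-! ### Coherence of the second monoidal structure. -/

section ParLemmas

variable {C : Type u} [Category.{v} C] [ParCategory C]

@[simp]
theorem parLeft_id (X Y : C) : parLeft X (𝟙 Y) = 𝟙 (X ⅋ Y) :=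
  @MonoidalCategory.whiskerLeft_id C _ ParCategory.par X Y

@[simp]
theorem parRight_id (X Y : C) : parRight (𝟙 X) Y = 𝟙 (X ⅋ Y) :=
  @MonoidalCategory.id_whiskerRight C _ ParCategory.par X Y

theorem parHom_def {X Y X' Y' : C} (f : X ⟶ Y) (g : X' ⟶ Y') :
    parHom f g = parRight f X' ≫ parLeft Y g :=
  @MonoidalCategory.tensorHom_def C _ ParCategory.par _ _ _ _ f g

theorem parAssoc_naturality_left {X X' : C} (f : X ⟶ X') (Y Z : C) :
    parRight (parRight f Y) Z ≫ (parAssoc X' Y Z).hom =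
      (parAssoc X Y Z).hom ≫ parRight f (Y ⅋ Z) :=
  @MonoidalCategory.associator_naturality_left C _ ParCategory.par _ _ f Y Z

theorem parAssoc_naturality_middle (X : C) {Y Y' : C} (f : Y ⟶ Y') (Z : C) :
    parRight (parLeft X f) Z ≫ (parAssoc X Y' Z).hom =
      (parAssoc X Y Z).hom ≫ parLeft X (parRight f Z) :=
  @MonoidalCategory.associator_naturality_middle C _ ParCategory.par X _ _ f Z

theorem parAssoc_naturality_right (X Y : C) {Z Z' : C} (f : Z ⟶ Z') :
    parLeft (X ⅋ Y) f ≫ (parAssoc X Y Z').hom =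
      (parAssoc X Y Z).hom ≫ parLeft X (parLeft Y f) :=
  @MonoidalCategory.associator_naturality_right C _ ParCategory.par X Y _ _ f

theorem par_triangle (X Y : C) :
    (parAssoc X (parUnit C) Y).hom ≫ parLeft X (parLambda Y).hom = parRight (parRho X).hom Y :=
  @MonoidalCategory.triangle C _ ParCategory.par X Y

theorem parLambda_par (X Y : C) :
    (parAssoc (parUnit C) X Y).hom ≫ (parLambda (X ⅋ Y)).hom = parRight (parLambda X).hom Y := by
  have := @MonoidalCategory.leftUnitor_tensor_hom C _ ParCategory.par X Y
  exact ((Iso.inv_comp_eq _).1 this.symm).symm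

theorem parRho_par (X Y : C) :
    (parAssoc X Y (parUnit C)).hom ≫ parLeft X (parRho Y).hom = (parRho (X ⅋ Y)).hom :=
  (@MonoidalCategory.rightUnitor_tensor_hom C _ ParCategory.par X Y).symm

end ParLemmas

/-! ### Linear adjunctions as bijective transposition. -/

variable {C : Type u} [Category.{v} C] [LinearlyDistributive C]

/-- The transpose `x ⊗ t ⟶ s` of an arrow `t ⟶ y ⅋ s` along a pairing `x ⊗ y ⟶ d`. -/
def pairLeft {x y : C} (γ : x ⊗ y ⟶ parUnit C) {t s : C} (g : t ⟶ y ⅋ s) : x ⊗ t ⟶ s :=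
  x ◁ g ≫ distL x y s ≫ parRight γ s ≫ (parLambda s).hom

/-- The transpose `t ⊗ y ⟶ s` of an arrow `t ⟶ s ⅋ x` along a pairing `x ⊗ y ⟶ d`. -/
def pairRight {x y : C} (γ : x ⊗ y ⟶ parUnit C) {t s : C} (g : t ⟶ s ⅋ x) : t ⊗ y ⟶ s :=
  g ▷ y ≫ distR s x y ≫ parLeft s γ ≫ (parRho s).hom

/-- The candidate inverse of `pairLeft`. -/
def copairLeft {x y : C} (τ : 𝟙_ C ⟶ y ⅋ x) {t s : C} (h : x ⊗ t ⟶ s) : t ⟶ y ⅋ s :=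
  (λ_ t).inv ≫ τ ▷ t ≫ distR y x t ≫ parLeft y h

/-- The candidate inverse of `pairRight`. -/
def copairRight {x y : C} (τ : 𝟙_ C ⟶ y ⅋ x) {t s : C} (h : t ⊗ y ⟶ s) : t ⟶ s ⅋ x :=
  (ρ_ t).inv ≫ t ◁ τ ≫ distL t y x ≫ parRight h x

/-- Naturality moves `h` to the end, and the mixed associativity `distL_distR` turns the rest into
the left triangle whiskered by `t`. Only this one triangle is used, so the lemma is available before
`γ` and `τ` are known to form an adjunction. -/
theorem pairLeft_copairLeft {x y : C} {γ : x ⊗ y ⟶ parUnit C} {τ : 𝟙_ C ⟶ y ⅋ x}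
    (tri : (ρ_ x).inv ≫ x ◁ τ ≫ distL x y x ≫ parRight γ x ≫ (parLambda x).hom = 𝟙 x)
    {t s : C} (h : x ⊗ t ⟶ s) : pairLeft γ (copairLeft τ h) = h := by
  have h2 : x ◁ parLeft y h ≫ distL x y s ≫ parRight γ s ≫ (parLambda s).hom =
      distL x y (x ⊗ t) ≫ parRight γ (x ⊗ t) ≫ (parLambda (x ⊗ t)).hom ≫ h := by
    rw [← Category.assoc, LinearlyDistributive.distL_nat₃, Category.assoc,
      ← Category.assoc (parLeft _ _), par_exchange, Category.assoc, parLambda_naturality]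
  have h3 : x ◁ distR y x t ≫ distL x y (x ⊗ t) ≫ parRight γ (x ⊗ t) ≫
        (parLambda (x ⊗ t)).hom =
      (α_ x (y ⅋ x) t).inv ≫ distL x y x ▷ t ≫ parRight γ x ▷ t ≫ (parLambda x).hom ▷ t := by
    rw [← LinearlyDistributive.distR_unit_left, ← Category.assoc (parRight γ x ▷ t),
      LinearlyDistributive.distR_nat₁, Category.assoc, Iso.eq_inv_comp,
      ← Category.assoc (distL x y x ▷ t), ← LinearlyDistributive.distL_distR]
    simp only [Category.assoc]
  have h4 := congrArg (fun f => f ▷ t) tri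
  simp only [comp_whiskerRight, id_whiskerRight] at h4
  unfold pairLeft copairLeft
  simp only [MonoidalCategory.whiskerLeft_comp, Category.assoc]
  rw [h2, ← Category.assoc (parRight _ _), ← Category.assoc (distL _ _ _),
    ← Category.assoc (x ◁ distR _ _ _), h3]
  simp only [Category.assoc]
  have h5 : x ◁ (λ_ t).inv ≫ x ◁ τ ▷ t ≫ (α_ x (y ⅋ x) t).inv =
      (ρ_ x).inv ▷ t ≫ (x ◁ τ) ▷ t := by
    simp
  rw [reassoc_of% h5, reassoc_of% h4]

theorem pairRight_copairRight {x y : C} {γ : x ⊗ y ⟶ parUnit C} {τ : 𝟙_ C ⟶ y ⅋ x}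
    (tri : (λ_ y).inv ≫ τ ▷ y ≫ distR y x y ≫ parLeft y γ ≫ (parRho y).hom = 𝟙 y)
    {t s : C} (h : t ⊗ y ⟶ s) : pairRight γ (copairRight τ h) = h := by
  have h2 : parRight h x ▷ y ≫ distR s x y ≫ parLeft s γ ≫ (parRho s).hom =
      distR (t ⊗ y) x y ≫ parLeft (t ⊗ y) γ ≫ (parRho (t ⊗ y)).hom ≫ h := by
    rw [← Category.assoc, LinearlyDistributive.distR_nat₁, Category.assoc,
      ← Category.assoc (parRight _ _), ← par_exchange, Category.assoc, parRho_naturality]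
  have h3 : distL t y x ▷ y ≫ distR (t ⊗ y) x y ≫ parLeft (t ⊗ y) γ ≫
        (parRho (t ⊗ y)).hom =
      (α_ t (y ⅋ x) y).hom ≫ t ◁ distR y x y ≫ t ◁ parLeft y γ ≫ t ◁ (parRho y).hom := by
    rw [← LinearlyDistributive.distL_unit_right, ← Category.assoc (t ◁ parLeft y γ),
      LinearlyDistributive.distL_nat₃, ← Category.assoc (distL t y x ▷ y),
      ← LinearlyDistributive.distL_distR]
    simp only [Category.assoc]
  have h4 := congrArg (fun f => t ◁ f) tri
  simp only [MonoidalCategory.whiskerLeft_comp, MonoidalCategory.whiskerLeft_id] at h4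
  unfold pairRight copairRight
  simp only [comp_whiskerRight, Category.assoc]
  rw [h2, ← Category.assoc (parLeft _ _), ← Category.assoc (distR _ _ _),
    ← Category.assoc (distL _ _ _ ▷ _), h3]
  simp only [Category.assoc]
  have h5 : (ρ_ t).inv ▷ y ≫ (t ◁ τ) ▷ y ≫ (α_ t (y ⅋ x) y).hom =
      t ◁ (λ_ y).inv ≫ t ◁ τ ▷ y := by
    simp
  rw [reassoc_of% h5, reassoc_of% h4]

/-- The other composite uses the right triangle and the other mixed axiom, `distR_distL`, which
leaves that triangle whiskered by `s` on the `⅋` side. -/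
theorem copairLeft_pairLeft {x y : C} {γ : x ⊗ y ⟶ parUnit C} {τ : 𝟙_ C ⟶ y ⅋ x}
    (tri : (λ_ y).inv ≫ τ ▷ y ≫ distR y x y ≫ parLeft y γ ≫ (parRho y).hom = 𝟙 y)
    {t s : C} (g : t ⟶ y ⅋ s) : copairLeft τ (pairLeft γ g) = g := by
  have h1 : (λ_ t).inv ≫ τ ▷ t ≫ distR y x t ≫ parLeft y (x ◁ g) =
      g ≫ (λ_ (y ⅋ s)).inv ≫ τ ▷ (y ⅋ s) ≫ distR y x (y ⅋ s) := by
    rw [← distR_nat₃, ← whisker_exchange_assoc, ← leftUnitor_inv_naturality_assoc]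
  have h2 : (parAssoc y (x ⊗ y) s).hom ≫ parLeft y (parRight γ s) ≫
      parLeft y (parLambda s).hom = parRight (parLeft y γ) s ≫ parRight (parRho y).hom s := by
    rw [← par_triangle, ← Category.assoc, ← parAssoc_naturality_middle, Category.assoc]
  have h3 : (λ_ (y ⅋ s)).inv ≫ τ ▷ (y ⅋ s) ≫ distL (y ⅋ x) y s =
      parRight ((λ_ y).inv ≫ τ ▷ y) s := by
    rw [distL_nat₁, Iso.inv_comp_eq, ← distL_unit_left, Category.assoc, ← parRight_comp]
    simp
  have h4 := congrArg (fun f => parRight f s) tri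
  simp only [parRight_comp, parRight_id] at h4
  unfold pairLeft copairLeft
  simp only [parLeft_comp]
  rw [reassoc_of% h1, ← reassoc_of% (distR_distL y x y s), h2, reassoc_of% h3]
  simp only [parRight_comp, Category.assoc]
  rw [h4, Category.comp_id]

theorem copairRight_pairRight {x y : C} {γ : x ⊗ y ⟶ parUnit C} {τ : 𝟙_ C ⟶ y ⅋ x}
    (tri : (ρ_ x).inv ≫ x ◁ τ ≫ distL x y x ≫ parRight γ x ≫ (parLambda x).hom = 𝟙 x)
    {t s : C} (g : t ⟶ s ⅋ x) : copairRight τ (pairRight γ g) = g := by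
  have h1 : (ρ_ t).inv ≫ t ◁ τ ≫ distL t y x ≫ parRight (g ▷ y) x =
      g ≫ (ρ_ (s ⅋ x)).inv ≫ (s ⅋ x) ◁ τ ≫ distL (s ⅋ x) y x := by
    rw [← distL_nat₁, whisker_exchange_assoc, ← rightUnitor_inv_naturality_assoc]
  have h2 : (parAssoc s (x ⊗ y) x).hom ≫ parLeft s (parRight γ x) ≫
      parLeft s (parLambda x).hom = parRight (parLeft s γ) x ≫ parRight (parRho s).hom x := by
    rw [← par_triangle, ← Category.assoc, ← parAssoc_naturality_middle, Category.assoc]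
  have h3 : (ρ_ (s ⅋ x)).inv ≫ (s ⅋ x) ◁ τ ≫ distR s x (y ⅋ x) =
      parLeft s ((ρ_ x).inv ≫ x ◁ τ) := by
    rw [distR_nat₃, Iso.inv_comp_eq, ← distR_unit_right, Category.assoc, ← parLeft_comp]
    simp
  have h4 := congrArg (fun f => parLeft s f) tri
  simp only [parLeft_comp, parLeft_id] at h4
  unfold pairRight copairRight
  simp only [parRight_comp]
  rw [reassoc_of% h1, ← h2, reassoc_of% (distR_distL s x y x), reassoc_of% h3]
  simp only [parLeft_comp, Category.assoc]
  rw [h4, Category.comp_id]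

theorem pairLeft_bijective {x y : C} (a : LinearAdjoint x y) (t s : C) :
    Function.Bijective (pairLeft a.γ : (t ⟶ y ⅋ s) → (x ⊗ t ⟶ s)) :=
  Function.bijective_iff_has_inverse.2 ⟨copairLeft a.τ,
    copairLeft_pairLeft a.triangle_right, pairLeft_copairLeft a.triangle_left⟩

theorem pairRight_bijective {x y : C} (a : LinearAdjoint x y) (t s : C) :
    Function.Bijective (pairRight a.γ : (t ⟶ s ⅋ x) → (t ⊗ y ⟶ s)) :=
  Function.bijective_iff_has_inverse.2 ⟨copairRight a.τ,
    copairRight_pairRight a.triangle_left, pairRight_copairRight a.triangle_right⟩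

/-- For `s = d` the general transposition reduces, up to a unitor, to pairing with `γ`. -/
theorem pairLeft_parRho_inv {x y : C} (γ : x ⊗ y ⟶ parUnit C) {t : C} (g : t ⟶ y) :
    pairLeft γ (g ≫ (parRho y).inv) = x ◁ g ≫ γ := by
  unfold pairLeft
  have h : distL x y (parUnit C) ≫ parRight γ (parUnit C) ≫ (parRho (parUnit C)).hom =
      x ◁ (parRho y).hom ≫ γ := by
    rw [parRho_naturality, ← Category.assoc, distL_unit_right]
  rw [par_unitors_equal, h, ← MonoidalCategory.whiskerLeft_comp_assoc]
  simp

theorem pairRight_parLambda_inv {x y : C} (γ : x ⊗ y ⟶ parUnit C) {t : C} (g : t ⟶ x) :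
    pairRight γ (g ≫ (parLambda x).inv) = g ▷ y ≫ γ := by
  unfold pairRight
  have h : distR (parUnit C) x y ≫ parLeft (parUnit C) γ ≫ (parLambda (parUnit C)).hom =
      (parLambda x).hom ▷ y ≫ γ := by
    rw [parLambda_naturality, ← Category.assoc, distR_unit_left]
  rw [← par_unitors_equal, h, ← comp_whiskerRight_assoc]
  simp

/-- The two triangle identities in terms of transposes. -/
theorem exists_linearAdjoint_of_pairLeft {x y : C} (γ : x ⊗ y ⟶ parUnit C)
    (h : ∀ t s : C, Function.Bijective (pairLeft γ : (t ⟶ y ⅋ s) → (x ⊗ t ⟶ s))) :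
    ∃ a : LinearAdjoint x y, a.γ = γ := by
  -- The left triangle says precisely that the transpose of `τ` is the right unitor of `x`, so
  -- surjectivity supplies `τ`.
  obtain ⟨τ, hτ⟩ := (h (𝟙_ C) x).2 (ρ_ x).hom
  have tri : (ρ_ x).inv ≫ x ◁ τ ≫ distL x y x ≫ parRight γ x ≫ (parLambda x).hom = 𝟙 x := by
    rw [Iso.inv_comp_eq, Category.comp_id]
    exact hτ
  refine ⟨⟨τ, γ, tri, ?_⟩, rfl⟩
  -- The right triangle follows from injectivity: both of its sides have transpose `γ`, by
  -- `pairLeft_copairLeft`, which needs only the left triangle.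
  rw [← cancel_mono (parRho y).inv]
  apply (h y (parUnit C)).1
  rw [pairLeft_parRho_inv, pairLeft_parRho_inv, MonoidalCategory.whiskerLeft_id,
    Category.id_comp]
  have h1 := pairLeft_copairLeft tri (t := y) γ
  rw [← pairLeft_parRho_inv]
  simpa [copairLeft] using h1

/-- The mirror image is needed as well: `rbind` decomposes under transposition on the left, and
`lbind` under transposition on the right. -/
theorem exists_linearAdjoint_of_pairRight {x y : C} (γ : x ⊗ y ⟶ parUnit C)
    (h : ∀ t s : C, Function.Bijective (pairRight γ : (t ⟶ s ⅋ x) → (t ⊗ y ⟶ s))) :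
    ∃ a : LinearAdjoint x y, a.γ = γ := by
  obtain ⟨τ, hτ⟩ := (h (𝟙_ C) y).2 (λ_ y).hom
  have tri : (λ_ y).inv ≫ τ ▷ y ≫ distR y x y ≫ parLeft y γ ≫ (parRho y).hom = 𝟙 y := by
    rw [Iso.inv_comp_eq, Category.comp_id]
    exact hτ
  refine ⟨⟨τ, γ, ?_, tri⟩, rfl⟩
  rw [← cancel_mono (parLambda x).inv]
  apply (h x (parUnit C)).1
  rw [pairRight_parLambda_inv, pairRight_parLambda_inv, id_whiskerRight, Category.id_comp]
  have h1 := pairRight_copairRight tri (t := x) γ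
  rw [← pairRight_parLambda_inv]
  simpa [copairRight] using h1

/-- A linear adjunction is determined by its counit. -/
theorem LinearAdjoint.ext_γ {x y : C} {a b : LinearAdjoint x y} (h : a.γ = b.γ) : a = b := by
  -- Both units have the right unitor of `x` as their transpose along the common counit.
  refine LinearAdjoint.ext ((pairLeft_bijective a (𝟙_ C) x).1 ?_) h
  have ha := a.triangle_left
  have hb := b.triangle_left
  rw [Iso.inv_comp_eq, Category.comp_id] at ha hb
  rw [← h] at hb
  exact ha.trans hb.symm

/-- The axiom `distL_par` splits the innermost distribution and `distL_tensor` the outermost one.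
Bijectivity for `rbind ω ψ` is thereby inherited from `ω` and `ψ`. -/
theorem pairLeft_rbind {x y x' y' : C} (ω : x ⊗ y ⟶ parUnit C) (ψ : x' ⊗ y' ⟶ parUnit C)
    {t s : C} (g : t ⟶ (y' ⅋ y) ⅋ s) :
    pairLeft (rbind ω ψ) g =
      (α_ x x' t).hom ≫ pairLeft ω (pairLeft ψ (g ≫ (parAssoc y' y s).hom)) := by
  have h1 : distL x' (y' ⅋ y) s ≫ parRight (distL x' y' y) s ≫ parRight (parRight ψ y) s ≫
      parRight (parLambda y).hom s = x' ◁ (parAssoc y' y s).hom ≫ distL x' y' (y ⅋ s) ≫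
        parRight ψ (y ⅋ s) ≫ (parLambda (y ⅋ s)).hom := by
    rw [reassoc_of% (distL_par x' y' y s), ← parLambda_par,
      ← reassoc_of% (parAssoc_naturality_left ψ y s)]
  have h2 := congrArg (fun f => x ◁ f) h1
  simp only [MonoidalCategory.whiskerLeft_comp] at h2
  unfold pairLeft rbind
  simp only [MonoidalCategory.whiskerLeft_comp, parRight_comp, Category.assoc]
  rw [← reassoc_of% h2, reassoc_of% (distL_tensor x x' (y' ⅋ y) s),
    ← reassoc_of% (distL_nat₂ x (distL x' y' y) s), ← reassoc_of% (distL_nat₂ x (parRight ψ y) s),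
    ← reassoc_of% (distL_nat₂ x (parLambda y).hom s)]
  simp

/-- The mirror image of `pairLeft_rbind`, by `distR_par` and `distR_tensor`. -/
theorem pairRight_lbind {x y x' y' : C} (ω : x ⊗ y ⟶ parUnit C) (ψ : x' ⊗ y' ⟶ parUnit C)
    {t s : C} (g : t ⟶ (s ⅋ x) ⅋ x') :
    pairRight (lbind ω ψ) (g ≫ (parAssoc s x x').hom) =
      (α_ t y' y).inv ≫ pairRight ω (pairRight ψ g) := by
  have h1 : (parAssoc s x x').hom ▷ y' ≫ distR s (x ⅋ x') y' ≫ parLeft s (distR x x' y') ≫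
      parLeft s (parLeft x ψ) ≫ parLeft s (parRho x).hom =
        distR (s ⅋ x) x' y' ≫ parLeft (s ⅋ x) ψ ≫ (parRho (s ⅋ x)).hom := by
    rw [← reassoc_of% (distR_par s x x' y'), ← parRho_par,
      reassoc_of% (parAssoc_naturality_right s x ψ)]
  have h2 := congrArg (fun f => f ▷ y) h1
  simp only [comp_whiskerRight] at h2
  have h3 : distR s (x ⅋ x') (y' ⊗ y) ≫ parLeft s (α_ (x ⅋ x') y' y).inv =
      (α_ (s ⅋ (x ⅋ x')) y' y).inv ≫ distR s (x ⅋ x') y' ▷ y ≫ distR s ((x ⅋ x') ⊗ y') y := by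
    rw [Iso.eq_inv_comp, reassoc_of% (distR_tensor s (x ⅋ x') y' y), ← parLeft_comp]
    simp
  unfold pairRight lbind
  simp only [comp_whiskerRight, parLeft_comp, Category.assoc]
  rw [reassoc_of% h3, ← reassoc_of% (distR_nat₂ s (distR x x' y') y),
    ← reassoc_of% (distR_nat₂ s (parLeft x ψ) y), ← reassoc_of% (distR_nat₂ s (parRho x).hom y),
    ← reassoc_of% h2]
  simp

/-- `x ⊗ x' ⊣ y' ⅋ y` -/
theorem exists_linearAdjoint_rbind {x y x' y' : C} (a : LinearAdjoint x y)
    (a' : LinearAdjoint x' y') :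
    ∃ b : LinearAdjoint (x ⊗ x') (y' ⅋ y), b.γ = rbind a.γ a'.γ := by
  refine exists_linearAdjoint_of_pairLeft _ fun t s => ?_
  have : (pairLeft (rbind a.γ a'.γ) : (t ⟶ (y' ⅋ y) ⅋ s) → _) =
      (fun f => (α_ x x' t).hom ≫ f) ∘ pairLeft a.γ ∘ pairLeft a'.γ ∘
        fun g => g ≫ (parAssoc y' y s).hom :=
    funext fun g => pairLeft_rbind _ _ g
  rw [this]
  exact (((α_ x x' t).symm.homFromEquiv (Z := s)).bijective).comp
    ((pairLeft_bijective a _ _).comp ((pairLeft_bijective a' _ _).comp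
      ((parAssoc y' y s).homToEquiv (Z := t)).bijective))

/-- `x ⅋ x' ⊣ y' ⊗ y` -/
theorem exists_linearAdjoint_lbind {x y x' y' : C} (a : LinearAdjoint x y)
    (a' : LinearAdjoint x' y') :
    ∃ b : LinearAdjoint (x ⅋ x') (y' ⊗ y), b.γ = lbind a.γ a'.γ := by
  refine exists_linearAdjoint_of_pairRight _ fun t s => ?_
  have : (pairRight (lbind a.γ a'.γ) : (t ⟶ s ⅋ (x ⅋ x')) → _) =
      (fun f => (α_ t y' y).inv ≫ f) ∘ pairRight a.γ ∘ pairRight a'.γ ∘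
        fun g => g ≫ (parAssoc s x x').inv :=
    funext fun g => by
      have := pairRight_lbind a.γ a'.γ (g ≫ (parAssoc s x x').inv)
      simpa using this
  rw [this]
  exact (((α_ t y' y).homFromEquiv (Z := s)).bijective).comp
    ((pairRight_bijective a _ _).comp ((pairRight_bijective a' _ _).comp
      ((parAssoc s x x').symm.homToEquiv (Z := t)).bijective))

/-! ### Constructions of linear adjunctions and uniqueness of transposes. -/

namespace LinearAdjoint

/-- The linear adjunction `x ⊗ x' ⊣ y' ⅋ y`. -/
noncomputable def tensor {x y x' y' : C} (a : LinearAdjoint x y) (a' : LinearAdjoint x' y') :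
    LinearAdjoint (x ⊗ x') (y' ⅋ y) :=
  (exists_linearAdjoint_rbind a a').choose

/-- The counit is all that is ever used of this chosen adjunction; by `ext_γ` it determines the
unit. -/
theorem tensor_γ {x y x' y' : C} (a : LinearAdjoint x y) (a' : LinearAdjoint x' y') :
    (a.tensor a').γ = rbind a.γ a'.γ :=
  (exists_linearAdjoint_rbind a a').choose_spec

/-- The linear adjunction `x ⅋ x' ⊣ y' ⊗ y`. -/
noncomputable def par {x y x' y' : C} (a : LinearAdjoint x y) (a' : LinearAdjoint x' y') :
    LinearAdjoint (x ⅋ x') (y' ⊗ y) :=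
  (exists_linearAdjoint_lbind a a').choose

theorem par_γ {x y x' y' : C} (a : LinearAdjoint x y) (a' : LinearAdjoint x' y') :
    (a.par a').γ = lbind a.γ a'.γ :=
  (exists_linearAdjoint_lbind a a').choose_spec

variable (C) in
/-- The linear adjunction `e ⊣ d`. -/
def unit : LinearAdjoint (𝟙_ C) (parUnit C) where
  τ := (parLambda (𝟙_ C)).inv
  γ := (λ_ (parUnit C)).hom
  triangle_left := by
    rw [reassoc_of% (distL_unit_left (parUnit C) (𝟙_ C))]
    simp [MonoidalCategory.unitors_equal]
  triangle_right := by
    rw [← par_unitors_equal, parLambda_naturality, reassoc_of% (distR_unit_left (𝟙_ C) (parUnit C))]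
    simp

variable (C) in
/-- The linear adjunction `d ⊣ e`. -/
def parUnit : LinearAdjoint (parUnit C) (𝟙_ C) where
  τ := (parRho (𝟙_ C)).inv
  γ := (ρ_ (StarAut.parUnit C)).hom
  triangle_left := by
    rw [par_unitors_equal, parRho_naturality,
      reassoc_of% (distL_unit_right (StarAut.parUnit C) (𝟙_ C))]
    simp
  triangle_right := by
    rw [reassoc_of% (distR_unit_right (𝟙_ C) (StarAut.parUnit C))]
    simp [MonoidalCategory.unitors_inv_equal]

/-- The transposition changes by precomposition with an isomorphism and remains bijective. Applied
to `σ`, this makes `x^*` a left adjoint of `x`. -/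
theorem exists_ofIso {x x' y : C} (i : x' ≅ x) (a : LinearAdjoint x y) :
    ∃ b : LinearAdjoint x' y, b.γ = i.hom ▷ y ≫ a.γ := by
  refine exists_linearAdjoint_of_pairLeft _ fun t s => ?_
  have : (pairLeft (i.hom ▷ y ≫ a.γ) : (t ⟶ y ⅋ s) → _) =
      (fun f => i.hom ▷ t ≫ f) ∘ pairLeft a.γ := by
    funext g
    simp only [pairLeft, parRight_comp, Category.assoc, Function.comp_apply]
    rw [← reassoc_of% (distL_nat₁ i.hom y s), whisker_exchange_assoc]
  rw [this]
  exact ((whiskerRightIso i t).symm.homFromEquiv (Z := s)).bijective.comp (pairLeft_bijective a t s)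

/-- Transport of a linear adjunction along an isomorphism of left adjoints. -/
noncomputable def ofIso {x x' y : C} (i : x' ≅ x) (a : LinearAdjoint x y) : LinearAdjoint x' y :=
  (exists_ofIso i a).choose

theorem ofIso_γ {x x' y : C} (i : x' ≅ x) (a : LinearAdjoint x y) :
    (ofIso i a).γ = i.hom ▷ y ≫ a.γ :=
  (exists_ofIso i a).choose_spec

variable {x y : C} (a : LinearAdjoint x y)

/-- Equations between arrows into a dual are reduced by this, and by its mirror image, to equations
between pairings. -/
theorem hom_ext_right {t : C} {g g' : t ⟶ y} (h : x ◁ g ≫ a.γ = x ◁ g' ≫ a.γ) : g = g' := by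
  rw [← a.lCurry_whiskerLeft g, h, a.lCurry_whiskerLeft]

theorem hom_ext_left {t : C} {g g' : t ⟶ x} (h : g ▷ y ≫ a.γ = g' ▷ y ≫ a.γ) : g = g' := by
  rw [← a.rCurry_whiskerRight g, h, a.rCurry_whiskerRight]

@[simp]
theorem lCurry_γ : a.lCurry a.γ = 𝟙 y :=
  a.hom_ext_right (by rw [a.whiskerLeft_lCurry]; simp)

@[simp]
theorem rCurry_γ : a.rCurry a.γ = 𝟙 x :=
  a.hom_ext_left (by rw [a.whiskerRight_rCurry]; simp)

theorem lCurry_comp {t t' : C} (g : t' ⟶ t) (ω : x ⊗ t ⟶ StarAut.parUnit C) :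
    a.lCurry (x ◁ g ≫ ω) = g ≫ a.lCurry ω :=
  a.hom_ext_right (by
    rw [a.whiskerLeft_lCurry, MonoidalCategory.whiskerLeft_comp, Category.assoc,
      a.whiskerLeft_lCurry])

end LinearAdjoint

/-! ### Naturality of `rbind` and `lbind`, and binding with a unit. -/

section Bind

variable {p q s t p' q' s' t' : C}

theorem rbind_whiskerLeft (ω : p ⊗ t ⟶ parUnit C) (ψ : q ⊗ s ⟶ parUnit C) (h : s' ⟶ s)
    (k : t' ⟶ t) :
    (p ⊗ q) ◁ parHom h k ≫ rbind ω ψ = rbind (p ◁ k ≫ ω) (q ◁ h ≫ ψ) := by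
  have h1 : q ◁ parRight h t' ≫ q ◁ parLeft s k ≫ distL q s t ≫ parRight ψ t ≫
      (parLambda t).hom = distL q s' t' ≫ parRight (q ◁ h) t' ≫ parRight ψ t' ≫
        (parLambda t').hom ≫ k := by
    rw [reassoc_of% (distL_nat₃ q s k), reassoc_of% (distL_nat₂ q h t'),
      reassoc_of% (par_exchange ψ k), parLambda_naturality]
  have h2 := congrArg (fun f => p ◁ f) h1
  simp only [MonoidalCategory.whiskerLeft_comp] at h2
  unfold rbind
  simp only [parHom_def, MonoidalCategory.whiskerLeft_comp, parRight_comp, Category.assoc]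
  rw [associator_naturality_right_assoc, associator_naturality_right_assoc, reassoc_of% h2]

theorem rbind_whiskerRight (ω : p ⊗ t ⟶ parUnit C) (ψ : q ⊗ s ⟶ parUnit C) (f : p' ⟶ p)
    (g : q' ⟶ q) :
    (f ⊗ₘ g) ▷ (s ⅋ t) ≫ rbind ω ψ = rbind (f ▷ t ≫ ω) (g ▷ s ≫ ψ) := by
  unfold rbind
  simp only [MonoidalCategory.tensorHom_def, comp_whiskerRight, parRight_comp,
    MonoidalCategory.whiskerLeft_comp,
    Category.assoc, associator_naturality_left_assoc, associator_naturality_middle_assoc]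
  rw [← MonoidalCategory.whiskerLeft_comp_assoc p (g ▷ _), distL_nat₁]
  simp only [MonoidalCategory.whiskerLeft_comp, Category.assoc]
  simp only [← whisker_exchange_assoc]

theorem lbind_whiskerLeft (ω : p ⊗ t ⟶ parUnit C) (ψ : q ⊗ s ⟶ parUnit C) (h : s' ⟶ s)
    (k : t' ⟶ t) :
    (p ⅋ q) ◁ (h ⊗ₘ k) ≫ lbind ω ψ = lbind (p ◁ k ≫ ω) (q ◁ h ≫ ψ) := by
  unfold lbind
  simp only [MonoidalCategory.tensorHom_def, MonoidalCategory.whiskerLeft_comp, parLeft_comp,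
    comp_whiskerRight,
    Category.assoc, associator_inv_naturality_right_assoc, associator_inv_naturality_middle_assoc]
  simp only [whisker_exchange_assoc]
  rw [← comp_whiskerRight_assoc ((p ⅋ q) ◁ h), distR_nat₃]
  simp only [comp_whiskerRight, Category.assoc]

theorem lbind_whiskerRight (ω : p ⊗ t ⟶ parUnit C) (ψ : q ⊗ s ⟶ parUnit C) (f : p' ⟶ p)
    (g : q' ⟶ q) :
    parHom f g ▷ (s ⊗ t) ≫ lbind ω ψ = lbind (f ▷ t ≫ ω) (g ▷ s ≫ ψ) := by
  have h1 : parRight f q' ▷ s ≫ parLeft p g ▷ s ≫ distR p q s ≫ parLeft p ψ ≫ (parRho p).hom =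
      distR p' q' s ≫ parLeft p' (g ▷ s) ≫ parLeft p' ψ ≫ (parRho p').hom ≫ f := by
    rw [reassoc_of% (distR_nat₂ p g s), reassoc_of% (distR_nat₁ f q' s), ← parRho_naturality,
      reassoc_of% (par_exchange f ψ), reassoc_of% (par_exchange f (g ▷ s))]
  have h2 := congrArg (fun f => f ▷ t) h1
  simp only [comp_whiskerRight] at h2
  unfold lbind
  simp only [parHom_def, comp_whiskerRight, parLeft_comp, Category.assoc]
  rw [associator_inv_naturality_left_assoc, associator_inv_naturality_left_assoc,
    reassoc_of% h2]

/-- Binding with a counit and precomposing with its unit does nothing. -/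
theorem unit_rbind {x y : C} (a : LinearAdjoint x y) (ω : p ⊗ x ⟶ parUnit C) :
    (p ⊗ x) ◁ a.τ ≫ rbind ω a.γ = (ρ_ (p ⊗ x)).hom ≫ ω := by
  have h := a.triangle_left
  rw [Iso.inv_comp_eq, Category.comp_id] at h
  have h2 := congrArg (fun f => p ◁ f) h
  simp only [MonoidalCategory.whiskerLeft_comp] at h2
  unfold rbind
  rw [associator_naturality_right_assoc, reassoc_of% h2]
  simp

/-- No triangle identity is involved: the unit followed by the first part of `lbind` is literally
the transpose of `ψ`. Together with `unit_rbind` this forces a rotation to be an involution. -/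
theorem unit_lbind {x y : C} (a : LinearAdjoint x y) (χ : y ⊗ t ⟶ parUnit C)
    (ψ : x ⊗ s ⟶ parUnit C) :
    a.τ ▷ (s ⊗ t) ≫ lbind χ ψ = (λ_ (s ⊗ t)).hom ≫ a.lCurry ψ ▷ t ≫ χ := by
  unfold lbind LinearAdjoint.lCurry
  simp only [comp_whiskerRight, Category.assoc]
  rw [associator_inv_naturality_left_assoc]
  simp

end Bind

/-! ### Sameness of arrows -/

section Same

variable {D : Type u₁} [Category.{v₁} D]

@[simp]
theorem sameArrow_iff {X Y : D} {f g : X ⟶ Y} : SameArrow f g ↔ f = g :=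
  ⟨fun ⟨_, _, h⟩ => by simpa using h, fun h => ⟨rfl, rfl, by simpa using h⟩⟩

theorem SameArrow.trans {X Y X' Y' X'' Y'' : D} {f : X ⟶ Y} {g : X' ⟶ Y'} {k : X'' ⟶ Y''}
    (h : SameArrow f g) (h' : SameArrow g k) : SameArrow f k := by
  obtain ⟨rfl, rfl, h⟩ := h
  obtain ⟨rfl, rfl, h'⟩ := h'
  simp_all

theorem isIdentity_id (X : D) : IsIdentity (𝟙 X) := ⟨rfl, rfl⟩

theorem IsIdentity.comp {X Y Z : D} {f : X ⟶ Y} {g : Y ⟶ Z} (hf : IsIdentity f)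
    (hg : IsIdentity g) : IsIdentity (f ≫ g) := by
  obtain ⟨rfl, rfl⟩ := hf
  obtain ⟨rfl, rfl⟩ := hg
  exact ⟨rfl, by simp⟩

theorem IsIdentity.map {E : Type u₂} [Category.{v₂} E] (F : D ⥤ E) {X Y : D} {f : X ⟶ Y}
    (hf : IsIdentity f) : IsIdentity (F.map f) := by
  obtain ⟨rfl, rfl⟩ := hf
  exact ⟨rfl, by simp⟩

/-- The equality of objects is a separate hypothesis, because a faithful functor need not be
injective on objects. -/
theorem isIdentity_of_map {E : Type u₂} [Category.{v₂} E] (F : D ⥤ E) [F.Faithful] {X Y : D}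
    {f : X ⟶ Y} (h : X = Y) (hf : IsIdentity (F.map f)) : IsIdentity f := by
  subst h
  obtain ⟨h, hf⟩ := hf
  exact ⟨rfl, F.map_injective (by simpa using hf)⟩

theorem sameArrow_of_map {E : Type u₂} [Category.{v₂} E] (F : D ⥤ E) [F.Faithful]
    {X Y X' Y' : D} {f : X ⟶ Y} {g : X' ⟶ Y'} (h : X = X') (h' : Y = Y')
    (hf : SameArrow (F.map f) (F.map g)) : SameArrow f g := by
  subst h h'
  rw [sameArrow_iff] at hf ⊢
  exact F.map_injective hf

end Same

/-- The de Morgan and cancellation arrows are transposes of counits; transposing a counit along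
itself gives an identity. This reduces strictness to an equality of objects and an equality of
counits. -/
theorem isIdentity_lCurry {x y t : C} (a : LinearAdjoint x y) {ω : x ⊗ t ⟶ parUnit C} (h : t = y)
    (hω : SameArrow ω a.γ) : IsIdentity (a.lCurry ω) := by
  subst h
  rw [sameArrow_iff.1 hω, a.lCurry_γ]
  exact isIdentity_id _

theorem isIdentity_rCurry {x y t : C} (a : LinearAdjoint x y) {ω : t ⊗ y ⟶ parUnit C} (h : t = x)
    (hω : SameArrow ω a.γ) : IsIdentity (a.rCurry ω) := by
  subst h
  rw [sameArrow_iff.1 hω, a.rCurry_γ]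
  exact isIdentity_id _

/-- The upper case form of a cycle: bijections `Hom(p ⊗ t, d) ≃ Hom(t ⊗ p, d)` which are natural
and compatible with `rbind` and `lbind`. -/
structure Rotation (C : Type u) [Category.{v} C] [LinearlyDistributive C] where
  /-- the bijection -/
  rot {p t : C} : (p ⊗ t ⟶ parUnit C) ≃ (t ⊗ p ⟶ parUnit C)
  rot_whiskerLeft {p t t' : C} (g : t' ⟶ t) (ω : p ⊗ t ⟶ parUnit C) :
    rot (p ◁ g ≫ ω) = g ▷ p ≫ rot ω
  rot_whiskerRight {p p' t : C} (f : p' ⟶ p) (ω : p ⊗ t ⟶ parUnit C) :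
    rot (f ▷ t ≫ ω) = t ◁ f ≫ rot ω
  rot_rbind {p q s t : C} (ω : p ⊗ t ⟶ parUnit C) (ψ : q ⊗ s ⟶ parUnit C) :
    rot (rbind ω ψ) = lbind (rot ψ) (rot ω)
  rot_lbind {p q s t : C} (ω : p ⊗ t ⟶ parUnit C) (ψ : q ⊗ s ⟶ parUnit C) :
    rot (lbind ω ψ) = rbind (rot ψ) (rot ω)

/-! ### Rotations are involutions, and they yield cycles. -/

namespace Rotation

section

variable {C : Type u} [Category.{v} C] [LinearlyDistributive C] (R : Rotation C)

/-- The rotated unitor is the left unitor followed by some endomorphism `w` of `d`. Binding the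
right unitor with itself returns it up to unitors, so compatibility with `lbind` makes `w`
idempotent. Bijectivity of the rotation gives `w` a one-sided inverse, and then `w` is the identity.
-/
theorem rot_rightUnitor : R.rot (ρ_ (parUnit C)).hom = (λ_ (parUnit C)).hom := by
  set v' := R.rot (ρ_ (parUnit C)).hom with hv
  obtain ⟨w, hw⟩ : ∃ w : parUnit C ⟶ parUnit C, (λ_ (parUnit C)).hom ≫ w = v' :=
    ⟨(λ_ _).inv ≫ v', by simp⟩
  have h1 : lbind (ρ_ (parUnit C)).hom (ρ_ (parUnit C)).hom =
      (parUnit C ⅋ parUnit C) ◁ (λ_ (𝟙_ C)).hom ≫ (parRho (parUnit C)).hom ▷ 𝟙_ C ≫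
        (ρ_ (parUnit C)).hom := by
    unfold lbind
    rw [← comp_whiskerRight_assoc (distR _ _ _), distR_unit_right,
      triangle_assoc_comp_right_assoc]
  have h2 := congrArg R.rot h1
  rw [R.rot_lbind, R.rot_whiskerLeft, R.rot_whiskerRight, ← hv, ← hw] at h2
  have h3 : parRight ((λ_ (parUnit C)).hom ≫ w) (parUnit C) ≫ (parLambda (parUnit C)).hom =
      parRight (λ_ (parUnit C)).hom (parUnit C) ≫ (parRho (parUnit C)).hom ≫ w := by
    rw [parRight_comp, Category.assoc, par_unitors_equal, parRho_naturality]
  have h4 : rbind ((λ_ (parUnit C)).hom ≫ w) ((λ_ (parUnit C)).hom ≫ w) =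
      (λ_ (𝟙_ C)).hom ▷ (parUnit C ⅋ parUnit C) ≫ 𝟙_ C ◁ (parRho (parUnit C)).hom ≫
        (λ_ (parUnit C)).hom ≫ w ≫ w := by
    unfold rbind
    rw [← MonoidalCategory.whiskerLeft_comp_assoc _ (parRight _ _), h3,
      ← MonoidalCategory.whiskerLeft_comp_assoc _ (distL _ _ _),
      reassoc_of% (distL_unit_left (parUnit C) (parUnit C)), MonoidalCategory.unitors_equal,
      ← triangle_assoc]
    simp only [MonoidalCategory.whiskerLeft_comp, Category.assoc, leftUnitor_naturality_assoc]
  rw [h4] at h2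
  have h5 : w ≫ w = w := by
    have : IsIso (parRho (parUnit C)).hom := inferInstance
    have h6 : IsIso ((λ_ (𝟙_ C)).hom ▷ (parUnit C ⅋ parUnit C)) := inferInstance
    rwa [cancel_epi, cancel_epi, cancel_epi] at h2
  -- Surjectivity of the rotation: a preimage of the left unitor is the right unitor preceded by
  -- some `z`, and by naturality its rotation is the left unitor followed by `z ≫ w`.
  obtain ⟨z, hz⟩ : ∃ z : parUnit C ⟶ parUnit C, z ≫ w = 𝟙 _ := by
    obtain ⟨ζ, hζ⟩ := R.rot.surjective (λ_ (parUnit C)).hom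
    refine ⟨(ρ_ _).inv ≫ ζ, ?_⟩
    have : ζ = ((ρ_ _).inv ≫ ζ) ▷ 𝟙_ C ≫ (ρ_ (parUnit C)).hom := by simp
    rw [this, R.rot_whiskerRight, ← hv, ← hw, leftUnitor_naturality_assoc] at hζ
    rw [← cancel_epi (λ_ (parUnit C)).hom, hζ, Category.comp_id]
  have h6 : w = 𝟙 _ := by
    rw [← Category.id_comp w, ← hz, Category.assoc, h5]
  rw [← hw, h6, Category.comp_id]

/-- Precomposed with the unit of `b`, the pairing `rbind ω b.γ` is `ω` up to a unitor. Its rotation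
is `lbind` of the rotated pairings, where the same unit transposes `rot ω`; by naturality this
amounts to `rot (rot ω)`. A right dual of `t` is all that is needed. -/
theorem rot_rot {p t y : C} (b : LinearAdjoint t y) (ω : p ⊗ t ⟶ parUnit C) :
    R.rot (R.rot ω) = ω := by
  have h := congrArg R.rot (unit_rbind b ω)
  rw [R.rot_whiskerLeft, R.rot_rbind, unit_lbind, ← R.rot_whiskerLeft, b.whiskerLeft_lCurry,
    ← rightUnitor_naturality, R.rot_whiskerRight, rot_rightUnitor, leftUnitor_naturality] at h
  exact (cancel_epi _).1 h

/-- Involutivity applies even without chosen duals, since `e ⊣ d` always holds. -/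
theorem rot_leftUnitor : R.rot (λ_ (parUnit C)).hom = (ρ_ (parUnit C)).hom := by
  rw [← rot_rightUnitor, R.rot_rot (LinearAdjoint.unit C)]

end

variable {C : Type u} [Category.{v} C] [StarAutonomous C] (R : Rotation C)

/-- The cycle with a given upper case form. -/
def toCycle : StarCycle C where
  iso p :=
    { hom := (prepAdj p).rCurry (R.rot (perpAdj p).γ)
      inv := (perpAdj p).lCurry (R.rot.symm (prepAdj p).γ)
      hom_inv_id := by
        apply (perpAdj p).hom_ext_right
        apply R.rot.injective
        rw [MonoidalCategory.whiskerLeft_comp, Category.assoc, (perpAdj p).whiskerLeft_lCurry,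
          R.rot_whiskerLeft, R.rot.apply_symm_apply, (prepAdj p).whiskerRight_rCurry]
        simp
      inv_hom_id := by
        apply (prepAdj p).hom_ext_left
        rw [comp_whiskerRight, Category.assoc, (prepAdj p).whiskerRight_rCurry,
          ← R.rot_whiskerLeft, (perpAdj p).whiskerLeft_lCurry]
        simp }
  naturality {p q} f := by
    apply (prepAdj p).hom_ext_left
    have h1 : perpMap f ▷ p ≫ R.rot (perpAdj p).γ = perp q ◁ f ≫ R.rot (perpAdj q).γ := by
      rw [← R.rot_whiskerLeft, ← R.rot_whiskerRight]
      exact congrArg R.rot (isMate_perpMap f).symm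
    simp only [comp_whiskerRight, Category.assoc]
    rw [(prepAdj p).whiskerRight_rCurry, h1, isMate_prepMap f, ← whisker_exchange_assoc,
      (prepAdj q).whiskerRight_rCurry]
  -- The de Morgan arrows are transposes of `rbind` and `lbind` of counits, so this axiom is
  -- `rot_rbind` at those counits, as the next one is `rot_lbind`.
  tensor p q := by
    apply (prepAdj (p ⊗ q)).hom_ext_left
    simp only [comp_whiskerRight, Category.assoc]
    rw [(prepAdj _).whiskerRight_rCurry, prepOfTensor, (prepAdj _).whiskerRight_rCurry,
      lbind_whiskerRight, (prepAdj _).whiskerRight_rCurry, (prepAdj _).whiskerRight_rCurry,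
      ← R.rot_whiskerLeft, perpOfTensor, (perpAdj _).whiskerLeft_lCurry, R.rot_rbind]
  par p q := by
    apply (prepAdj (p ⅋ q)).hom_ext_left
    simp only [comp_whiskerRight, Category.assoc]
    rw [(prepAdj _).whiskerRight_rCurry, prepOfPar, (prepAdj _).whiskerRight_rCurry,
      rbind_whiskerRight, (prepAdj _).whiskerRight_rCurry, (prepAdj _).whiskerRight_rCurry,
      ← R.rot_whiskerLeft, perpOfPar, (perpAdj _).whiskerLeft_lCurry, R.rot_lbind]

theorem toCycle_rotate {p t : C} (ω : p ⊗ t ⟶ parUnit C) : R.toCycle.rotate ω = R.rot ω := by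
  unfold StarCycle.rotate
  rw [comp_whiskerRight, Category.assoc, toCycle]
  dsimp only
  rw [(prepAdj p).whiskerRight_rCurry, ← R.rot_whiskerLeft, (perpAdj p).whiskerLeft_lCurry]

end Rotation

/-! ### The rotation given by a cycle. -/

namespace StarCycle

variable {C : Type u} [Category.{v} C] [StarAutonomous C] (σ : StarCycle C)

theorem rotate_whiskerLeft {p t t' : C} (g : t' ⟶ t) (ω : p ⊗ t ⟶ parUnit C) :
    σ.rotate (p ◁ g ≫ ω) = g ▷ p ≫ σ.rotate ω := by
  simp [rotate, LinearAdjoint.lCurry_comp]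

theorem rotate_whiskerRight {p p' t : C} (f : p' ⟶ p) (ω : p ⊗ t ⟶ parUnit C) :
    σ.rotate (f ▷ t ≫ ω) = t ◁ f ≫ σ.rotate ω := by
  have h : (perpAdj p').lCurry (f ▷ t ≫ ω) = (perpAdj p).lCurry ω ≫ perpMap f := by
    apply (perpAdj p').hom_ext_right
    rw [(perpAdj p').whiskerLeft_lCurry, MonoidalCategory.whiskerLeft_comp, Category.assoc,
      ← isMate_perpMap f, whisker_exchange_assoc, (perpAdj p).whiskerLeft_lCurry]
  unfold rotate
  rw [h, Category.assoc, σ.naturality, ← Category.assoc, comp_whiskerRight, Category.assoc,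
    isMate_prepMap f, whisker_exchange_assoc]

/-- Every pairing is a counit precomposed with its own transpose, so by naturality of binding the
claim reduces to the case of counits, which is the axiom `tensor` of the cycle. -/
theorem rotate_rbind {p q s t : C} (ω : p ⊗ t ⟶ parUnit C) (ψ : q ⊗ s ⟶ parUnit C) :
    σ.rotate (rbind ω ψ) = lbind (σ.rotate ψ) (σ.rotate ω) := by
  have h : (perpAdj (p ⊗ q)).lCurry (rbind ω ψ) =
      parHom ((perpAdj q).lCurry ψ) ((perpAdj p).lCurry ω) ≫ perpOfTensor p q := by
    rw [perpOfTensor, ← LinearAdjoint.lCurry_comp, rbind_whiskerLeft,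
      LinearAdjoint.whiskerLeft_lCurry, LinearAdjoint.whiskerLeft_lCurry]
  unfold rotate
  rw [h, Category.assoc, σ.tensor, ← lbind_whiskerRight]
  simp only [comp_whiskerRight, Category.assoc]
  rw [prepOfTensor, LinearAdjoint.whiskerRight_rCurry, lbind_whiskerRight, lbind_whiskerRight,
    lbind_whiskerRight]
  simp only [comp_whiskerRight, Category.assoc]

theorem rotate_lbind {p q s t : C} (ω : p ⊗ t ⟶ parUnit C) (ψ : q ⊗ s ⟶ parUnit C) :
    σ.rotate (lbind ω ψ) = rbind (σ.rotate ψ) (σ.rotate ω) := by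
  have h : (perpAdj (p ⅋ q)).lCurry (lbind ω ψ) =
      ((perpAdj q).lCurry ψ ⊗ₘ (perpAdj p).lCurry ω) ≫ perpOfPar q p := by
    rw [perpOfPar, ← LinearAdjoint.lCurry_comp, lbind_whiskerLeft,
      LinearAdjoint.whiskerLeft_lCurry, LinearAdjoint.whiskerLeft_lCurry]
  unfold rotate
  rw [h, Category.assoc, σ.par, ← rbind_whiskerRight]
  simp only [comp_whiskerRight, Category.assoc]
  rw [prepOfPar, LinearAdjoint.whiskerRight_rCurry, rbind_whiskerRight, rbind_whiskerRight,
    rbind_whiskerRight]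
  simp only [comp_whiskerRight, Category.assoc]

/-- The upper case form of a cycle. -/
def rotation : Rotation C where
  rot {p t} :=
    { toFun := σ.rotate
      invFun := fun ψ => p ◁ ((prepAdj p).rCurry ψ ≫ (σ.iso p).inv) ≫ (perpAdj p).γ
      left_inv := fun ω => by
        dsimp only [rotate]
        rw [(prepAdj p).rCurry_whiskerRight, Category.assoc, Iso.hom_inv_id,
          Category.comp_id, (perpAdj p).whiskerLeft_lCurry]
      right_inv := fun ψ => by
        dsimp only [rotate]
        rw [(perpAdj p).lCurry_whiskerLeft, Category.assoc, Iso.inv_hom_id,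
          Category.comp_id, (prepAdj p).whiskerRight_rCurry] }
  rot_whiskerLeft := σ.rotate_whiskerLeft
  rot_whiskerRight := σ.rotate_whiskerRight
  rot_rbind := σ.rotate_rbind
  rot_lbind := σ.rotate_lbind

/-- Involutivity is not an axiom of a cycle; it comes from compatibility with binding and the right
dual of `t`. -/
theorem rotate_rotate {p t : C} (ω : p ⊗ t ⟶ parUnit C) : σ.rotate (σ.rotate ω) = ω :=
  σ.rotation.rot_rot (perpAdj t) ω

theorem rotate_injective {p t : C} :
    Function.Injective (σ.rotate : (p ⊗ t ⟶ parUnit C) → (t ⊗ p ⟶ parUnit C)) :=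
  σ.rotation.rot.injective

end StarCycle

/-! ### Images of pairings under strong functors. -/

namespace LDFunctor

variable {C : Type u₁} [Category.{v₁} C] {D : Type u₂} [Category.{v₂} D]
variable [LinearlyDistributive C] [LinearlyDistributive D] {F : C ⥤ D} (M : LDFunctor F)

/-- `F (p ⊗ q) ⟶ F p ⊗ F q`, the inverse of `μ` -/
def δ (p q : C) : F.obj (p ⊗ q) ⟶ F.obj p ⊗ F.obj q := M.tens.δ p q

/-- `F (p ⅋ q) ⟶ F p ⅋ F q`, the inverse of `parμ` -/
def parδ (p q : C) : F.obj (p ⅋ q) ⟶ F.obj p ⅋ F.obj q := M.par.δ p q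

theorem μ_δ (p q : C) : M.μ p q ≫ M.δ p q = 𝟙 _ := M.tens.μ_δ p q

theorem δ_μ (p q : C) : M.δ p q ≫ M.μ p q = 𝟙 _ := M.tens.δ_μ p q

theorem parμ_parδ (p q : C) : M.parμ p q ≫ M.parδ p q = 𝟙 _ := M.par.μ_δ p q

theorem parδ_parμ (p q : C) : M.parδ p q ≫ M.parμ p q = 𝟙 _ := M.par.δ_μ p q

theorem parη_parε : M.parη ≫ M.parε = 𝟙 _ := M.par.η_ε

theorem parε_parη : M.parε ≫ M.parη = 𝟙 _ := M.par.ε_η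

instance (p q : C) : IsIso (M.μ p q) := ⟨M.δ p q, M.μ_δ p q, M.δ_μ p q⟩

instance (p q : C) : IsIso (M.parμ p q) := ⟨M.parδ p q, M.parμ_parδ p q, M.parδ_parμ p q⟩

instance : IsIso M.parη := ⟨M.parε, M.parη_parε, M.parε_parη⟩

theorem μ_natural_left {p p' : C} (f : p ⟶ p') (q : C) :
    F.map f ▷ F.obj q ≫ M.μ p' q = M.μ p q ≫ F.map (f ▷ q) :=
  M.tens.μ_natural_left f q

theorem μ_natural_right (p : C) {q q' : C} (f : q ⟶ q') :
    F.obj p ◁ F.map f ≫ M.μ p q' = M.μ p q ≫ F.map (p ◁ f) :=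
  M.tens.μ_natural_right p f

theorem parμ_natural_left {p p' : C} (f : p ⟶ p') (q : C) :
    parRight (F.map f) (F.obj q) ≫ M.parμ p' q = M.parμ p q ≫ F.map (parRight f q) :=
  M.par.μ_natural_left f q

theorem parμ_natural_right (p : C) {q q' : C} (f : q ⟶ q') :
    parLeft (F.obj p) (F.map f) ≫ M.parμ p q' = M.parμ p q ≫ F.map (parLeft p f) :=
  M.par.μ_natural_right p f

theorem associativity (p q r : C) :
    M.μ p q ▷ F.obj r ≫ M.μ (p ⊗ q) r ≫ F.map (α_ p q r).hom =
      (α_ _ _ _).hom ≫ F.obj p ◁ M.μ q r ≫ M.μ p (q ⊗ r) :=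
  M.tens.associativity p q r

theorem distL_eq (p q r : C) :
    F.obj p ◁ M.parμ q r ≫ M.μ p (q ⅋ r) ≫ F.map (distL p q r) =
      distL _ _ _ ≫ parRight (M.μ p q) (F.obj r) ≫ M.parμ (p ⊗ q) r :=
  M.map_distL p q r

theorem distR_eq (p q r : C) :
    M.parμ p q ▷ F.obj r ≫ M.μ (p ⅋ q) r ≫ F.map (distR p q r) =
      distR _ _ _ ≫ parLeft (F.obj p) (M.μ q r) ≫ M.parμ p (q ⊗ r) :=
  M.map_distR p q r

theorem parμ_parLambda (p : C) :
    M.parμ (parUnit C) p ≫ F.map (parLambda p).hom =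
      parRight M.parη (F.obj p) ≫ (parLambda (F.obj p)).hom := by
  have h : (parLambda (F.obj p)).hom = parRight M.parε (F.obj p) ≫ M.parμ (parUnit C) p ≫
      F.map (parLambda p).hom := M.par.left_unitality p
  rw [h, ← Category.assoc (parRight _ _), ← parRight_comp, M.parη_parε, parRight_id,
    Category.id_comp]

theorem parμ_parRho (p : C) :
    M.parμ p (parUnit C) ≫ F.map (parRho p).hom =
      parLeft (F.obj p) M.parη ≫ (parRho (F.obj p)).hom := by
  have h : (parRho (F.obj p)).hom = parLeft (F.obj p) M.parε ≫ M.parμ p (parUnit C) ≫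
      F.map (parRho p).hom := M.par.right_unitality p
  rw [h, ← Category.assoc (parLeft _ _), ← parLeft_comp, M.parη_parε, parLeft_id,
    Category.id_comp]

/-- The image `F p ⊗ F t ⟶ d` of an arrow `p ⊗ t ⟶ d`. -/
def mapPairing {p t : C} (ω : p ⊗ t ⟶ parUnit C) : F.obj p ⊗ F.obj t ⟶ parUnit D :=
  M.μ p t ≫ F.map ω ≫ M.parη

theorem mapPairing_whiskerLeft {p t t' : C} (g : t' ⟶ t) (ω : p ⊗ t ⟶ parUnit C) :
    M.mapPairing (p ◁ g ≫ ω) = F.obj p ◁ F.map g ≫ M.mapPairing ω := by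
  unfold mapPairing
  rw [reassoc_of% (M.μ_natural_right p g), Functor.map_comp, Category.assoc]

theorem mapPairing_whiskerRight {p p' t : C} (f : p' ⟶ p) (ω : p ⊗ t ⟶ parUnit C) :
    M.mapPairing (f ▷ t ≫ ω) = F.map f ▷ F.obj t ≫ M.mapPairing ω := by
  unfold mapPairing
  rw [reassoc_of% (M.μ_natural_left f t), Functor.map_comp, Category.assoc]

theorem mapPairing_injective [F.Faithful] {p t : C} :
    Function.Injective (M.mapPairing : (p ⊗ t ⟶ parUnit C) → _) := by
  intro ω ω' h
  unfold mapPairing at h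
  rw [cancel_epi, cancel_mono] at h
  exact F.map_injective h

theorem mapPairing_surjective [F.Full] {p t : C} :
    Function.Surjective (M.mapPairing : (p ⊗ t ⟶ parUnit C) → _) := by
  intro ω
  refine ⟨F.preimage (M.δ p t ≫ ω ≫ M.parε), ?_⟩
  unfold mapPairing
  rw [Functor.map_preimage, Category.assoc, Category.assoc, M.parε_parη, Category.comp_id,
    reassoc_of% (M.μ_δ p t)]

/-- Preservation of `distL`, together with associativity and unitality of the comparisons, makes a
strong functor respect binding. This is what allows rotations to be lifted along it. -/
theorem mapPairing_rbind {p q s t : C} (ω : p ⊗ t ⟶ parUnit C) (ψ : q ⊗ s ⟶ parUnit C) :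
    M.μ p q ▷ (F.obj s ⅋ F.obj t) ≫ F.obj (p ⊗ q) ◁ M.parμ s t ≫ M.mapPairing (rbind ω ψ) =
      rbind (M.mapPairing ω) (M.mapPairing ψ) := by
  have h1 : F.obj q ◁ M.parμ s t ≫ M.μ q (s ⅋ t) ≫ F.map (distL q s t) ≫
      F.map (parRight ψ t) ≫ F.map (parLambda t).hom =
        distL _ _ _ ≫ parRight (M.mapPairing ψ) (F.obj t) ≫ (parLambda (F.obj t)).hom := by
    rw [reassoc_of% (M.distL_eq q s t), ← reassoc_of% (M.parμ_natural_left ψ t), M.parμ_parLambda]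
    simp only [mapPairing, parRight_comp, Category.assoc]
  have h2 := congrArg (fun f => F.obj p ◁ f) h1
  simp only [MonoidalCategory.whiskerLeft_comp] at h2
  unfold rbind
  rw [← reassoc_of% h2]
  unfold mapPairing
  simp only [Functor.map_comp, Category.assoc]
  rw [← whisker_exchange_assoc, reassoc_of% (M.associativity p q (s ⅋ t)),
    associator_naturality_right_assoc]
  simp only [← reassoc_of% (M.μ_natural_right p)]

theorem mapPairing_lbind {p q s t : C} (ω : p ⊗ t ⟶ parUnit C) (ψ : q ⊗ s ⟶ parUnit C) :
    M.parμ p q ▷ (F.obj s ⊗ F.obj t) ≫ F.obj (p ⅋ q) ◁ M.μ s t ≫ M.mapPairing (lbind ω ψ) =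
      lbind (M.mapPairing ω) (M.mapPairing ψ) := by
  have h1 : M.parμ p q ▷ F.obj s ≫ M.μ (p ⅋ q) s ≫ F.map (distR p q s) ≫
      F.map (parLeft p ψ) ≫ F.map (parRho p).hom =
        distR _ _ _ ≫ parLeft (F.obj p) (M.mapPairing ψ) ≫ (parRho (F.obj p)).hom := by
    rw [reassoc_of% (M.distR_eq p q s), ← reassoc_of% (M.parμ_natural_right p ψ), M.parμ_parRho]
    simp only [mapPairing, parLeft_comp, Category.assoc]
  have h2 := congrArg (fun f => f ▷ F.obj t) h1
  simp only [comp_whiskerRight] at h2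
  have h3 : F.obj (p ⅋ q) ◁ M.μ s t ≫ M.μ (p ⅋ q) (s ⊗ t) ≫ F.map (α_ (p ⅋ q) s t).inv =
      (α_ _ _ _).inv ≫ M.μ (p ⅋ q) s ▷ F.obj t ≫ M.μ ((p ⅋ q) ⊗ s) t := by
    rw [Iso.eq_inv_comp, ← reassoc_of% (M.associativity (p ⅋ q) s t), ← Functor.map_comp]
    simp
  unfold lbind
  rw [← reassoc_of% h2]
  unfold mapPairing
  simp only [Functor.map_comp, Category.assoc]
  rw [reassoc_of% h3, associator_inv_naturality_left_assoc]
  have h4 : ∀ {x y : C} (f : x ⟶ y) {Z : D} (h : F.obj (y ⊗ t) ⟶ Z),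
      M.μ x t ≫ F.map (f ▷ t) ≫ h = F.map f ▷ F.obj t ≫ M.μ y t ≫ h := fun f _ h => by
    rw [reassoc_of% (M.μ_natural_left f t)]
  rw [h4, h4, h4]

end LDFunctor

/-- The upper case form of a cycle lifts along a fully faithful functor. -/
noncomputable def Rotation.lift {C : Type u₁} [Category.{v₁} C] {D : Type u₂} [Category.{v₂} D]
    [LinearlyDistributive C] [LinearlyDistributive D] {F : C ⥤ D} (M : LDFunctor F) [F.Full]
    [F.Faithful] (R : Rotation D) : Rotation C :=
  have bij (p t : C) : Function.Bijective (M.mapPairing : (p ⊗ t ⟶ parUnit C) → _) :=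
    ⟨M.mapPairing_injective, M.mapPairing_surjective⟩
  let e (p t : C) := Equiv.ofBijective _ (bij p t)
  have he (p t : C) (ω : p ⊗ t ⟶ parUnit C) : e p t ω = M.mapPairing ω := rfl
  have hr (p t : C) (ω : p ⊗ t ⟶ parUnit C) :
      M.mapPairing (((e p t).trans (R.rot.trans (e t p).symm)) ω) = R.rot (M.mapPairing ω) := by
    rw [← he t p, Equiv.trans_apply, Equiv.trans_apply, Equiv.apply_symm_apply, he]
  { rot := fun {p t} => (e p t).trans (R.rot.trans (e t p).symm)
    rot_whiskerLeft := fun {p t t'} g ω => M.mapPairing_injective (by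
      rw [hr, M.mapPairing_whiskerLeft, M.mapPairing_whiskerRight, hr, R.rot_whiskerLeft])
    rot_whiskerRight := fun {p p' t} f ω => M.mapPairing_injective (by
      rw [hr, M.mapPairing_whiskerRight, M.mapPairing_whiskerLeft, hr, R.rot_whiskerRight])
    rot_rbind := fun {p q s t} ω ψ => M.mapPairing_injective (by
      -- The comparison isomorphisms are put in front so that `mapPairing_lbind` applies on one side
      -- and, after rotation, `mapPairing_rbind` on the other; the two whiskerings then differ by an
      -- exchange.
      rw [hr, ← cancel_epi (F.obj (s ⅋ t) ◁ M.μ p q), ← cancel_epi (M.parμ s t ▷ _),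
        M.mapPairing_lbind, hr, hr, ← R.rot_rbind, ← M.mapPairing_rbind, R.rot_whiskerRight,
        R.rot_whiskerLeft, whisker_exchange_assoc])
    rot_lbind := fun {p q s t} ω ψ => M.mapPairing_injective (by
      rw [hr, ← cancel_epi (F.obj (s ⊗ t) ◁ M.parμ p q), ← cancel_epi (M.μ s t ▷ _),
        M.mapPairing_rbind, hr, hr, ← R.rot_lbind, ← M.mapPairing_lbind, R.rot_whiskerRight,
        R.rot_whiskerLeft, whisker_exchange_assoc]) }

theorem Rotation.mapPairing_lift {C : Type u₁} [Category.{v₁} C] {D : Type u₂} [Category.{v₂} D]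
    [LinearlyDistributive C] [LinearlyDistributive D] {F : C ⥤ D} (M : LDFunctor F) [F.Full]
    [F.Faithful] (R : Rotation D) {p t : C} (ω : p ⊗ t ⟶ parUnit C) :
    M.mapPairing ((R.lift M).rot ω) = R.rot (M.mapPairing ω) :=
  Equiv.ofBijective_apply_symm_apply M.mapPairing
    ⟨M.mapPairing_injective, M.mapPairing_surjective⟩ _

/-- Both comparisons with duals are transposes of image pairings. Pairing the desired equation with
the counit of the left dual turns it into the hypothesis, so only the counits need testing. -/
theorem LDFunctor.preservesCycle {C : Type u₁} [Category.{v₁} C] {D : Type u₂} [Category.{v₂} D]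
    [StarAutonomous C] [StarAutonomous D] {F : C ⥤ D} (M : LDFunctor F) {σ : StarCycle C}
    {σ' : StarCycle D} (h : ∀ p : C, M.mapPairing (σ.rotate (perpAdj p).γ) =
      σ'.rotate (M.mapPairing (perpAdj p).γ)) : M.PreservesCycle σ σ' := by
  intro p
  apply (prepAdj (F.obj p)).hom_ext_left
  have h1 := h p
  simp only [StarCycle.rotate, LinearAdjoint.lCurry_γ, Category.id_comp,
    M.mapPairing_whiskerRight] at h1
  rw [comp_whiskerRight, Category.assoc, prepComparison, LinearAdjoint.whiskerRight_rCurry]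
  exact h1

/-! ### Composition and equivalences -/

section Comp

variable {C : Type*} [Category* C] {D : Type*} [Category* D] {E : Type*} [Category* E]

/-- The composite of two strong monoidal functors. -/
@[reducible]
def monoidalComp [MonoidalCategory C] [MonoidalCategory D] [MonoidalCategory E] {F : C ⥤ D}
    {G : D ⥤ E} (_ : F.Monoidal) (_ : G.Monoidal) : (F ⋙ G).Monoidal :=
  inferInstance

variable [LinearlyDistributive C] [LinearlyDistributive D] [LinearlyDistributive E]

namespace LDFunctor

/-- The composite of two strong functors of linearly distributive categories. -/
def comp {F : C ⥤ D} {G : D ⥤ E} (M : LDFunctor F) (N : LDFunctor G) : LDFunctor (F ⋙ G) where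
  tens := monoidalComp M.tens N.tens
  par := @monoidalComp _ _ _ _ _ _ ParCategory.par ParCategory.par ParCategory.par _ _ M.par N.par
  map_distL X Y Z := by
    change G.obj (F.obj X) ◁ (N.parμ (F.obj Y) (F.obj Z) ≫ G.map (M.parμ Y Z)) ≫
        (N.μ (F.obj X) (F.obj (Y ⅋ Z)) ≫ G.map (M.μ X (Y ⅋ Z))) ≫ G.map (F.map (distL X Y Z)) =
      distL _ _ _ ≫ parRight (N.μ (F.obj X) (F.obj Y) ≫ G.map (M.μ X Y)) (G.obj (F.obj Z)) ≫
        N.parμ (F.obj (X ⊗ Y)) (F.obj Z) ≫ G.map (M.parμ (X ⊗ Y) Z)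
    simp only [parRight_comp, Category.assoc]
    rw [reassoc_of% (N.parμ_natural_left (M.μ X Y) (F.obj Z)),
      ← reassoc_of% (N.distL_eq (F.obj X) (F.obj Y) (F.obj Z))]
    simp only [← Functor.map_comp]
    rw [← M.distL_eq]
    simp only [MonoidalCategory.whiskerLeft_comp, Functor.map_comp, Category.assoc]
    rw [reassoc_of% (N.μ_natural_right (F.obj X) (M.parμ Y Z))]
  map_distR X Y Z := by
    change (N.parμ (F.obj X) (F.obj Y) ≫ G.map (M.parμ X Y)) ▷ G.obj (F.obj Z) ≫
        (N.μ (F.obj (X ⅋ Y)) (F.obj Z) ≫ G.map (M.μ (X ⅋ Y) Z)) ≫ G.map (F.map (distR X Y Z)) =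
      distR _ _ _ ≫ parLeft (G.obj (F.obj X)) (N.μ (F.obj Y) (F.obj Z) ≫ G.map (M.μ Y Z)) ≫
        N.parμ (F.obj X) (F.obj (Y ⊗ Z)) ≫ G.map (M.parμ X (Y ⊗ Z))
    simp only [parLeft_comp, Category.assoc]
    rw [reassoc_of% (N.parμ_natural_right (F.obj X) (M.μ Y Z)),
      ← reassoc_of% (N.distR_eq (F.obj X) (F.obj Y) (F.obj Z))]
    simp only [← Functor.map_comp]
    rw [← M.distR_eq]
    simp only [comp_whiskerRight, Functor.map_comp, Category.assoc]
    rw [reassoc_of% (N.μ_natural_left (M.parμ X Y) (F.obj Z))]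

theorem IsStrict.comp {F : C ⥤ D} {G : D ⥤ E} {M : LDFunctor F} {N : LDFunctor G}
    (hM : M.IsStrict) (hN : N.IsStrict) : (M.comp N).IsStrict where
  μ p q := (hN.μ _ _).comp ((hM.μ p q).map G)
  ε := hN.ε.comp (hM.ε.map G)
  parμ p q := (hN.parμ _ _).comp ((hM.parμ p q).map G)
  parε := hN.parε.comp (hM.parε.map G)

theorem mapPairing_comp {F : C ⥤ D} {G : D ⥤ E} (M : LDFunctor F) (N : LDFunctor G) {p t : C}
    (ω : p ⊗ t ⟶ parUnit C) :
    (M.comp N).mapPairing ω = N.mapPairing (M.mapPairing ω) := by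
  change (N.μ _ _ ≫ G.map (M.μ _ _)) ≫ G.map (F.map ω) ≫ G.map M.parη ≫ N.parη = _
  simp [mapPairing]

end LDFunctor

end Comp

section Equivalence

-- Monoidality of the unit of the equivalence, with the oplax comparison eliminated because it
-- inverts the lax one.
open Functor.LaxMonoidal Functor.OplaxMonoidal in
theorem unit_tensor_comp {C : Type*} [Category* C] {D : Type*} [Category* D] [MonoidalCategory C]
    [MonoidalCategory D] (E : C ≌ D) [E.functor.Monoidal] [E.inverse.Monoidal] [E.IsMonoidal]
    (X Y : C) : (E.unit.app X ⊗ₘ E.unit.app Y) ≫ μ E.inverse _ _ ≫ E.inverse.map (μ E.functor X Y) =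
      E.unit.app (X ⊗ Y) := by
  have := E.toAdjunction.unit_app_tensor_comp_map_δ X Y
  simp only [Equivalence.toAdjunction_unit] at this
  rw [← reassoc_of% this, ← Functor.map_comp]
  simp

open Functor.LaxMonoidal Functor.OplaxMonoidal in
theorem unit_unit_comp {C : Type*} [Category* C] {D : Type*} [Category* D] [MonoidalCategory C]
    [MonoidalCategory D] (E : C ≌ D) [E.functor.Monoidal] [E.inverse.Monoidal] [E.IsMonoidal] :
    E.unit.app (𝟙_ C) ≫ E.inverse.map (η E.functor) ≫ η E.inverse = 𝟙 _ := by
  have := E.toAdjunction.unit_app_unit_comp_map_η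
  simp only [Equivalence.toAdjunction_unit] at this
  rw [reassoc_of% this]
  simp

/-- The inverse of a strong monoidal equivalence is strong monoidal. -/
@[reducible]
noncomputable def functorMonoidal {C : Type*} [Category* C] {D : Type*} [Category* D]
    [MonoidalCategory C] [MonoidalCategory D] (E : C ≌ D) (h : E.inverse.Monoidal) :
    E.functor.Monoidal :=
  letI : E.symm.functor.Monoidal := h
  E.symm.inverseMonoidal

theorem functorMonoidal_isMonoidal {C : Type*} [Category* C] {D : Type*} [Category* D]
    [MonoidalCategory C] [MonoidalCategory D] (E : C ≌ D) (h : E.inverse.Monoidal) :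
    @Equivalence.IsMonoidal _ _ _ _ _ _ E (functorMonoidal E h) h := by
  let : E.symm.functor.Monoidal := h
  let : E.symm.inverse.Monoidal := E.symm.inverseMonoidal
  have : E.symm.IsMonoidal := ⟨rfl, fun _ _ => rfl⟩
  exact Equivalence.isMonoidal_symm E.symm

variable {C : Type u₁} [Category.{v₁} C] {D : Type u₂} [Category.{v₂} D]
variable [LinearlyDistributive C] [LinearlyDistributive D]

theorem distL_naturality {x x' y y' z z' : C} (f : x ⟶ x') (g : y ⟶ y') (h : z ⟶ z') :
    (f ⊗ₘ parHom g h) ≫ distL x' y' z' = distL x y z ≫ parHom (f ⊗ₘ g) h := by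
  simp only [MonoidalCategory.tensorHom_def, parHom_def, MonoidalCategory.whiskerLeft_comp,
    parRight_comp, Category.assoc]
  rw [distL_nat₃, reassoc_of% (distL_nat₂ x' g z), reassoc_of% (distL_nat₁ f y z)]

theorem distR_naturality {x x' y y' z z' : C} (f : x ⟶ x') (g : y ⟶ y') (h : z ⟶ z') :
    (parHom f g ⊗ₘ h) ≫ distR x' y' z' = distR x y z ≫ parHom f (g ⊗ₘ h) := by
  simp only [MonoidalCategory.tensorHom_def, parHom_def, comp_whiskerRight,
    parLeft_comp, Category.assoc]
  rw [distR_nat₃, reassoc_of% (distR_nat₂ x' g z), reassoc_of% (distR_nat₁ f y z)]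

theorem parHom_comp_parHom {x x' x'' y y' y'' : C} (f : x ⟶ x') (f' : x' ⟶ x'') (g : y ⟶ y')
    (g' : y' ⟶ y'') : parHom f g ≫ parHom f' g' = parHom (f ≫ f') (g ≫ g') :=
  @MonoidalCategory.tensorHom_comp_tensorHom C _ ParCategory.par _ _ _ _ _ _ f g f' g'

theorem parHom_id_left (x : C) {y y' : C} (g : y ⟶ y') : parHom (𝟙 x) g = parLeft x g :=
  @MonoidalCategory.id_tensorHom C _ ParCategory.par x _ _ g

theorem parHom_id_right {x x' : C} (f : x ⟶ x') (y : C) : parHom f (𝟙 y) = parRight f y :=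
  @MonoidalCategory.tensorHom_id C _ ParCategory.par _ _ f y

instance {x x' y y' : C} (f : x ⟶ x') (g : y ⟶ y') [IsIso f] [IsIso g] : IsIso (parHom f g) :=
  ⟨parHom (inv f) (inv g),
    by rw [parHom_comp_parHom, IsIso.hom_inv_id, IsIso.hom_inv_id, parHom_id_left, parLeft_id],
    by rw [parHom_comp_parHom, IsIso.inv_hom_id, IsIso.inv_hom_id, parHom_id_left, parLeft_id]⟩

section Unit

variable {F : C ⥤ D} {G : D ⥤ C} [G.Faithful] (N : LDFunctor G) (u : ∀ X, X ⟶ G.obj (F.obj X))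
  [∀ X, IsIso (u X)] (hu : ∀ {X Y : C} (f : X ⟶ Y), f ≫ u Y = u X ≫ G.map (F.map f))
  (m : ∀ X Y, F.obj X ⊗ F.obj Y ⟶ F.obj (X ⊗ Y)) (s : ∀ X Y, F.obj X ⅋ F.obj Y ⟶ F.obj (X ⅋ Y))
  (hm : ∀ X Y, (u X ⊗ₘ u Y) ≫ N.μ _ _ ≫ G.map (m X Y) = u (X ⊗ Y))
  (hs : ∀ X Y, parHom (u X) (u Y) ≫ N.parμ _ _ ≫ G.map (s X Y) = u (X ⅋ Y))
include hu hm hs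

/-- After applying the faithful `G` and cancelling the invertible comparisons and units, both sides
become `distL X Y Z` followed by the unit at its target. Thus compatibility of `F` with the
distributions is forced by that of `G`. -/
theorem map_distL_of_unit (X Y Z : C) :
    F.obj X ◁ s Y Z ≫ m X (Y ⅋ Z) ≫ F.map (distL X Y Z) =
      distL _ _ _ ≫ parRight (m X Y) (F.obj Z) ≫ s (X ⊗ Y) Z := by
  apply G.map_injective
  rw [← cancel_epi (N.μ _ _), ← cancel_epi (G.obj (F.obj X) ◁ N.parμ _ _),
    ← cancel_epi (u X ⊗ₘ parHom (u Y) (u Z))]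
  simp only [Functor.map_comp]
  rw [← reassoc_of% (N.μ_natural_right (F.obj X) (s Y Z)),
    reassoc_of% (N.distL_eq (F.obj X) (F.obj Y) (F.obj Z)),
    ← reassoc_of% (N.parμ_natural_left (m X Y) (F.obj Z)),
    reassoc_of% (distL_naturality (u X) (u Y) (u Z)),
    ← id_tensorHom, ← id_tensorHom, tensorHom_comp_tensorHom_assoc, tensorHom_comp_tensorHom_assoc,
    ← parHom_id_right, ← parHom_id_right]
  simp only [Category.comp_id, Category.assoc]
  rw [hs, reassoc_of% hm, ← hu, ← Category.assoc (parHom (N.μ _ _) _), parHom_comp_parHom,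
    ← Category.assoc (parHom _ _) (parHom _ _), parHom_comp_parHom, hm, Category.comp_id,
    Category.comp_id, hs]

theorem map_distR_of_unit (X Y Z : C) :
    s X Y ▷ F.obj Z ≫ m (X ⅋ Y) Z ≫ F.map (distR X Y Z) =
      distR _ _ _ ≫ parLeft (F.obj X) (m Y Z) ≫ s X (Y ⊗ Z) := by
  apply G.map_injective
  rw [← cancel_epi (N.μ _ _), ← cancel_epi (N.parμ _ _ ▷ G.obj (F.obj Z)),
    ← cancel_epi (parHom (u X) (u Y) ⊗ₘ u Z)]
  simp only [Functor.map_comp]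
  rw [← reassoc_of% (N.μ_natural_left (s X Y) (F.obj Z)),
    reassoc_of% (N.distR_eq (F.obj X) (F.obj Y) (F.obj Z)),
    ← reassoc_of% (N.parμ_natural_right (F.obj X) (m Y Z)),
    reassoc_of% (distR_naturality (u X) (u Y) (u Z)),
    ← tensorHom_id, ← tensorHom_id, tensorHom_comp_tensorHom_assoc, tensorHom_comp_tensorHom_assoc,
    ← parHom_id_left, ← parHom_id_left]
  simp only [Category.comp_id, Category.assoc]
  rw [hs, reassoc_of% hm, ← hu, ← Category.assoc (parHom _ (N.μ _ _)), parHom_comp_parHom,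
    ← Category.assoc (parHom _ _) (parHom _ _), parHom_comp_parHom, hm, Category.comp_id,
    Category.comp_id, hs]

end Unit

variable (E : C ≌ D) (N : LDFunctor E.inverse)

/-- The inverse of a strong equivalence of linearly distributive categories is strong. -/
noncomputable def LDFunctor.functorOfInverse : LDFunctor E.functor :=
  have hu : ∀ {X Y : C} (f : X ⟶ Y), f ≫ E.unit.app Y = E.unit.app X ≫
      E.inverse.map (E.functor.map f) := fun f => E.unit.naturality f
  have hm := @unit_tensor_comp _ _ _ _ _ _ E (functorMonoidal E N.tens) N.tens
    (functorMonoidal_isMonoidal E N.tens)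
  have hs := @unit_tensor_comp _ _ _ _ ParCategory.par ParCategory.par E
    (@functorMonoidal _ _ _ _ ParCategory.par ParCategory.par E N.par) N.par
    (@functorMonoidal_isMonoidal _ _ _ _ ParCategory.par ParCategory.par E N.par)
  { tens := functorMonoidal E N.tens
    par := @functorMonoidal _ _ _ _ ParCategory.par ParCategory.par E N.par
    map_distL := map_distL_of_unit N (fun X => E.unit.app X) hu _ _ hm hs
    map_distR := map_distR_of_unit N (fun X => E.unit.app X) hu _ _ hm hs }

/-- An equivalence whose inverse is strong is an equivalence of linearly distributive
categories. -/
noncomputable def LDEquivalence.ofInverse : LDEquivalence E where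
  functor := LDFunctor.functorOfInverse E N
  inverse := N
  tens_isMonoidal := functorMonoidal_isMonoidal E N.tens
  par_isMonoidal := @functorMonoidal_isMonoidal _ _ _ _ ParCategory.par ParCategory.par E N.par

/-- The unit of the equivalence is natural and monoidal for both structures, so the round trip of a
pairing, restricted along it, is the pairing itself. -/
theorem LDEquivalence.mapPairing_mapPairing {E : C ≌ D} (L : LDEquivalence E) {p t : C}
    (ω : p ⊗ t ⟶ parUnit C) :
    (E.unit.app p ⊗ₘ E.unit.app t) ≫ L.inverse.mapPairing (L.functor.mapPairing ω) = ω := by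
  have hm := @unit_tensor_comp _ _ _ _ _ _ E L.functor.tens L.inverse.tens L.tens_isMonoidal p t
  have hs := @unit_unit_comp _ _ _ _ ParCategory.par ParCategory.par E L.functor.par L.inverse.par
    L.par_isMonoidal
  change (E.unit.app p ⊗ₘ E.unit.app t) ≫ L.inverse.μ _ _ ≫
    E.inverse.map (L.functor.μ p t ≫ E.functor.map ω ≫ L.functor.parη) ≫ L.inverse.parη = ω
  change _ ≫ L.inverse.μ _ _ ≫ E.inverse.map (L.functor.μ p t) = _ at hm
  change E.unit.app (parUnit C) ≫ E.inverse.map L.functor.parη ≫ L.inverse.parη = 𝟙 _ at hs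
  have hu : ω ≫ E.unit.app (parUnit C) = E.unit.app (p ⊗ t) ≫ E.inverse.map (E.functor.map ω) :=
    E.unit.naturality ω
  simp only [Functor.map_comp, Category.assoc]
  rw [reassoc_of% hm, ← Category.assoc (E.unit.app (p ⊗ t)), ← hu, Category.assoc, hs]
  exact Category.comp_id ω

end Equivalence

theorem StarCycle.rotate_tensorHom {C : Type u} [Category.{v} C] [StarAutonomous C]
    (σ : StarCycle C) {p p' t t' : C} (f : p' ⟶ p) (g : t' ⟶ t) (ω : p ⊗ t ⟶ parUnit C) :
    σ.rotate ((f ⊗ₘ g) ≫ ω) = (g ⊗ₘ f) ≫ σ.rotate ω := by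
  rw [MonoidalCategory.tensorHom_def, Category.assoc, σ.rotate_whiskerRight, σ.rotate_whiskerLeft,
    tensorHom_def'_assoc]

/-- The inverse functor, here `zero` or its restriction, is the explicit one. Applying it and
restricting along the unit transfers its compatibility with rotation to the functor, about whose
comparisons nothing else is known. -/
theorem LDEquivalence.functor_preservesCycle {C : Type u₁} [Category.{v₁} C] {D : Type u₂}
    [Category.{v₂} D] [StarAutonomous C] [StarAutonomous D] {E : C ≌ D} (L : LDEquivalence E)
    {σ : StarCycle C} {σ' : StarCycle D}
    (h : ∀ {p t : D} (ω : p ⊗ t ⟶ parUnit D), L.inverse.mapPairing (σ'.rotate ω) =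
      σ.rotate (L.inverse.mapPairing ω)) : L.functor.PreservesCycle σ σ' := by
  refine L.functor.preservesCycle fun p => L.inverse.mapPairing_injective ?_
  rw [h, ← cancel_epi (E.unit.app _ ⊗ₘ E.unit.app _), L.mapPairing_mapPairing]
  rw [← σ.rotate_tensorHom (E.unit.app p) (E.unit.app (perp p)), L.mapPairing_mapPairing]

namespace ZString

/-! ### Arrows of strings are determined by their components at zero -/

section

variable {C : Type u} [Category.{v} C] [LinearlyDistributive C]

/-- The units may be ignored because the counits determine them. -/
theorem ext_of_γ {p q : ZString C} (h : ∀ n, p.obj n = q.obj n)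
    (h' : ∀ m n (e : n = m + 1), SameArrow (p.γ m n e) (q.γ m n e)) : p = q := by
  obtain ⟨P, a⟩ := p
  obtain ⟨Q, b⟩ := q
  obtain rfl : P = Q := funext h
  congr
  funext m n e
  exact LinearAdjoint.ext_γ (sameArrow_iff.1 (h' m n e))

/-- The components of the string of mates of an arrow, with either parity. -/
def extend {p q : ZString C} (f : p.obj 0 ⟶ q.obj 0) (n : ℤ) :
    (Even n → (p.obj n ⟶ q.obj n)) × (Odd n → (q.obj n ⟶ p.obj n)) :=
  -- Induction away from `0` in both directions, each component being the transpose of its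
  -- neighbour. Parity enters as a hypothesis of the components, so both directions of arrow are
  -- carried along; the odd case at `0` is vacuous.
  n.inductionOn' 0 (fun _ => f, fun h => absurd h (by decide))
    (fun k _ c => (fun h => (q.adj k (k + 1) rfl).lCurry (c.2 (by grind) ▷ _ ≫ p.γ k (k + 1) rfl),
      fun h => (p.adj k (k + 1) rfl).lCurry (c.1 (by grind) ▷ _ ≫ q.γ k (k + 1) rfl)))
    (fun k _ c =>
      (fun h => (q.adj (k - 1) k (by omega)).rCurry
          (_ ◁ c.2 (by grind) ≫ p.γ (k - 1) k (by omega)),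
        fun h => (p.adj (k - 1) k (by omega)).rCurry
          (_ ◁ c.1 (by grind) ≫ q.γ (k - 1) k (by omega))))

theorem extend_zero {p q : ZString C} (f : p.obj 0 ⟶ q.obj 0) (h : Even (0 : ℤ)) :
    (extend f 0).1 h = f := by
  rw [extend, Int.inductionOn'_self]

/-- For `m ≥ 0` the component at `m + 1`, and for `m < 0` the component at `m`, was defined as the
mate of the other one. -/
theorem extend_mate {p q : ZString C} (f : p.obj 0 ⟶ q.obj 0) (m n : ℤ) (h : n = m + 1) :
    (∀ (hm : Even m) (hn : Odd n), IsMate (p.adj m n h) (q.adj m n h)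
      ((extend f m).1 hm) ((extend f n).2 hn)) ∧
    (∀ (hm : Odd m) (hn : Even n), IsMate (q.adj m n h) (p.adj m n h)
      ((extend f m).2 hm) ((extend f n).1 hn)) := by
  rcases le_or_gt 0 m with h0 | h0
  · subst h
    have e : extend f (m + 1) = _ := Int.inductionOn'_add_one h0
    rw [e]
    exact ⟨fun hm hn => (LinearAdjoint.whiskerLeft_lCurry _ _).symm,
      fun hm hn => (LinearAdjoint.whiskerLeft_lCurry _ _).symm⟩
  · obtain rfl : m = n - 1 := by omega
    have e : extend f (n - 1) = _ := Int.inductionOn'_sub_one (by omega)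
    rw [e]
    exact ⟨fun hm hn => LinearAdjoint.whiskerRight_rCurry _ _,
      fun hm hn => LinearAdjoint.whiskerRight_rCurry _ _⟩

/-- The string of mates of an arrow. -/
def lift {p q : ZString C} (f : p.obj 0 ⟶ q.obj 0) : p ⟶ q :=
  ({ even := fun n => (extend f n).1
     odd := fun n => (extend f n).2
     mate_even := fun m n h => (extend_mate f m n h).1
     mate_odd := fun m n h => (extend_mate f m n h).2 } : Hom p q)

theorem zero_map_lift {p q : ZString C} (f : p.obj 0 ⟶ q.obj 0) : (zero C).map (lift f) = f :=
  extend_zero f Even.zero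

instance : (zero C).Full := ⟨fun f => ⟨lift f, zero_map_lift f⟩⟩

/-- Each of two mates determines the other, so equality spreads from `0` in both directions. Hence
`zero` is faithful, and equations between arrows of strings need only be checked at `0`. -/
theorem Hom.ext_zero {p q : ZString C} {f g : Hom p q}
    (h : f.even 0 Even.zero = g.even 0 Even.zero) : f = g := by
  have key : ∀ n : ℤ, (∀ hn, f.even n hn = g.even n hn) ∧ (∀ hn, f.odd n hn = g.odd n hn) := by
    intro n
    induction n using Int.inductionOn' (b := 0) with
    | zero => exact ⟨fun _ => h, fun hn => absurd hn (by decide)⟩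
    | succ k _ ih =>
      refine ⟨fun hn => ?_, fun hn => ?_⟩
      · have hk : Odd k := by grind
        apply (q.adj k (k + 1) rfl).hom_ext_right
        rw [← f.mate_odd k _ rfl hk hn, ← g.mate_odd k _ rfl hk hn, ih.2]
      · have hk : Even k := by grind
        apply (p.adj k (k + 1) rfl).hom_ext_right
        rw [← f.mate_even k _ rfl hk hn, ← g.mate_even k _ rfl hk hn, ih.1]
    | pred k _ ih =>
      refine ⟨fun hn => ?_, fun hn => ?_⟩
      · have hk : Odd k := by grind
        apply (q.adj (k - 1) k (by omega)).hom_ext_left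
        rw [f.mate_even _ k (by omega) hn hk, g.mate_even _ k (by omega) hn hk, ih.2]
      · have hk : Even k := by grind
        apply (p.adj (k - 1) k (by omega)).hom_ext_left
        rw [f.mate_odd _ k (by omega) hn hk, g.mate_odd _ k (by omega) hn hk, ih.1]
  exact Hom.ext (funext fun n => funext (key n).1) (funext fun n => funext (key n).2)

instance : (zero C).Faithful := ⟨fun h => Hom.ext_zero h⟩

/-! ### Tensor products of strings -/

/-- `x ⊗ y` or `y ⅋ x` -/
def pairObj : Bool → C → C → C
  | true, x, y => x ⊗ y
  | false, x, y => y ⅋ x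

variable (C) in
/-- `e` or `d` -/
def unitObj : Bool → C
  | true => 𝟙_ C
  | false => parUnit C

/-- The linear adjunction between `x ⊗ x'` and `y' ⅋ y`, or between `x' ⅋ x` and `y ⊗ y'`. -/
noncomputable def pairAdj {x y x' y' : C} (a : LinearAdjoint x y) (a' : LinearAdjoint x' y') :
    (b b' : Bool) → b' = !b → LinearAdjoint (pairObj b x x') (pairObj b' y y')
  | true, false, _ => a.tensor a'
  | false, true, _ => a'.par a

variable (C) in
/-- The linear adjunction between `e` and `d`, or between `d` and `e`. -/
def unitAdj : (b b' : Bool) → b' = !b → LinearAdjoint (unitObj C b) (unitObj C b')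
  | true, false, _ => LinearAdjoint.unit C
  | false, true, _ => LinearAdjoint.parUnit C

/-- The string `p n ⊗ q n` where `β n` is true and `q n ⅋ p n` where it is false. -/
noncomputable def interleave (β : ℤ → Bool) (hβ : ∀ m n, n = m + 1 → β n = !β m)
    (p q : ZString C) : ZString C where
  obj n := pairObj (β n) (p.obj n) (q.obj n)
  adj m n h := pairAdj (p.adj m n h) (q.adj m n h) (β m) (β n) (hβ m n h)

variable (C) in
/-- The string of alternating units. -/
def alternate (β : ℤ → Bool) (hβ : ∀ m n, n = m + 1 → β n = !β m) : ZString C where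
  obj n := unitObj C (β n)
  adj m n h := unitAdj C (β m) (β n) (hβ m n h)

/-- The parity of an integer. -/
def isEven (n : ℤ) : Bool := n % 2 == 0

theorem isEven_iff {n : ℤ} : isEven n = true ↔ Even n := by
  simp [isEven, Int.even_iff]

theorem isEven_false_iff {n : ℤ} : isEven n = false ↔ Odd n := by
  rw [← Int.not_even_iff_odd, ← isEven_iff, Bool.not_eq_true]

theorem isEven_succ (m n : ℤ) (h : n = m + 1) : isEven n = !isEven m := by
  subst h
  rw [Bool.eq_iff_iff, Bool.not_eq_true', isEven_iff, isEven_false_iff, Int.even_add_one,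
    Int.not_even_iff_odd]

theorem not_isEven_succ (m n : ℤ) (h : n = m + 1) : (!isEven n) = !!isEven m := by
  rw [isEven_succ m n h]

/-- `p ⊗ q` -/
noncomputable def tensorString (p q : ZString C) : ZString C := interleave isEven isEven_succ p q

/-- `p ⅋ q` -/
noncomputable def parString (p q : ZString C) : ZString C :=
  -- The arguments are reversed because the flag is false at even indices, where `pairObj` forms `⅋`
  -- in the opposite order.
  interleave (fun n => !isEven n) not_isEven_succ q p

variable (C) in
/-- `e` -/
def unitString : ZString C := alternate C isEven isEven_succ

variable (C) in
/-- `d` -/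
def parUnitString : ZString C := alternate C (fun n => !isEven n) not_isEven_succ

end

/-- The monoidal structure for which a fully faithful functor is strong, with a given tensor
product of objects. -/
@[reducible]
noncomputable def inducedStruct {C : Type*} [Category* C] {D : Type*} [Category* D]
    [MonoidalCategory C] (F : D ⥤ C) [F.Full] [F.Faithful] (t : D → D → D) (e : D)
    (μ : ∀ X Y, F.obj X ⊗ F.obj Y ≅ F.obj (t X Y)) (ε : 𝟙_ C ≅ F.obj e) :
    MonoidalCategoryStruct D where
  tensorObj := t
  tensorUnit := e
  whiskerLeft X _ _ f := F.preimage ((μ _ _).inv ≫ F.obj X ◁ F.map f ≫ (μ _ _).hom)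
  whiskerRight f X := F.preimage ((μ _ _).inv ≫ F.map f ▷ F.obj X ≫ (μ _ _).hom)
  tensorHom f g := F.preimage ((μ _ _).inv ≫ (F.map f ⊗ₘ F.map g) ≫ (μ _ _).hom)
  associator X Y Z := F.preimageIso ((((μ _ _).symm ≪≫ ((μ _ _).symm ⊗ᵢ .refl _))
        ≪≫ α_ (F.obj X) (F.obj Y) (F.obj Z) ≪≫ ((.refl _ ⊗ᵢ μ _ _) ≪≫ μ _ _)))
  leftUnitor X := F.preimageIso (((μ _ _).symm ≪≫ (ε.symm ⊗ᵢ .refl _)) ≪≫ λ_ (F.obj X))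
  rightUnitor X := F.preimageIso (((μ _ _).symm ≪≫ (.refl _ ⊗ᵢ ε.symm)) ≪≫ ρ_ (F.obj X))

/-- The functor data for `inducedStruct`. -/
@[reducible]
noncomputable def inducedData {C : Type*} [Category* C] {D : Type*} [Category* D]
    [MonoidalCategory C] (F : D ⥤ C) [F.Full] [F.Faithful] (t : D → D → D) (e : D)
    (μ : ∀ X Y, F.obj X ⊗ F.obj Y ≅ F.obj (t X Y)) (ε : 𝟙_ C ≅ F.obj e) :
    letI := inducedStruct F t e μ ε
    Monoidal.InducingFunctorData F :=
  letI := inducedStruct F t e μ ε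
  { μIso := μ
    εIso := ε
    whiskerLeft_eq := fun _ _ _ _ => F.map_preimage _
    whiskerRight_eq := fun _ _ => F.map_preimage _
    tensorHom_eq := fun _ _ => F.map_preimage _
    associator_eq := fun _ _ _ => F.map_preimage _
    leftUnitor_eq := fun _ => F.map_preimage _
    rightUnitor_eq := fun _ => F.map_preimage _ }

section

variable {C : Type*} [Category* C] [MonoidalCategory C]

/-- With identity comparisons the induced associator is the original one. The statement is about an
arbitrary monoidal category, so that it serves both `⊗` and `⅋`. -/
theorem associator_of_refl (X Y Z : C) :
    (((Iso.refl ((X ⊗ Y) ⊗ Z)).symm ≪≫ ((Iso.refl (X ⊗ Y)).symm ⊗ᵢ Iso.refl Z)) ≪≫ α_ X Y Z ≪≫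
      ((Iso.refl X ⊗ᵢ Iso.refl (Y ⊗ Z)) ≪≫ Iso.refl (X ⊗ (Y ⊗ Z)))).hom = (α_ X Y Z).hom := by
  simp

theorem leftUnitor_of_refl (X : C) :
    (((Iso.refl (𝟙_ C ⊗ X)).symm ≪≫ ((Iso.refl (𝟙_ C)).symm ⊗ᵢ Iso.refl X)) ≪≫ λ_ X).hom =
      (λ_ X).hom := by
  simp

theorem rightUnitor_of_refl (X : C) :
    (((Iso.refl (X ⊗ 𝟙_ C)).symm ≪≫ (Iso.refl X ⊗ᵢ (Iso.refl (𝟙_ C)).symm)) ≪≫ ρ_ X).hom =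
      (ρ_ X).hom := by
  simp

end

/-- The monoidal category structure given by `inducedStruct`. -/
@[reducible]
noncomputable def inducedMonoidal {C : Type*} [Category* C] {D : Type*} [Category* D]
    [MonoidalCategory C] (F : D ⥤ C) [F.Full] [F.Faithful] (t : D → D → D) (e : D)
    (μ : ∀ X Y, F.obj X ⊗ F.obj Y ≅ F.obj (t X Y)) (ε : 𝟙_ C ≅ F.obj e) : MonoidalCategory D :=
  letI := inducedStruct F t e μ ε
  Monoidal.induced F (inducedData F t e μ ε)

/-- The functor along which a monoidal structure is induced is strong. -/
@[reducible]
noncomputable def inducedFunctorMonoidal {C : Type*} [Category* C] {D : Type*} [Category* D]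
    [MonoidalCategory C] (F : D ⥤ C) [F.Full] [F.Faithful] (t : D → D → D) (e : D)
    (μ : ∀ X Y, F.obj X ⊗ F.obj Y ≅ F.obj (t X Y)) (ε : 𝟙_ C ≅ F.obj e) :
    letI := inducedMonoidal F t e μ ε
    F.Monoidal :=
  letI := inducedStruct F t e μ ε
  Monoidal.fromInducedMonoidal F (inducedData F t e μ ε)

/-! ### The linearly distributive structure on strings, lifted along `zero`. -/

section

variable {C : Type u} [Category.{v} C] [LinearlyDistributive C]

-- The flag at `0` computes, so the object at `0` of a product of strings is by definition the
-- product of the objects at `0`; the comparisons can be identities and `zero` is strict.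
noncomputable scoped instance : MonoidalCategory (ZString C) :=
  inducedMonoidal (zero C) tensorString (unitString C) (fun _ _ => Iso.refl _) (Iso.refl _)

noncomputable scoped instance : ParCategory (ZString C) where
  par := @inducedMonoidal _ _ _ _ ParCategory.par (zero C) _ _ parString (parUnitString C)
    (fun _ _ => Iso.refl _) (Iso.refl _)

theorem zero_map_whiskerLeft (p : ZString C) {q r : ZString C} (f : q ⟶ r) :
    (zero C).map (p ◁ f) = (zero C).obj p ◁ (zero C).map f :=
  ((zero C).map_preimage _).trans ((Category.id_comp _).trans (Category.comp_id _))

theorem zero_map_parLeft (p : ZString C) {q r : ZString C} (f : q ⟶ r) :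
    (zero C).map (parLeft p f) = parLeft ((zero C).obj p) ((zero C).map f) :=
  ((zero C).map_preimage _).trans ((Category.id_comp _).trans (Category.comp_id _))

theorem zero_map_whiskerRight {p q : ZString C} (f : p ⟶ q) (r : ZString C) :
    (zero C).map (f ▷ r) = (zero C).map f ▷ (zero C).obj r :=
  ((zero C).map_preimage _).trans ((Category.id_comp _).trans (Category.comp_id _))

theorem zero_map_parRight {p q : ZString C} (f : p ⟶ q) (r : ZString C) :
    (zero C).map (parRight f r) = parRight ((zero C).map f) ((zero C).obj r) :=
  ((zero C).map_preimage _).trans ((Category.id_comp _).trans (Category.comp_id _))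

theorem zero_map_associator (p q r : ZString C) :
    (zero C).map (α_ p q r).hom = (α_ ((zero C).obj p) ((zero C).obj q) ((zero C).obj r)).hom :=
  ((zero C).map_preimage _).trans (associator_of_refl _ _ _)

theorem zero_map_parAssoc (p q r : ZString C) :
    (zero C).map (parAssoc p q r).hom =
      (parAssoc ((zero C).obj p) ((zero C).obj q) ((zero C).obj r)).hom :=
  ((zero C).map_preimage _).trans (@associator_of_refl C _ ParCategory.par _ _ _)

theorem zero_map_leftUnitor (p : ZString C) :
    (zero C).map (λ_ p).hom = (λ_ ((zero C).obj p)).hom :=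
  ((zero C).map_preimage _).trans (leftUnitor_of_refl _)

theorem zero_map_parLambda (p : ZString C) :
    (zero C).map (parLambda p).hom = (parLambda ((zero C).obj p)).hom :=
  ((zero C).map_preimage _).trans (@leftUnitor_of_refl C _ ParCategory.par _)

theorem zero_map_rightUnitor (p : ZString C) :
    (zero C).map (ρ_ p).hom = (ρ_ ((zero C).obj p)).hom :=
  ((zero C).map_preimage _).trans (rightUnitor_of_refl _)

theorem zero_map_parRho (p : ZString C) :
    (zero C).map (parRho p).hom = (parRho ((zero C).obj p)).hom :=
  ((zero C).map_preimage _).trans (@rightUnitor_of_refl C _ ParCategory.par _)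

/-- The linear distribution `p ⊗ (q ⅋ r) ⟶ (p ⊗ q) ⅋ r` -/
noncomputable def stringDistL (p q r : ZString C) : p ⊗ (q ⅋ r) ⟶ (p ⊗ q) ⅋ r :=
  (zero C).preimage (distL ((zero C).obj p) ((zero C).obj q) ((zero C).obj r))

/-- The linear distribution `(p ⅋ q) ⊗ r ⟶ p ⅋ (q ⊗ r)` -/
noncomputable def stringDistR (p q r : ZString C) : (p ⅋ q) ⊗ r ⟶ p ⅋ (q ⊗ r) :=
  (zero C).preimage (distR ((zero C).obj p) ((zero C).obj q) ((zero C).obj r))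

theorem zero_map_stringDistL (p q r : ZString C) :
    (zero C).map (stringDistL p q r) =
      distL ((zero C).obj p) ((zero C).obj q) ((zero C).obj r) :=
  (zero C).map_preimage _

theorem zero_map_stringDistR (p q r : ZString C) :
    (zero C).map (stringDistR p q r) =
      distR ((zero C).obj p) ((zero C).obj q) ((zero C).obj r) :=
  (zero C).map_preimage _

-- As `zero` is faithful and carries each structural arrow to its counterpart, each axiom is the
-- corresponding axiom at index `0`.
noncomputable scoped instance : LinearlyDistributive (ZString C) where
  distL := stringDistL
  distR := stringDistR
  distL_nat₁ f p q := (zero C).map_injective (by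
    simp only [Functor.map_comp, zero_map_whiskerRight, zero_map_parRight, zero_map_stringDistL]
    exact distL_nat₁ _ _ _)
  distL_nat₂ p _ _ f q := (zero C).map_injective (by
    simp only [Functor.map_comp, zero_map_whiskerLeft, zero_map_parRight, zero_map_stringDistL]
    exact distL_nat₂ _ _ _)
  distL_nat₃ p q _ _ f := (zero C).map_injective (by
    simp only [Functor.map_comp, zero_map_whiskerLeft, zero_map_parLeft, zero_map_stringDistL]
    exact distL_nat₃ _ _ _)
  distR_nat₁ f p q := (zero C).map_injective (by
    simp only [Functor.map_comp, zero_map_whiskerRight, zero_map_parRight, zero_map_stringDistR]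
    exact distR_nat₁ _ _ _)
  distR_nat₂ p _ _ f q := (zero C).map_injective (by
    simp only [Functor.map_comp, zero_map_whiskerRight, zero_map_parLeft, zero_map_stringDistR]
    exact distR_nat₂ _ _ _)
  distR_nat₃ p q _ _ f := (zero C).map_injective (by
    simp only [Functor.map_comp, zero_map_whiskerLeft, zero_map_parLeft, zero_map_stringDistR]
    exact distR_nat₃ _ _ _)
  distL_unit_left p q := (zero C).map_injective (by
    simp only [Functor.map_comp, zero_map_leftUnitor, zero_map_parRight, zero_map_stringDistL]
    exact distL_unit_left _ _)
  distL_unit_right p q := (zero C).map_injective (by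
    simp only [Functor.map_comp, zero_map_whiskerLeft, zero_map_parRho, zero_map_stringDistL]
    exact distL_unit_right _ _)
  distR_unit_left p q := (zero C).map_injective (by
    simp only [Functor.map_comp, zero_map_parLambda, zero_map_whiskerRight, zero_map_stringDistR]
    exact distR_unit_left _ _)
  distR_unit_right p q := (zero C).map_injective (by
    simp only [Functor.map_comp, zero_map_parLeft, zero_map_rightUnitor, zero_map_stringDistR]
    exact distR_unit_right _ _)
  distL_tensor p q r s := (zero C).map_injective (by
    simp only [Functor.map_comp, zero_map_whiskerLeft, zero_map_parRight, zero_map_stringDistL,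
      zero_map_associator]
    exact distL_tensor _ _ _ _)
  distL_par p q r s := (zero C).map_injective (by
    simp only [Functor.map_comp, zero_map_whiskerLeft, zero_map_parRight, zero_map_stringDistL,
      zero_map_parAssoc]
    exact distL_par _ _ _ _)
  distR_tensor p q r s := (zero C).map_injective (by
    simp only [Functor.map_comp, zero_map_whiskerRight, zero_map_parLeft, zero_map_stringDistR,
      zero_map_associator]
    exact distR_tensor _ _ _ _)
  distR_par p q r s := (zero C).map_injective (by
    simp only [Functor.map_comp, zero_map_whiskerRight, zero_map_parLeft, zero_map_stringDistR,
      zero_map_parAssoc]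
    exact distR_par _ _ _ _)
  distL_distR p q r s := (zero C).map_injective (by
    simp only [Functor.map_comp, zero_map_whiskerRight, zero_map_whiskerLeft, zero_map_stringDistR,
      zero_map_stringDistL, zero_map_associator]
    exact distL_distR _ _ _ _)
  distR_distL p q r s := (zero C).map_injective (by
    simp only [Functor.map_comp, zero_map_parRight, zero_map_parLeft, zero_map_stringDistR,
      zero_map_stringDistL, zero_map_parAssoc]
    exact distR_distL _ _ _ _)

variable (C) in
/-- The functor `zero` is a strict functor of linearly distributive categories. -/
noncomputable def zeroLD : LDFunctor (zero C) where
  tens := inducedFunctorMonoidal (zero C) tensorString (unitString C) (fun _ _ => Iso.refl _)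
    (Iso.refl _)
  par := @inducedFunctorMonoidal _ _ _ _ ParCategory.par (zero C) _ _ parString (parUnitString C)
    (fun _ _ => Iso.refl _) (Iso.refl _)
  map_distL p q r := by
    change (zero C).obj p ◁ 𝟙 ((zero C).obj q ⅋ (zero C).obj r) ≫
      𝟙 ((zero C).obj p ⊗ ((zero C).obj q ⅋ (zero C).obj r)) ≫ (zero C).map (stringDistL p q r) =
        distL _ _ _ ≫ parRight (𝟙 ((zero C).obj p ⊗ (zero C).obj q)) ((zero C).obj r) ≫ 𝟙 _
    rw [zero_map_stringDistL]
    simp only [MonoidalCategory.whiskerLeft_id, parRight_id, Category.comp_id]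
    exact (Category.id_comp _).trans (Category.id_comp _)
  map_distR p q r := by
    change 𝟙 ((zero C).obj p ⅋ (zero C).obj q) ▷ (zero C).obj r ≫
      𝟙 (((zero C).obj p ⅋ (zero C).obj q) ⊗ (zero C).obj r) ≫ (zero C).map (stringDistR p q r) =
        distR _ _ _ ≫ parLeft ((zero C).obj p) (𝟙 ((zero C).obj q ⊗ (zero C).obj r)) ≫ 𝟙 _
    rw [zero_map_stringDistR]
    simp only [MonoidalCategory.id_whiskerRight, parLeft_id, Category.comp_id]
    exact (Category.id_comp _).trans (Category.id_comp _)

theorem zeroLD_isStrict : (zeroLD C).IsStrict where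
  μ _ _ := ⟨rfl, rfl⟩
  ε := ⟨rfl, rfl⟩
  parμ _ _ := ⟨rfl, rfl⟩
  parε := ⟨rfl, rfl⟩

theorem zeroLD_mapPairing {p t : ZString C} (ω : p ⊗ t ⟶ parUnit (ZString C)) :
    (zeroLD C).mapPairing ω = (zero C).map ω :=
  (Category.id_comp _).trans (Category.comp_id _)

end

end ZString

namespace ZString

variable {C : Type u} [Category.{v} C] [LinearlyDistributive C]

/-! ### Duals of strings -/

/-- The counit of a linear adjunction as an arrow of `pairObj`. -/
def counitEven {x y : C} (a : LinearAdjoint x y) :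
    (b : Bool) → b = true → (pairObj b x y ⟶ unitObj C (!b))
  | true, _ => a.γ

/-- The unit of a linear adjunction as an arrow of `pairObj`. -/
def counitOdd {x y : C} (a : LinearAdjoint x y) :
    (b : Bool) → b = false → (unitObj C (!b) ⟶ pairObj b x y)
  | false, _ => a.τ

theorem sameArrow_counitEven {x y : C} (a : LinearAdjoint x y) {b : Bool} (hb : b = true) :
    SameArrow (counitEven a b hb) a.γ := by
  subst hb
  exact sameArrow_iff.2 rfl

theorem sameArrow_counitOdd {x y : C} (a : LinearAdjoint x y) {b : Bool} (hb : b = false) :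
    SameArrow (counitOdd a b hb) a.τ := by
  subst hb
  exact sameArrow_iff.2 rfl

theorem sameArrow_pairAdj_true {x y x' y' : C} (a : LinearAdjoint x y) (a' : LinearAdjoint x' y')
    {b b' : Bool} (h : b' = !b) (hb : b = true) :
    SameArrow (pairAdj a a' b b' h).γ (rbind a.γ a'.γ) := by
  subst hb h
  exact sameArrow_iff.2 (a.tensor_γ a')

theorem sameArrow_pairAdj_false {x y x' y' : C} (a : LinearAdjoint x y) (a' : LinearAdjoint x' y')
    {b b' : Bool} (h : b' = !b) (hb : b = false) :
    SameArrow (pairAdj a a' b b' h).γ (lbind a'.γ a.γ) := by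
  subst hb h
  exact sameArrow_iff.2 (a'.par_γ a)

theorem sameArrow_unitAdj_true {b b' : Bool} (h : b' = !b) (hb : b = true) :
    SameArrow (unitAdj C b b' h).γ (λ_ (parUnit C)).hom := by
  subst hb h
  exact sameArrow_iff.2 rfl

theorem sameArrow_unitAdj_false {b b' : Bool} (h : b' = !b) (hb : b = false) :
    SameArrow (unitAdj C b b' h).γ (ρ_ (parUnit C)).hom := by
  subst hb h
  exact sameArrow_iff.2 rfl

/-- The mate condition between a counit and the next unit is `unit_rbind`. Two names `j`, `j'` for
one index are needed because the index of the shifted factor and that of the unshifted one agree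
only propositionally. -/
theorem isMate_counitEven (p : ZString C) {i j j' k : ℤ} (hj : j = i + 1) (hj' : j' = i + 1)
    (hk : k = j + 1) (hk' : k = j' + 1) {b b' : Bool} (h : b' = !b) (h' : (!b') = !!b)
    (hb : b = true) (hb' : b' = false) :
    IsMate (pairAdj (p.adj i j' hj') (p.adj j k hk) b b' h) (unitAdj C (!b) (!b') h')
      (counitEven (p.adj i j hj) b hb) (counitOdd (p.adj j' k hk') b' hb') := by
  obtain rfl : j = j' := by omega
  subst hb hb'
  refine Eq.trans ?_ (congrArg (_ ≫ ·) (LinearAdjoint.tensor_γ _ _)).symm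
  exact (rightUnitor_naturality _).trans (unit_rbind _ _).symm

/-- Here the mate condition is `unit_lbind`, in which the counit transposed along itself is an
identity. -/
theorem isMate_counitOdd (p : ZString C) {i j j' k : ℤ} (hj : j = i + 1) (hj' : j' = i + 1)
    (hk : k = j + 1) (hk' : k = j' + 1) {b b' : Bool} (h : b' = !b) (h' : (!b') = !!b)
    (hb : b = false) (hb' : b' = true) :
    IsMate (unitAdj C (!b) (!b') h') (pairAdj (p.adj i j' hj') (p.adj j k hk) b b' h)
      (counitOdd (p.adj i j hj) b hb) (counitEven (p.adj j' k hk') b' hb') := by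
  obtain rfl : j = j' := by omega
  subst hb hb'
  refine (congrArg (_ ≫ ·) (LinearAdjoint.par_γ _ _)).trans ?_
  refine (unit_lbind _ _ _).trans ?_
  rw [LinearAdjoint.lCurry_γ, id_whiskerRight, Category.id_comp]
  exact (leftUnitor_naturality _).symm

/-- The counit `p ⊗ p^* ⟶ d` -/
noncomputable def succCounit (p : ZString C) : p ⊗ p.succ ⟶ parUnit (ZString C) :=
  ({ even := fun n hn => counitEven (p.adj n (n + 1) rfl) (isEven n) (isEven_iff.2 hn)
     odd := fun n hn => counitOdd (p.adj n (n + 1) rfl) (isEven n) (isEven_false_iff.2 hn)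
     mate_even := fun m n h _ _ =>
      isMate_counitEven p _ h _ _ (isEven_succ m n h) _ _ _
     mate_odd := fun m n h _ _ =>
      isMate_counitOdd p _ h _ _ (isEven_succ m n h) _ _ _ } :
    Hom (tensorString p p.succ) (parUnitString C))

/-- The counit `*p ⊗ p ⟶ d` -/
noncomputable def predCounit (p : ZString C) : p.pred ⊗ p ⟶ parUnit (ZString C) :=
  ({ even := fun n hn => counitEven (p.adj (n - 1) n (by omega)) (isEven n) (isEven_iff.2 hn)
     odd := fun n hn => counitOdd (p.adj (n - 1) n (by omega)) (isEven n) (isEven_false_iff.2 hn)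
     mate_even := fun m n h _ _ =>
      isMate_counitEven p _ (by omega) _ _ (isEven_succ m n h) _ _ _
     mate_odd := fun m n h _ _ =>
      isMate_counitOdd p _ (by omega) _ _ (isEven_succ m n h) _ _ _ } :
    Hom (tensorString p.pred p) (parUnitString C))

theorem zero_map_succCounit (p : ZString C) :
    (zero C).map (succCounit p) = p.γ 0 (0 + 1) rfl := rfl

theorem zero_map_predCounit (p : ZString C) :
    (zero C).map (predCounit p) = p.γ (0 - 1) 0 (by omega) := rfl

/-- A linear adjunction of strings, from one between their objects at zero. -/
noncomputable def liftAdj {p q : ZString C} (a : LinearAdjoint (p.obj 0) (q.obj 0))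
    (c : p ⊗ q ⟶ parUnit (ZString C)) (hc : (zero C).map c = a.γ) : LinearAdjoint p q where
  -- The counit is given with all of its components; the unit can be any lift, since the triangle
  -- identities are tested at `0`.
  τ := (zero C).preimage a.τ
  γ := c
  triangle_left := (zero C).map_injective (by
    have h : (zero C).map (ρ_ p).inv = (ρ_ ((zero C).obj p)).inv :=
      congrArg Iso.inv (Iso.ext (zero_map_rightUnitor p) : (zero C).mapIso (ρ_ p) = ρ_ _)
    have h' : (zero C).map ((zero C).preimage a.τ : 𝟙_ (ZString C) ⟶ q ⅋ p) = a.τ :=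
      (zero C).map_preimage _
    have hd : (zero C).map (distL p q p) = distL ((zero C).obj p) ((zero C).obj q)
      ((zero C).obj p) := zero_map_stringDistL _ _ _
    simp only [Functor.map_comp, zero_map_whiskerLeft, zero_map_parRight, zero_map_parLambda, h,
      h', hd, hc]
    exact a.triangle_left.trans ((zero C).map_id p).symm)
  triangle_right := (zero C).map_injective (by
    have h : (zero C).map (λ_ q).inv = (λ_ ((zero C).obj q)).inv :=
      congrArg Iso.inv (Iso.ext (zero_map_leftUnitor q) : (zero C).mapIso (λ_ q) = λ_ _)
    have h' : (zero C).map ((zero C).preimage a.τ : 𝟙_ (ZString C) ⟶ q ⅋ p) = a.τ :=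
      (zero C).map_preimage _
    have hd : (zero C).map (distR q p q) = distR ((zero C).obj q) ((zero C).obj p)
      ((zero C).obj q) := zero_map_stringDistR _ _ _
    simp only [Functor.map_comp, zero_map_whiskerRight, zero_map_parLeft, zero_map_parRho, h,
      h', hd, hc]
    exact a.triangle_right.trans ((zero C).map_id q).symm)

/-- The star-autonomous structure on strings. -/
noncomputable scoped instance starAutonomous : StarAutonomous (ZString C) where
  perp := succ
  prep := pred
  perpAdj p := liftAdj (q := p.succ) (p.adj 0 (0 + 1) rfl) (succCounit p) (zero_map_succCounit p)
  prepAdj p := liftAdj (p := p.pred) (p.adj (0 - 1) 0 (by omega)) (predCounit p)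
    (zero_map_predCounit p)

variable (C) in
theorem isStandard : IsStandard C where
  tensor _ _ :=
    { obj_even := fun _ hn => congrArg (fun b => pairObj b _ _) (isEven_iff.2 hn)
      obj_odd := fun _ hn => congrArg (fun b => pairObj b _ _) (isEven_false_iff.2 hn)
      γ_even := fun _ _ _ hm => sameArrow_pairAdj_true _ _ _ (isEven_iff.2 hm)
      γ_odd := fun _ _ _ hm => sameArrow_pairAdj_false _ _ _ (isEven_false_iff.2 hm) }
  par p q :=
    { obj_even := fun n hn =>
        congrArg (fun b => pairObj (!b) (q.obj n) (p.obj n)) (isEven_iff.2 hn)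
      obj_odd := fun n hn =>
        congrArg (fun b => pairObj (!b) (q.obj n) (p.obj n)) (isEven_false_iff.2 hn)
      γ_even := fun _ _ _ hm =>
        sameArrow_pairAdj_false _ _ _ (congrArg Bool.not (isEven_iff.2 hm))
      γ_odd := fun _ _ _ hm =>
        sameArrow_pairAdj_true _ _ _ (congrArg Bool.not (isEven_false_iff.2 hm)) }
  unit :=
    { obj_even := fun _ hn => congrArg (unitObj C) (isEven_iff.2 hn)
      obj_odd := fun _ hn => congrArg (unitObj C) (isEven_false_iff.2 hn)
      γ_even := fun _ _ _ hm => sameArrow_unitAdj_true _ (isEven_iff.2 hm)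
      γ_odd := fun _ _ _ hm => sameArrow_unitAdj_false _ (isEven_false_iff.2 hm) }
  parUnit :=
    { obj_even := fun _ hn => congrArg (fun b => unitObj C (!b)) (isEven_iff.2 hn)
      obj_odd := fun _ hn => congrArg (fun b => unitObj C (!b)) (isEven_false_iff.2 hn)
      γ_even := fun _ _ _ hm =>
        sameArrow_unitAdj_false _ (congrArg Bool.not (isEven_iff.2 hm))
      γ_odd := fun _ _ _ hm =>
        sameArrow_unitAdj_true _ (congrArg Bool.not (isEven_false_iff.2 hm)) }
  zero_strict := ⟨zeroLD C, zeroLD_isStrict⟩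
  perp _ := rfl
  prep _ := rfl
  perp_γ_even _ _ _ := sameArrow_counitEven _ _
  perp_γ_odd _ _ _ := sameArrow_counitOdd _ _
  prep_γ_even _ _ _ := sameArrow_counitEven _ _
  prep_γ_odd _ _ _ := sameArrow_counitOdd _ _

/-! ### Strictness of the negations -/

/-- A shift of an interleaved string is by definition the interleaving of the shifted strings along
the shifted parity function. The de Morgan equalities of objects therefore reduce to comparing
parity functions, without transport of adjunctions. -/
theorem interleave_congr {β β' : ℤ → Bool} (h : ∀ n, β n = β' n) (hβ hβ') (p q : ZString C) :
    interleave β hβ p q = interleave β' hβ' p q := by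
  obtain rfl : β = β' := funext h
  rfl

theorem alternate_congr {β β' : ℤ → Bool} (h : ∀ n, β n = β' n) (hβ hβ') :
    alternate C β hβ = alternate C β' hβ' := by
  obtain rfl : β = β' := funext h
  rfl

theorem sameArrow_γ (p : ZString C) {m n m' n' : ℤ} (h : n = m + 1) (h' : n' = m' + 1)
    (e : m = m') : SameArrow (p.γ m n h) (p.γ m' n' h') := by
  subst h h' e
  exact sameArrow_iff.2 rfl

/-- The indices `n` and `n - 1 + 1` agree only propositionally, so the equality of strings goes
through objects and counits. -/
theorem succ_pred (p : ZString C) : p.pred.succ = p :=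
  ext_of_γ (fun _ => congrArg p.obj (by omega)) fun _ _ _ => p.sameArrow_γ _ _ (by omega)

theorem pred_succ (p : ZString C) : p.succ.pred = p :=
  ext_of_γ (fun _ => congrArg p.obj (by omega)) fun _ _ _ => p.sameArrow_γ _ _ (by omega)

theorem perp_par (p q : ZString C) : perp p ⊗ perp q = perp (q ⅋ p) :=
  interleave_congr (fun n => by beta_reduce; rw [isEven_succ n (n + 1) rfl, Bool.not_not]) _ _ _ _

theorem perp_tensor (p q : ZString C) : perp q ⅋ perp p = perp (p ⊗ q) :=
  interleave_congr (fun n => by rw [isEven_succ n (n + 1) rfl]) _ _ _ _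

theorem prep_par (p q : ZString C) : prep p ⊗ prep q = prep (q ⅋ p) :=
  interleave_congr (fun n => by rw [isEven_succ (n - 1) n (by omega)]) _ _ _ _

theorem prep_tensor (p q : ZString C) : prep q ⅋ prep p = prep (p ⊗ q) :=
  interleave_congr (fun n => by rw [isEven_succ (n - 1) n (by omega), Bool.not_not]) _ _ _ _

theorem perp_parUnit : 𝟙_ (ZString C) = perp (parUnit (ZString C)) :=
  alternate_congr (fun n => by beta_reduce; rw [isEven_succ n (n + 1) rfl, Bool.not_not]) _ _

theorem perp_unit : parUnit (ZString C) = perp (𝟙_ (ZString C)) :=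
  alternate_congr (fun n => by rw [isEven_succ n (n + 1) rfl]) _ _

theorem prep_parUnit : 𝟙_ (ZString C) = prep (parUnit (ZString C)) :=
  alternate_congr (fun n => by rw [isEven_succ (n - 1) n (by omega)]) _ _

theorem prep_unit : parUnit (ZString C) = prep (𝟙_ (ZString C)) :=
  alternate_congr (fun n => by rw [isEven_succ (n - 1) n (by omega), Bool.not_not]) _ _

theorem zero_map_rbind {p q s t : ZString C} (ω : p ⊗ t ⟶ parUnit (ZString C))
    (ψ : q ⊗ s ⟶ parUnit (ZString C)) :
    (zero C).map (rbind ω ψ) = rbind ((zero C).map ω) ((zero C).map ψ) := by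
  have h := (zeroLD C).mapPairing_rbind ω ψ
  simp only [zeroLD_mapPairing] at h
  refine Eq.trans ?_ h
  refine Eq.symm ((congrArg₂ (· ≫ ·) (id_whiskerRight _ _)
    (congrArg (· ≫ _) (whiskerLeft_id _ _))).trans ?_)
  exact (Category.id_comp _).trans (Category.id_comp _)

theorem zero_map_lbind {p q s t : ZString C} (ω : p ⊗ t ⟶ parUnit (ZString C))
    (ψ : q ⊗ s ⟶ parUnit (ZString C)) :
    (zero C).map (lbind ω ψ) = lbind ((zero C).map ω) ((zero C).map ψ) := by
  have h := (zeroLD C).mapPairing_lbind ω ψ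
  simp only [zeroLD_mapPairing] at h
  refine Eq.trans ?_ h
  refine Eq.symm ((congrArg₂ (· ≫ ·) (id_whiskerRight _ _)
    (congrArg (· ≫ _) (whiskerLeft_id _ _))).trans ?_)
  exact (Category.id_comp _).trans (Category.id_comp _)

/-- By faithfulness of `zero` the counits are compared at `0` alone, where the chosen one was
constructed as the `rbind` in question. The companions below hold for the same reason. -/
theorem sameArrow_rbind_prep (p q : ZString C) :
    SameArrow (rbind (prepAdj p).γ (prepAdj q).γ) (prepAdj (q ⅋ p)).γ :=
  sameArrow_of_map (zero C) (congrArg (· ⊗ _) (prep_par p q)) rfl (sameArrow_iff.2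
    ((zero_map_rbind _ _).trans (LinearAdjoint.tensor_γ _ _).symm))

theorem sameArrow_lbind_prep (p q : ZString C) :
    SameArrow (lbind (prepAdj q).γ (prepAdj p).γ) (prepAdj (p ⊗ q)).γ :=
  sameArrow_of_map (zero C) (congrArg (· ⊗ _) (prep_tensor p q)) rfl (sameArrow_iff.2
    ((zero_map_lbind _ _).trans (LinearAdjoint.par_γ _ _).symm))

theorem sameArrow_rbind_perp (p q : ZString C) :
    SameArrow (rbind (perpAdj p).γ (perpAdj q).γ) (perpAdj (p ⊗ q)).γ :=
  sameArrow_of_map (zero C) (congrArg (_ ⊗ ·) (perp_tensor p q)) rfl (sameArrow_iff.2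
    ((zero_map_rbind _ _).trans (LinearAdjoint.tensor_γ _ _).symm))

theorem sameArrow_lbind_perp (p q : ZString C) :
    SameArrow (lbind (perpAdj q).γ (perpAdj p).γ) (perpAdj (q ⅋ p)).γ :=
  sameArrow_of_map (zero C) (congrArg (_ ⊗ ·) (perp_par p q)) rfl (sameArrow_iff.2
    ((zero_map_lbind _ _).trans (LinearAdjoint.par_γ _ _).symm))

theorem sameArrow_perp_parUnit :
    SameArrow (ρ_ (parUnit (ZString C))).hom (perpAdj (parUnit (ZString C))).γ :=
  sameArrow_of_map (zero C) (congrArg (_ ⊗ ·) perp_parUnit) rfl (sameArrow_iff.2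
    (zero_map_rightUnitor _))

theorem sameArrow_perp_unit :
    SameArrow (λ_ (parUnit (ZString C))).hom (perpAdj (𝟙_ (ZString C))).γ :=
  sameArrow_of_map (zero C) (congrArg (_ ⊗ ·) perp_unit) rfl (sameArrow_iff.2
    (zero_map_leftUnitor _))

theorem sameArrow_prep_parUnit :
    SameArrow (λ_ (parUnit (ZString C))).hom (prepAdj (parUnit (ZString C))).γ :=
  sameArrow_of_map (zero C) (congrArg (· ⊗ _) prep_parUnit) rfl (sameArrow_iff.2
    (zero_map_leftUnitor _))

theorem sameArrow_prep_unit :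
    SameArrow (ρ_ (parUnit (ZString C))).hom (prepAdj (𝟙_ (ZString C))).γ :=
  sameArrow_of_map (zero C) (congrArg (· ⊗ _) prep_unit) rfl (sameArrow_iff.2
    (zero_map_rightUnitor _))

theorem sameArrow_perp_prep (p : ZString C) :
    SameArrow (prepAdj p).γ (perpAdj (prep p)).γ :=
  sameArrow_of_map (zero C) (congrArg (prep p ⊗ ·) (succ_pred p).symm) rfl
    (p.sameArrow_γ _ _ rfl)

theorem sameArrow_prep_perp (p : ZString C) :
    SameArrow (perpAdj p).γ (prepAdj (perp p)).γ :=
  sameArrow_of_map (zero C) (congrArg (· ⊗ perp p) (pred_succ p).symm) rfl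
    (p.sameArrow_γ _ _ rfl)

variable (C) in
theorem hasStrictNegations : HasStrictNegations (ZString C) where
  perp_par p q := isIdentity_lCurry _ (perp_par p q) (sameArrow_lbind_perp p q)
  perp_tensor p q := isIdentity_lCurry _ (perp_tensor p q) (sameArrow_rbind_perp p q)
  perp_parUnit := isIdentity_lCurry _ perp_parUnit sameArrow_perp_parUnit
  perp_unit := isIdentity_lCurry _ perp_unit sameArrow_perp_unit
  prep_par p q := isIdentity_rCurry _ (prep_par p q) (sameArrow_rbind_prep p q)
  prep_tensor p q := isIdentity_rCurry _ (prep_tensor p q) (sameArrow_lbind_prep p q)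
  prep_parUnit := isIdentity_rCurry _ prep_parUnit sameArrow_prep_parUnit
  prep_unit := isIdentity_rCurry _ prep_unit sameArrow_prep_unit
  perp_prep p := isIdentity_lCurry _ (succ_pred p).symm (sameArrow_perp_prep p)
  prep_perp p := isIdentity_rCurry _ (pred_succ p).symm (sameArrow_prep_perp p)

end ZString

/-! ### Full subcategories -/

section FullSubcategory

theorem isIdentity_of_hom {C : Type u} [Category.{v} C] {P : ObjectProperty C}
    {X Y : P.FullSubcategory} {f : X ⟶ Y} (hf : IsIdentity f.hom) : IsIdentity f :=
  isIdentity_of_map P.ι (ObjectProperty.FullSubcategory.ext hf.choose) hf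

namespace StarClosed

variable {C : Type u} [Category.{v} C] [StarAutonomous C] (P : ObjectProperty C)
  [hP : Fact (IsStarClosed P)]

scoped instance : P.IsMonoidal where
  prop_unit := hP.out.unit
  prop_tensor _ _ h h' := hP.out.tensor h h'

theorem isMonoidal_par : @ObjectProperty.IsMonoidal C _ ParCategory.par P :=
  @ObjectProperty.IsMonoidal.mk _ _ ParCategory.par _
    (@ObjectProperty.ContainsUnit.mk _ _ ParCategory.par _ hP.out.parUnit)
    (@ObjectProperty.TensorLE.mk _ _ ParCategory.par _ _ _ fun _ _ h h' => hP.out.par h h')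

scoped instance : ParCategory P.FullSubcategory where
  par := @ObjectProperty.fullMonoidalSubcategory C _ ParCategory.par P (isMonoidal_par P)

scoped instance : LinearlyDistributive P.FullSubcategory where
  distL X Y Z := ObjectProperty.homMk (distL X.obj Y.obj Z.obj)
  distR X Y Z := ObjectProperty.homMk (distR X.obj Y.obj Z.obj)
  distL_nat₁ f _ _ := P.hom_ext (distL_nat₁ f.hom _ _)
  distL_nat₂ _ _ _ f _ := P.hom_ext (distL_nat₂ _ f.hom _)
  distL_nat₃ _ _ _ _ f := P.hom_ext (distL_nat₃ _ _ f.hom)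
  distR_nat₁ f _ _ := P.hom_ext (distR_nat₁ f.hom _ _)
  distR_nat₂ _ _ _ f _ := P.hom_ext (distR_nat₂ _ f.hom _)
  distR_nat₃ _ _ _ _ f := P.hom_ext (distR_nat₃ _ _ f.hom)
  distL_unit_left _ _ := P.hom_ext (distL_unit_left _ _)
  distL_unit_right _ _ := P.hom_ext (distL_unit_right _ _)
  distR_unit_left _ _ := P.hom_ext (distR_unit_left _ _)
  distR_unit_right _ _ := P.hom_ext (distR_unit_right _ _)
  distL_tensor _ _ _ _ := P.hom_ext (distL_tensor _ _ _ _)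
  distL_par _ _ _ _ := P.hom_ext (distL_par _ _ _ _)
  distR_tensor _ _ _ _ := P.hom_ext (distR_tensor _ _ _ _)
  distR_par _ _ _ _ := P.hom_ext (distR_par _ _ _ _)
  distL_distR _ _ _ _ := P.hom_ext (distL_distR _ _ _ _)
  distR_distL _ _ _ _ := P.hom_ext (distR_distL _ _ _ _)

variable {P} in
/-- A linear adjunction between objects of a full subcategory. -/
def fullAdj {X Y : P.FullSubcategory} (a : LinearAdjoint X.obj Y.obj) : LinearAdjoint X Y where
  τ := ObjectProperty.homMk a.τ
  γ := ObjectProperty.homMk a.γ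
  triangle_left := P.hom_ext a.triangle_left
  triangle_right := P.hom_ext a.triangle_right

scoped instance starAutonomous : StarAutonomous P.FullSubcategory where
  perp X := ⟨perp X.obj, hP.out.perp X.property⟩
  prep X := ⟨prep X.obj, hP.out.prep X.property⟩
  perpAdj X := fullAdj (perpAdj X.obj)
  prepAdj X := fullAdj (prepAdj X.obj)

end StarClosed

open StarClosed

variable {C : Type u} [Category.{v} C] [StarAutonomous C] (P : ObjectProperty C)
  [hP : Fact (IsStarClosed P)]

/-- The inclusion of a full subcategory which is closed under the operations. -/
def inclusionLD : LDFunctor P.ι where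
  tens := P.monoidalι
  par := @ObjectProperty.monoidalι C _ ParCategory.par P (isMonoidal_par P)
  map_distL X Y Z := by
    change X.obj ◁ 𝟙 (Y.obj ⅋ Z.obj) ≫ 𝟙 (X.obj ⊗ (Y.obj ⅋ Z.obj)) ≫ distL X.obj Y.obj Z.obj =
      distL X.obj Y.obj Z.obj ≫ parRight (𝟙 (X.obj ⊗ Y.obj)) Z.obj ≫ 𝟙 _
    simp
  map_distR X Y Z := by
    change 𝟙 (X.obj ⅋ Y.obj) ▷ Z.obj ≫ 𝟙 ((X.obj ⅋ Y.obj) ⊗ Z.obj) ≫ distR X.obj Y.obj Z.obj =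
      distR X.obj Y.obj Z.obj ≫ parLeft X.obj (𝟙 (Y.obj ⊗ Z.obj)) ≫ 𝟙 _
    simp

theorem inclusionLD_mapPairing {X Y : P.FullSubcategory}
    (ω : X ⊗ Y ⟶ parUnit P.FullSubcategory) : (inclusionLD P).mapPairing ω = ω.hom :=
  (Category.id_comp _).trans (Category.comp_id _)

theorem inclusionLD_isStarStrict : (inclusionLD P).IsStarStrict where
  μ _ _ := ⟨rfl, rfl⟩
  ε := ⟨rfl, rfl⟩
  parμ _ _ := ⟨rfl, rfl⟩
  parε := ⟨rfl, rfl⟩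
  perp X := isIdentity_lCurry _ rfl
    (sameArrow_iff.2 (inclusionLD_mapPairing P (perpAdj X).γ))
  prep X := isIdentity_rCurry _ rfl
    (sameArrow_iff.2 (inclusionLD_mapPairing P (prepAdj X).γ))

theorem HasStrictNegations.fullSubcategory (h : HasStrictNegations C) :
    HasStrictNegations P.FullSubcategory where
  perp_par p q := isIdentity_of_hom (h.perp_par p.obj q.obj)
  perp_tensor p q := isIdentity_of_hom (h.perp_tensor p.obj q.obj)
  perp_parUnit := isIdentity_of_hom h.perp_parUnit
  perp_unit := isIdentity_of_hom h.perp_unit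
  prep_par p q := isIdentity_of_hom (h.prep_par p.obj q.obj)
  prep_tensor p q := isIdentity_of_hom (h.prep_tensor p.obj q.obj)
  prep_parUnit := isIdentity_of_hom h.prep_parUnit
  prep_unit := isIdentity_of_hom h.prep_unit
  perp_prep p := isIdentity_of_hom (h.perp_prep p.obj)
  prep_perp p := isIdentity_of_hom (h.prep_perp p.obj)

/-- The restriction of a cycle to a full subcategory. -/
def StarCycle.restrict (σ : StarCycle C) : StarCycle P.FullSubcategory where
  iso X := P.isoMk (σ.iso X.obj)
  naturality f := P.hom_ext (σ.naturality f.hom)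
  tensor X Y := P.hom_ext (σ.tensor X.obj Y.obj)
  par X Y := P.hom_ext (σ.par X.obj Y.obj)

theorem StarCycle.mapPairing_restrict (σ : StarCycle C) {X Y : P.FullSubcategory}
    (ω : X ⊗ Y ⟶ parUnit P.FullSubcategory) :
    (inclusionLD P).mapPairing ((σ.restrict P).rotate ω) =
      σ.rotate ((inclusionLD P).mapPairing ω) := by
  rw [inclusionLD_mapPairing, inclusionLD_mapPairing]
  rfl

end FullSubcategory

/-! ### The isomorphisms between right and left duals induced by a cycle. -/

namespace LinearAdjoint

variable {C : Type u} [Category.{v} C] [StarAutonomous C] (σ : StarCycle C)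

theorem lCurry_lCurry {x y y' : C} (a : LinearAdjoint x y) (b : LinearAdjoint x y') :
    a.lCurry b.γ ≫ b.lCurry a.γ = 𝟙 y' := by
  apply b.hom_ext_right
  rw [MonoidalCategory.whiskerLeft_comp, Category.assoc, b.whiskerLeft_lCurry,
    a.whiskerLeft_lCurry]
  simp

theorem rCurry_rCurry {x x' y : C} (a : LinearAdjoint x y) (b : LinearAdjoint x' y) :
    a.rCurry b.γ ≫ b.rCurry a.γ = 𝟙 x' := by
  apply b.hom_ext_left
  rw [comp_whiskerRight, Category.assoc, b.whiskerRight_rCurry, a.whiskerRight_rCurry]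
  simp

/-- The isomorphism between right and left duals of one object induced by a cycle. -/
def cycleIso {w x y : C} (a : LinearAdjoint w x) (b : LinearAdjoint x y) : y ≅ w :=
  ({ hom := (perpAdj x).lCurry b.γ, inv := b.lCurry (perpAdj x).γ,
     hom_inv_id := lCurry_lCurry _ _, inv_hom_id := lCurry_lCurry _ _ } : y ≅ perp x) ≪≫
  σ.iso x ≪≫
  ({ hom := a.rCurry (prepAdj x).γ, inv := (prepAdj x).rCurry a.γ,
     hom_inv_id := rCurry_rCurry _ _, inv_hom_id := rCurry_rCurry _ _ } : prep x ≅ w)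

/-- This equation characterizes the isomorphism without the chosen duals, which cancel from its
definition; the facts below about a single cycle component rest on it. -/
theorem cycleIso_hom_whiskerRight {w x y : C} (a : LinearAdjoint w x) (b : LinearAdjoint x y) :
    (cycleIso σ a b).hom ▷ x ≫ a.γ = σ.rotate b.γ := by
  simp only [cycleIso, Iso.trans_hom, comp_whiskerRight, Category.assoc, a.whiskerRight_rCurry,
    StarCycle.rotate]

/-- One side of the mate equation is the rotation of `b.γ`. Rotating once more gives `b.γ` back by
involutivity, while the other side becomes `b.γ` preceded by an isomorphism and its inverse. -/
theorem isMate_cycleIso {w x y z : C} (a : LinearAdjoint w x) (b : LinearAdjoint x y)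
    (c : LinearAdjoint y z) :
    IsMate c a (cycleIso σ a b).hom (cycleIso σ b c).inv := by
  unfold IsMate
  rw [cycleIso_hom_whiskerRight]
  apply σ.rotate_injective
  rw [σ.rotate_rotate, σ.rotate_whiskerLeft, ← cycleIso_hom_whiskerRight σ b c,
    ← comp_whiskerRight_assoc, Iso.inv_hom_id, id_whiskerRight, Category.id_comp]

theorem isMate_cycleIso_inv {w x y z : C} (a : LinearAdjoint w x) (b : LinearAdjoint x y)
    (c : LinearAdjoint y z) :
    IsMate a c (cycleIso σ a b).inv (cycleIso σ b c).hom := by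
  have h : (cycleIso σ a b).hom ▷ x ≫ a.γ = y ◁ (cycleIso σ b c).inv ≫ c.γ :=
    isMate_cycleIso σ a b c
  unfold IsMate
  have h' : c.γ = y ◁ (cycleIso σ b c).hom ≫ (cycleIso σ a b).hom ▷ x ≫ a.γ := by
    rw [h, ← MonoidalCategory.whiskerLeft_comp_assoc]
    simp
  rw [h', ← whisker_exchange_assoc, ← comp_whiskerRight_assoc]
  simp

/-- Paired with `a`, the isomorphism is the double rotation of `a.γ`, which is `a.γ`. -/
theorem isIdentity_cycleIso {w x y : C} (a : LinearAdjoint w x) (b : LinearAdjoint x y) (h : y = w)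
    (hb : SameArrow b.γ (σ.rotate a.γ)) : IsIdentity (cycleIso σ a b).hom := by
  subst h
  have : (cycleIso σ a b).hom = 𝟙 _ := by
    apply a.hom_ext_left
    rw [cycleIso_hom_whiskerRight, sameArrow_iff.1 hb, σ.rotate_rotate]
    simp
  rw [this]
  exact isIdentity_id _

/-- Two successive rotations cancel, which makes the counits of a fixed string periodic with period
two. -/
theorem sameArrow_of_rotate {w x y z : C} (a : LinearAdjoint w x) (b : LinearAdjoint x y)
    (c : LinearAdjoint y z) (h : y = w) (h' : z = x) (hb : SameArrow b.γ (σ.rotate a.γ))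
    (hc : SameArrow c.γ (σ.rotate b.γ)) : SameArrow c.γ a.γ := by
  subst h h'
  rw [sameArrow_iff] at hb hc ⊢
  rw [hc, hb, σ.rotate_rotate]

end LinearAdjoint

/-! ### The equivalence with canonical strings. -/

namespace ZString

variable {C : Type u} [Category.{v} C] [StarAutonomous C]

theorem zero_map_lift_id (p : ZString C) :
    (zero C).map (lift (𝟙 (p.obj 0)) : canonical (p.obj 0) ⟶ p) = 𝟙 (p.obj 0) :=
  zero_map_lift _

theorem zero_map_lift_id' (p : ZString C) :
    (zero C).map (lift (𝟙 (p.obj 0)) : p ⟶ canonical (p.obj 0)) = 𝟙 (p.obj 0) :=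
  zero_map_lift _

/-- The canonical string of `p 0` is isomorphic to `p`. -/
def counitIso (p : ZString C) : canonical (p.obj 0) ≅ p where
  hom := lift (𝟙 (p.obj 0))
  inv := lift (𝟙 (p.obj 0))
  hom_inv_id := (zero C).map_injective
    ((congrArg₂ (fun f g : p.obj 0 ⟶ p.obj 0 => f ≫ g) (zero_map_lift_id p)
      (zero_map_lift_id' p)).trans (Category.comp_id _))
  inv_hom_id := (zero C).map_injective
    ((congrArg₂ (fun f g : p.obj 0 ⟶ p.obj 0 => f ≫ g) (zero_map_lift_id' p)
      (zero_map_lift_id p)).trans (Category.comp_id _))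

variable (C) in
/-- The equivalence between a star-autonomous category and its category of strings. -/
noncomputable def equivalence : C ≌ ZString C where
  functor := canonicalFunctor C
  inverse := zero C
  -- The canonical string of `p` has `p` itself at index `0`, so the unit is an identity.
  unitIso := NatIso.ofComponents (fun p => Iso.refl p)
    (fun f => (Category.comp_id f).trans (Category.id_comp f).symm)
  counitIso := NatIso.ofComponents counitIso
    (fun {p q} f => (zero C).map_injective
      ((congrArg (fun g : q.obj 0 ⟶ q.obj 0 => (zero C).map f ≫ g) (zero_map_lift_id q)).trans
        ((Category.comp_id _).trans ((Category.id_comp _).symm.trans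
          (congrArg (fun g : p.obj 0 ⟶ p.obj 0 => g ≫ (zero C).map f)
            (zero_map_lift_id p)).symm))))
  functor_unitIso_comp p := (zero C).map_injective
    ((congrArg (fun g : p ⟶ p => 𝟙 p ≫ g) (zero_map_lift_id (canonical p))).trans
      (Category.comp_id _))

/-! ### The induced cycle -/

variable (σ : StarCycle C)

/-- The cycle on strings induced by a cycle. -/
noncomputable def inducedCycle : StarCycle (ZString C) :=
  (σ.rotation.lift (zeroLD C)).toCycle

theorem mapPairing_inducedCycle {p t : ZString C} (ω : p ⊗ t ⟶ parUnit (ZString C)) :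
    (zeroLD C).mapPairing ((inducedCycle σ).rotate ω) = σ.rotate ((zeroLD C).mapPairing ω) := by
  rw [inducedCycle, Rotation.toCycle_rotate, Rotation.mapPairing_lift]
  rfl

theorem isMate_cycleIso (p : ZString C) {i j j' k k' l : ℤ} (hj : j = i + 1) (hj' : j' = i + 1)
    (hk : k = j + 1) (hk' : k' = j' + 1) (hjk : k' = j + 1) (hl : l = k + 1) (hl' : l = k' + 1) :
    IsMate (p.adj k l hl) (p.adj i j' hj')
      (LinearAdjoint.cycleIso σ (p.adj i j hj) (p.adj j k hk)).hom
      (LinearAdjoint.cycleIso σ (p.adj j' k' hk') (p.adj k' l hl')).inv := by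
  obtain rfl : j' = j := by omega
  obtain rfl : k' = k := by omega
  exact LinearAdjoint.isMate_cycleIso σ _ _ _

theorem isMate_cycleIso_inv (p : ZString C) {i j j' k k' l : ℤ} (hj : j = i + 1)
    (hj' : j' = i + 1) (hk : k = j + 1) (hk' : k' = j' + 1) (hl : l = k + 1) (hl' : l = k' + 1) :
    IsMate (p.adj i j' hj') (p.adj k l hl)
      (LinearAdjoint.cycleIso σ (p.adj i j hj) (p.adj j k hk)).inv
      (LinearAdjoint.cycleIso σ (p.adj j' k' hk') (p.adj k' l hl')).hom := by
  obtain rfl : j' = j := by omega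
  obtain rfl : k' = k := by omega
  exact LinearAdjoint.isMate_cycleIso_inv σ _ _ _

/-- The isomorphism between the two shifts of a string given by a cycle. -/
def shiftIso (p : ZString C) : p.succ ≅ p.pred where
  hom := ({
    even := fun n _ => (LinearAdjoint.cycleIso σ (p.adj (n - 1) n (by omega))
      (p.adj n (n + 1) rfl)).hom
    odd := fun n _ => (LinearAdjoint.cycleIso σ (p.adj (n - 1) n (by omega))
      (p.adj n (n + 1) rfl)).inv
    mate_even := fun m n h _ _ => isMate_cycleIso σ p _ _ _ _ (by omega) _ _
    mate_odd := fun m n h _ _ => isMate_cycleIso_inv σ p _ _ _ _ _ _ } : Hom p.succ p.pred)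
  inv := ({
    even := fun n _ => (LinearAdjoint.cycleIso σ (p.adj (n - 1) n (by omega))
      (p.adj n (n + 1) rfl)).inv
    odd := fun n _ => (LinearAdjoint.cycleIso σ (p.adj (n - 1) n (by omega))
      (p.adj n (n + 1) rfl)).hom
    mate_even := fun m n h _ _ => isMate_cycleIso_inv σ p _ _ _ _ _ _
    mate_odd := fun m n h _ _ => isMate_cycleIso σ p _ _ _ _ (by omega) _ _ } : Hom p.pred p.succ)
  hom_inv_id := Hom.ext_zero (Iso.hom_inv_id _)
  inv_hom_id := Hom.ext_zero (Iso.inv_hom_id _)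

/-- The lifted rotation provides the axioms of a cycle, and `shiftIso` the components at all
indices. They are the same isomorphism because they agree at `0`, where both have the rotated counit
as their pairing. -/
theorem inducedCycle_iso (p : ZString C) : (inducedCycle σ).iso p = shiftIso σ p := by
  refine Iso.ext ((zero C).map_injective ?_)
  apply (p.adj (0 - 1) 0 (by omega)).hom_ext_left
  refine Eq.trans ?_ (LinearAdjoint.cycleIso_hom_whiskerRight σ _ (p.adj 0 (0 + 1) rfl)).symm
  have h := mapPairing_inducedCycle σ (perpAdj p).γ
  rw [zeroLD_mapPairing, zeroLD_mapPairing] at h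
  refine Eq.trans ?_ h
  unfold StarCycle.rotate
  rw [LinearAdjoint.lCurry_γ, Category.id_comp]
  exact ((congrArg (· ≫ _) (zero_map_whiskerRight _ _).symm).trans
    ((zero C).map_comp _ (prepAdj p).γ).symm)

theorem isInducedCycle : IsInducedCycle σ (inducedCycle σ) where
  even p n hn := by
    rw [inducedCycle_iso]
    exact sameArrow_iff.2 rfl
  odd p n hn := by
    rw [inducedCycle_iso]
    exact sameArrow_iff.2 rfl

end ZString

namespace ZString

open StarClosed

variable {C : Type u} [Category.{v} C] [StarAutonomous C] {σ : StarCycle C}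

/-! ### Strings which are fixed by a cycle -/

theorem IsFString.obj_eq {p : ZString C} (hp : IsFString σ p) {l m n : ℤ} (hm : m = l + 1)
    (hn : n = m + 1) : p.obj n = p.obj l := by
  obtain rfl : l = m - 1 := by omega
  subst hn
  exact (hp m).1

theorem IsFString.sameArrow {p : ZString C} (hp : IsFString σ p) {l m n : ℤ} (hm : m = l + 1)
    (hn : n = m + 1) : SameArrow (p.γ m n hn) (σ.rotate (p.γ l m hm)) := by
  obtain rfl : l = m - 1 := by omega
  subst hn
  exact (hp m).2

/-- Rotation exchanges `rbind` and `lbind` and reverses their arguments, which is exactly how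
consecutive counits of a product of strings alternate. -/
theorem sameArrow_pairAdj {x y z x' y' z' : C} {a : LinearAdjoint x y} {c : LinearAdjoint y z}
    {a' : LinearAdjoint x' y'} {c' : LinearAdjoint y' z'} (h : z = x) (h' : z' = x')
    (hc : SameArrow c.γ (σ.rotate a.γ)) (hc' : SameArrow c'.γ (σ.rotate a'.γ)) {b b' b'' : Bool}
    (hb : b' = !b) (hb' : b'' = !b') :
    pairObj b'' z z' = pairObj b x x' ∧
      SameArrow (pairAdj c c' b' b'' hb').γ (σ.rotate (pairAdj a a' b b' hb).γ) := by
  subst h h' hb hb'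
  rw [sameArrow_iff] at hc hc'
  cases b
  · refine ⟨rfl, sameArrow_iff.2 ?_⟩
    change (c.tensor c').γ = σ.rotate (a'.par a).γ
    rw [LinearAdjoint.tensor_γ, LinearAdjoint.par_γ, σ.rotate_lbind, hc, hc']
  · refine ⟨rfl, sameArrow_iff.2 ?_⟩
    change (c'.par c).γ = σ.rotate (a.tensor a').γ
    rw [LinearAdjoint.tensor_γ, LinearAdjoint.par_γ, σ.rotate_rbind, hc, hc']

variable (σ) in
theorem sameArrow_unitAdj {b b' b'' : Bool} (hb : b' = !b) (hb' : b'' = !b') :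
    unitObj C b'' = unitObj C b ∧
      SameArrow (unitAdj C b' b'' hb').γ (σ.rotate (unitAdj C b b' hb).γ) := by
  subst hb hb'
  cases b
  · exact ⟨rfl, sameArrow_iff.2 σ.rotation.rot_rightUnitor.symm⟩
  · exact ⟨rfl, sameArrow_iff.2 σ.rotation.rot_leftUnitor.symm⟩

theorem isFString_interleave {β : ℤ → Bool} (hβ : ∀ m n, n = m + 1 → β n = !β m) {p q : ZString C}
    (hp : IsFString σ p) (hq : IsFString σ q) : IsFString σ (interleave β hβ p q) :=
  fun n => sameArrow_pairAdj (hp n).1 (hq n).1 (hp n).2 (hq n).2 _ _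

theorem isFString_alternate {β : ℤ → Bool} (hβ : ∀ m n, n = m + 1 → β n = !β m) :
    IsFString σ (alternate C β hβ) :=
  fun _ => sameArrow_unitAdj σ _ _

theorem isStarClosed_isFString : IsStarClosed (IsFString σ) where
  tensor hp hq := isFString_interleave _ hp hq
  par hp hq := isFString_interleave _ hq hp
  unit := isFString_alternate _
  parUnit := isFString_alternate _
  perp {p} hp n := ⟨hp.obj_eq (m := n + 1) (by omega) rfl,
    hp.sameArrow (m := n + 1) (by omega) _⟩
  prep {p} hp n := ⟨hp.obj_eq (m := n - 1) (by omega) (by omega),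
    hp.sameArrow (m := n - 1) (by omega) _⟩

instance : Fact (IsStarClosed (IsFString σ)) := ⟨isStarClosed_isFString⟩

/-- The objects agree by hypothesis, and the counits because passing from `γ (m - 1)` to `γ (m + 1)`
is a double rotation. -/
theorem IsFString.succ_eq_pred {p : ZString C} (hp : IsFString σ p) : p.succ = p.pred := by
  refine ext_of_γ (fun n => (hp n).1) fun m n h => ?_
  subst h
  have hm : m = m - 1 + 1 := by omega
  exact (LinearAdjoint.sameArrow_of_rotate σ (p.adj (m - 1) m hm) (p.adj m (m + 1) rfl)
    (p.adj (m + 1) (m + 1 + 1) rfl) (hp m).1 (hp.obj_eq rfl rfl) (hp m).2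
    (hp.sameArrow rfl rfl)).trans (p.sameArrow_γ hm (by omega) rfl)

/-- Since the two shifts are the same string, only the component at `0` has to be examined. -/
theorem isIdentity_inducedCycle {p : ZString C} (hp : IsFString σ p) :
    IsIdentity ((inducedCycle σ).iso p).hom := by
  rw [inducedCycle_iso]
  exact isIdentity_of_map (zero C) hp.succ_eq_pred
    (LinearAdjoint.isIdentity_cycleIso σ _ _ (hp 0).1 (hp 0).2)

/-- `x` or `x^*` -/
def dualObj (x : C) : Bool → C
  | true => x
  | false => perp x

variable (σ) in
/-- The linear adjunctions `x ⊣ x^*` and `x^* ⊣ x`, the latter obtained from a cycle. -/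
noncomputable def dualAdj (x : C) :
    (b b' : Bool) → b' = !b → LinearAdjoint (dualObj x b) (dualObj x b')
  | true, false, _ => perpAdj x
  | false, true, _ => LinearAdjoint.ofIso (σ.iso x) (prepAdj x)

variable (σ) in
/-- The string `(…, x^*, x, x^*, x, …)` -/
noncomputable def dualString (x : C) : ZString C where
  obj n := dualObj x (isEven n)
  adj m n h := dualAdj σ x _ _ (isEven_succ m n h)

/-- The adjunction `x^* ⊣ x` obtained from the cycle has as its counit the rotation of the counit of
`x ⊣ x^*`; the condition at the other parity is then involutivity. -/
theorem isFString_dualString (x : C) : IsFString σ (dualString σ x) := by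
  have h : (LinearAdjoint.ofIso (σ.iso x) (prepAdj x)).γ = σ.rotate (perpAdj x).γ := by
    rw [LinearAdjoint.ofIso_γ, StarCycle.rotate, LinearAdjoint.lCurry_γ, Category.id_comp]
  have key : ∀ {b b' b'' : Bool} (hb : b' = !b) (hb' : b'' = !b'),
      dualObj x b'' = dualObj x b ∧
        SameArrow (dualAdj σ x b' b'' hb').γ (σ.rotate (dualAdj σ x b b' hb).γ) := by
    intro b b' b'' hb hb'
    subst hb hb'
    cases b
    · exact ⟨rfl, sameArrow_iff.2 ((σ.rotate_rotate _).symm.trans (congrArg σ.rotate h.symm))⟩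
    · exact ⟨rfl, sameArrow_iff.2 h⟩
  exact fun n => key _ _

variable (σ) in
/-- The inclusion of `Fang` followed by `zero`. -/
noncomputable def fangZeroLD : LDFunctor ((IsFString σ).ι ⋙ zero C) :=
  (inclusionLD (IsFString σ)).comp (zeroLD C)

/-- A canonical string need not be fixed by the cycle; the alternating string of `x` is, and it has
`x` itself at index `0`. -/
instance : ((IsFString σ).ι ⋙ zero C).EssSurj where
  mem_essImage x := ⟨⟨dualString σ x, isFString_dualString x⟩, ⟨Iso.refl x⟩⟩

instance : ((IsFString σ).ι ⋙ zero C).IsEquivalence where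

variable (σ) in
/-- The equivalence between a cyclic star-autonomous category and the category of the strings
which are fixed by its cycle. -/
noncomputable def fangEquivalence : C ≌ Fang σ := ((IsFString σ).ι ⋙ zero C).asEquivalence.symm

theorem fangZeroLD_mapPairing {p t : Fang σ} (ω : p ⊗ t ⟶ parUnit (Fang σ)) :
    (fangZeroLD σ).mapPairing (((inducedCycle σ).restrict (IsFString σ)).rotate ω) =
      σ.rotate ((fangZeroLD σ).mapPairing ω) := by
  rw [fangZeroLD, LDFunctor.mapPairing_comp, StarCycle.mapPairing_restrict,
    mapPairing_inducedCycle, LDFunctor.mapPairing_comp]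

theorem isStrictNegation_restrict :
    ((inducedCycle σ).restrict (IsFString σ)).IsStrictNegation where
  hasStrictNegations := (hasStrictNegations C).fullSubcategory _
  isIdentity p := isIdentity_of_hom (isIdentity_inducedCycle p.property)

end ZString

end StarAut

/-! ### The theorem. -/

theorem lemma5p3 {K : Type u} [Category.{v} K] [StarAutonomous K] :
    -- the star-autonomous structure on the category of strings, which has strict negations
    ∃ S : StarAutonomous (ZString K),
      ZString.IsStandard K ∧ HasStrictNegations (ZString K) ∧
      -- the adjoint equivalence between `K` and the category of strings
      ∃ (E : K ≌ ZString K) (L : LDEquivalence E),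
        E.functor = ZString.canonicalFunctor K ∧ E.inverse = ZString.zero K ∧
        L.inverse.IsStrict ∧
        ∀ σ : StarCycle K,
          -- the induced cycle on strings
          ∃ ς : StarCycle (ZString K),
            ZString.IsInducedCycle σ ς ∧
            L.functor.PreservesCycle σ ς ∧ L.inverse.PreservesCycle ς σ ∧
            -- the strings fixed by `σ` are closed under the operations, and `ς` is the identity
            IsStarClosed (ZString.IsFString σ) ∧
            (∀ p : ZString K, ZString.IsFString σ p → IsIdentity (ς.iso p).hom) ∧
            -- the resulting cyclic star-autonomous category has a strict negation
            ∃ (S' : StarAutonomous (ZString.Fang σ)) (ς' : StarCycle (ZString.Fang σ)),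
              (∃ M : LDFunctor (ZString.IsFString σ).ι,
                M.IsStarStrict ∧ M.PreservesCycle ς' ς) ∧
              ς'.IsStrictNegation ∧
              -- and it is equivalent to `K`
              ∃ (E' : K ≌ ZString.Fang σ) (L' : LDEquivalence E'),
                E'.inverse = (ZString.IsFString σ).ι ⋙ ZString.zero K ∧
                L'.inverse.IsStrict ∧
                L'.functor.PreservesCycle σ ς' ∧ L'.inverse.PreservesCycle ς' σ := by
  open scoped ZString StarClosed in
  refine ⟨ZString.starAutonomous, ZString.isStandard K, ZString.hasStrictNegations K,
    ZString.equivalence K, LDEquivalence.ofInverse _ (ZString.zeroLD K), rfl, rfl,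
    ZString.zeroLD_isStrict, fun σ => ⟨ZString.inducedCycle σ, ZString.isInducedCycle σ,
    LDEquivalence.functor_preservesCycle _ (ZString.mapPairing_inducedCycle σ),
    LDFunctor.preservesCycle _ fun _ => ZString.mapPairing_inducedCycle σ _,
    ZString.isStarClosed_isFString, fun _ => ZString.isIdentity_inducedCycle,
    StarClosed.starAutonomous _, (ZString.inducedCycle σ).restrict _,
    ⟨inclusionLD _, inclusionLD_isStarStrict _,
      LDFunctor.preservesCycle _ fun _ => StarCycle.mapPairing_restrict _ _ _⟩,
    ZString.isStrictNegation_restrict, ZString.fangEquivalence σ,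
    LDEquivalence.ofInverse _ (ZString.fangZeroLD σ), rfl,
    (inclusionLD_isStarStrict _).toIsStrict.comp ZString.zeroLD_isStrict,
    LDEquivalence.functor_preservesCycle _ ZString.fangZeroLD_mapPairing,
    LDFunctor.preservesCycle _ fun _ => ZString.fangZeroLD_mapPairing _⟩⟩
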